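/- Let $d\ge 1$ be an integer and let $\alpha,\beta\in(0,1]$. All complex powers are principal values: $i^\beta=e^{i\pi\beta/2}$ and $(-i)^\beta=e^{-i\pi\beta/2}$. Let $\|\cdot\|$ be the norm of $L^2(\mathbb R^d)$, let $$\mathcal F u(\xi)=\hat u(\xi)=(2\pi)^{-d/2}\int_{\mathbb R^d}e^{-ix\cdot\xi}u(x)\,dx$$ be the unitary Fourier transform on $L^2(\mathbb R^d)$, and let $\mathcal F^*$ be its adjoint. Let $H_0=-\Delta$ with domain $D(H_0)=H^2(\mathbb R^d)$. For $\gamma\ge 1$ let $H_0^\gamma v=\mathcal F^*(|\xi|^{2\gamma}\hat v)$ with domain $D(H_0^\gamma)=\{v\in L^2(\mathbb R^d): |\xi|^{2\gamma}\hat v\in L^2(\mathbb R^d)\}$ and norm $\|v\|_{D(H_0^\gamma)}=(\|v\|^2+\|H_0^\gamma v\|^2)^{1/2}$. Put $$\mathcal U_{\alpha,\beta}=\begin{cases}D(H_0)&\text{if }\beta>\alpha,\\ D(H_0^{1/\alpha})&\text{if }\beta=\alpha,\\ \mathcal F^*\mathcal C_0(\mathbb R^d)&\text{if }\beta<\alpha,\end{cases}\qquad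 \|v\|_{\mathcal U_{\alpha,\beta}}=\begin{cases}\|v\|_{D(H_0)}&\text{if }\beta>\alpha,\\ \|v\|_{D(H_0^{1/\alpha})}&\text{if }\beta\le\alpha,\end{cases}$$ where $\mathcal C_0(\mathbb R^d)$ is the space of compactly supported continuous functions on $\mathbb R^d$. Let $E_{\alpha,1}(z)=\sum_{n\ge 0}z^n/\Gamma(\alpha n+1)$ be the Mittag-Leffler function. Let $\partial_t^\alpha$ be the Caputo derivative $$\partial_t^\alpha u(t)=\frac1{\Gamma(1-\alpha)}\int_0^t\frac{u'(s)}{(t-s)^\alpha}\,ds\quad(0<\alpha<1),\qquad \partial_t^1u=u',$$ where $u'$ is the weak derivative and the integral is required to converge absolutely in $L^2(\mathbb R^d)$ for a.e. $t$. For $T\in(0,\infty]$, a solution on $(0,T)$ of $$-i^\beta\partial_t^\alpha u+H_0u=0,\qquad u(\cdot,0)=u_0 \tag{$*$}$$ is a function $u\in L^1_{\rm loc}((0,T);D(H_0))\cap W^{1,1}_{\rm loc}((0,T);L^2(\mathbb R^d))$, identified with its representative that is continuous in time with values in $L^2(\mathbb R^d)$, which satisfies the equation a.e. on $\mathbb R^d\times(0,T)$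 and $\lim_{t\downarrow0}\|u(\cdot,t)-u_0\|=0$. **Proposition.** There is a constant $C>0$, depending only on $\alpha$, $\beta$ and $d$, such that the following holds for every $u_0\in\mathcal U_{\alpha,\beta}$. The system $(*)$ has a unique solution $u$ on $(0,\infty)$, and for every $T\in(0,\infty)$ its restriction to $(0,T)$ is the unique solution on $(0,T)$. With $u(\cdot,0)=u_0$, the solution is given by $$u(\cdot,t)=\mathcal F^*\big(E_{\alpha,1}((-i)^\beta|\cdot|^2t^\alpha)\,\hat u_0\big),\qquad t\ge 0.$$ Moreover, for every $T\in(0,\infty)$, $u\in\mathcal C([0,T];D(H_0))\cap W^{1,1}(0,T;L^2(\mathbb R^d))$, and if $\beta\ge\alpha$, then $$\|u\|_{\mathcal C([0,T];D(H_0))}+\|u\|_{W^{1,1}(0,T;L^2(\mathbb R^d))}\le C(1+T)\,\|u_0\|_{\mathcal U_{\alpha,\beta}},$$ whereas if $\beta<\alpha$, then $$\|u\|_{\mathcal C([0,T];D(H_0))}+\|u\|_{W^{1,1}(0,T;L^2(\mathbb R^d))}\le C(1+T)\,e^{\cos\left(\frac{\pi\beta}{2\alpha}\right)\Lambda^{2/\alpha}T}\,\|u_0\|_{\mathcal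 U_{\alpha,\beta}},$$ where $\Lambda=\max\{|\xi|:\xi\in\operatorname{supp}\hat u_0\}$ (and $\Lambda=0$ if $u_0=0$). -/

import Mathlib

open MeasureTheory Filter Topology Set
open scoped ENNReal NNReal FourierTransform SchwartzMap ContDiff Laplacian

noncomputable section

namespace TFSE

/-! ### The spaces -/

/-- The Euclidean space `ℝ^d`. -/
abbrev Sp (d : ℕ) : Type := EuclideanSpace ℝ (Fin d)

/-- The complex Hilbert space `L²(ℝ^d)`. -/
abbrev L2 (d : ℕ) : Type := Lp ℂ 2 (volume : Measure (Sp d))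

/-! ### The unitary Fourier transform

`û(ξ) = (2π)^(-d/2) ∫ exp(-i x·ξ) u(x) dx`.  Mathlib's transform has the kernel
`exp(-2πi x·ξ)`, so it is followed by the unitary dilation by the factor `(2π)⁻¹`. -/

theorem map_dilate {d : ℕ} {c : ℝ} (hc : 0 < c) :
    Measure.map (fun x : Sp d => c • x) volume = ENNReal.ofReal ((c ^ d)⁻¹) • volume := by
  have h := Measure.map_addHaar_smul (volume : Measure (Sp d)) hc.ne'
  rw [finrank_euclideanSpace_fin, abs_of_pos (by positivity)] at h
  exact h

theorem quasi_dilate {d : ℕ} {c : ℝ} (hc : 0 < c) :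
    Measure.QuasiMeasurePreserving (fun x : Sp d => c • x) volume volume := by
  refine ⟨measurable_const_smul c, ?_⟩
  rw [map_dilate hc]
  exact Measure.smul_absolutelyContinuous

theorem memLp_dilate {d : ℕ} {c : ℝ} (hc : 0 < c) (f : L2 d) :
    MemLp (fun x : Sp d => ((c ^ ((d : ℝ) / 2) : ℝ) : ℂ) * f (c • x)) 2 volume := by
  have h1 : MemLp (f : Sp d → ℂ) 2 (Measure.map (fun x : Sp d => c • x) volume) := by
    rw [map_dilate hc]
    exact (Lp.memLp f).smul_measure ENNReal.ofReal_ne_top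
  exact (h1.comp_of_map (measurable_const_smul c).aemeasurable).const_mul _

theorem eLpNorm_dilate {d : ℕ} {c : ℝ} (hc : 0 < c) (f : L2 d) :
    eLpNorm (fun x : Sp d => ((c ^ ((d : ℝ) / 2) : ℝ) : ℂ) * f (c • x)) 2 volume
      = eLpNorm f 2 volume := by
  have h0 : (fun x : Sp d => ((c ^ ((d : ℝ) / 2) : ℝ) : ℂ) * f (c • x))
      = ((c ^ ((d : ℝ) / 2) : ℝ) : ℂ) • ((f : Sp d → ℂ) ∘ fun x => c • x) := rfl
  have hm : AEStronglyMeasurable (f : Sp d → ℂ)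
      (Measure.map (fun x : Sp d => c • x) volume) := by
    rw [map_dilate hc]
    exact (Lp.aestronglyMeasurable f).smul_measure _
  rw [h0, eLpNorm_const_smul, ← eLpNorm_map_measure hm (measurable_const_smul c).aemeasurable,
    map_dilate hc, eLpNorm_smul_measure_of_ne_top (by norm_num), smul_eq_mul, ← mul_assoc]
  have h1 : ‖((c ^ ((d : ℝ) / 2) : ℝ) : ℂ)‖ₑ = ENNReal.ofReal (c ^ ((d : ℝ) / 2)) := by
    rw [← ofReal_norm, Complex.norm_real, Real.norm_of_nonneg (by positivity)]
  rw [h1, ENNReal.ofReal_rpow_of_nonneg (by positivity) (by positivity),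
    ← ENNReal.ofReal_mul (by positivity), Real.inv_rpow (by positivity),
    ← Real.rpow_natCast, ← Real.rpow_mul hc.le]
  have h2 : (d : ℝ) * (1 / (2 : ℝ≥0∞)).toReal = (d : ℝ) / 2 := by
    simp; ring
  rw [h2, mul_inv_cancel₀ (by positivity)]
  simp

/-- The dilation `f ↦ c^(d/2) f(c ·)`, an isometry of `L²(ℝ^d)` for `c > 0`. -/
def dilateₗᵢ (d : ℕ) {c : ℝ} (hc : 0 < c) : L2 d →ₗᵢ[ℂ] L2 d where
  toFun f := (memLp_dilate hc f).toLp
  map_add' f g := by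
    apply Lp.ext
    filter_upwards [(memLp_dilate hc (f + g)).coeFn_toLp, (memLp_dilate hc f).coeFn_toLp,
      (memLp_dilate hc g).coeFn_toLp,
      Lp.coeFn_add (memLp_dilate hc f).toLp (memLp_dilate hc g).toLp,
      (quasi_dilate hc).ae (Lp.coeFn_add f g)] with x h1 h2 h3 h4 h5
    rw [h1, h4, Pi.add_apply, h2, h3, h5, Pi.add_apply, mul_add]
  map_smul' a f := by
    apply Lp.ext
    filter_upwards [(memLp_dilate hc (a • f)).coeFn_toLp, (memLp_dilate hc f).coeFn_toLp,
      Lp.coeFn_smul a (memLp_dilate hc f).toLp,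
      (quasi_dilate hc).ae (Lp.coeFn_smul a f)] with x h1 h2 h4 h5
    rw [h1, RingHom.id_apply, h4, Pi.smul_apply, h2, h5, Pi.smul_apply, smul_eq_mul, smul_eq_mul]
    ring
  norm_map' f := by
    change ‖(memLp_dilate hc f).toLp‖ = ‖f‖
    rw [Lp.norm_toLp, eLpNorm_dilate hc, Lp.norm_def]

theorem dilateₗᵢ_surjective (d : ℕ) {c : ℝ} (hc : 0 < c) :
    Function.Surjective (dilateₗᵢ d hc) := by
  intro g
  have hc' : 0 < c⁻¹ := inv_pos.mpr hc
  refine ⟨dilateₗᵢ d hc' g, ?_⟩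
  apply Lp.ext
  filter_upwards [(memLp_dilate hc (dilateₗᵢ d hc' g)).coeFn_toLp,
    (quasi_dilate hc).ae (memLp_dilate hc' g).coeFn_toLp] with x h1 h2
  change ((memLp_dilate hc (dilateₗᵢ d hc' g)).toLp) x = g x
  rw [h1]
  change _ * ((memLp_dilate hc' g).toLp) (c • x) = g x
  rw [h2, smul_smul, inv_mul_cancel₀ hc.ne', one_smul, ← mul_assoc, ← Complex.ofReal_mul,
    Real.inv_rpow hc.le, mul_inv_cancel₀ (by positivity)]
  simp

/-- The unitary Fourier transform of `L²(ℝ^d)`; its adjoint and inverse is `(fourierL2 d).symm`. -/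
def fourierL2 (d : ℕ) : L2 d ≃ₗᵢ[ℂ] L2 d :=
  (Lp.fourierTransformₗᵢ (Sp d) ℂ).trans
    (LinearIsometryEquiv.ofSurjective
      (dilateₗᵢ d (c := (2 * Real.pi)⁻¹) (by positivity)) (dilateₗᵢ_surjective d _))

/-- On Schwartz functions `fourierL2` is given by the usual integral. -/
theorem fourierL2_toLp (d : ℕ) (f : 𝓢(Sp d, ℂ)) :
    (fourierL2 d (f.toLp 2) : Sp d → ℂ) =ᵐ[volume] fun ξ =>
      (((2 * Real.pi) ^ (-(d : ℝ) / 2) : ℝ) : ℂ) *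
        ∫ x : Sp d, Complex.exp (-Complex.I * ((inner ℝ x ξ : ℝ) : ℂ)) * f x := by
  have hc : 0 < (2 * Real.pi)⁻¹ := by positivity
  have e1 : fourierL2 d (f.toLp 2) = (memLp_dilate hc ((𝓕 f).toLp 2)).toLp := by
    rw [← SchwartzMap.toLp_fourier_eq]
    rfl
  rw [e1]
  filter_upwards [(memLp_dilate hc ((𝓕 f).toLp 2)).coeFn_toLp,
    (quasi_dilate hc).ae ((𝓕 f).coeFn_toLp 2 volume)] with ξ h1 h2
  rw [h1, h2, SchwartzMap.fourier_coe, Real.fourier_eq', Real.inv_rpow (by positivity),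
    ← Real.rpow_neg (by positivity), neg_div]
  congr 1
  refine integral_congr_ae (Eventually.of_forall fun x => ?_)
  simp only [smul_eq_mul, inner_smul_right]
  congr 2
  push_cast
  have : (Real.pi : ℂ) ≠ 0 := by exact_mod_cast Real.pi_ne_zero
  field_simp

/-! ### The operator `H₀ = -Δ` and its powers -/

/-- `D(H₀) = H²(ℝ^d)`. -/
def domH0 (d : ℕ) : Set (L2 d) :=
  {v | TemperedDistribution.MemSobolev 2 2 (v : 𝓢'(Sp d, ℂ))}

theorem exists_neg_laplacian {d : ℕ} {v : L2 d} (hv : v ∈ domH0 d) :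
    ∃ w : L2 d, (w : 𝓢'(Sp d, ℂ)) = -Δ (v : 𝓢'(Sp d, ℂ)) := by
  have h := TemperedDistribution.MemSobolev.laplacian hv
  rw [sub_self, TemperedDistribution.memSobolev_zero_iff] at h
  obtain ⟨w, hw⟩ := h
  refine ⟨-w, ?_⟩
  rw [hw]
  exact map_neg (Lp.toTemperedDistributionCLM ℂ (volume : Measure (Sp d)) 2) w

open Classical in
/-- `H₀ v = -Δ v` in the sense of distributions, for `v ∈ D(H₀)` (and `0` off `D(H₀)`). -/
def H0 {d : ℕ} (v : L2 d) : L2 d :=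
  if hv : v ∈ domH0 d then (exists_neg_laplacian hv).choose else 0

theorem H0_spec {d : ℕ} {v : L2 d} (hv : v ∈ domH0 d) :
    (H0 v : 𝓢'(Sp d, ℂ)) = -Δ (v : 𝓢'(Sp d, ℂ)) := by
  rw [H0, dif_pos hv]
  exact (exists_neg_laplacian hv).choose_spec

open Classical in
/-- The product `m f` if it lies in `L²(ℝ^d)` (and `0` otherwise). -/
def mulL2 {d : ℕ} (m : Sp d → ℂ) (f : L2 d) : L2 d :=
  if h : MemLp (fun ξ => m ξ * f ξ) 2 volume then h.toLp else 0

/-- `D(H₀^γ) = {v ∈ L² : |ξ|^(2γ) v̂ ∈ L²}`. -/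
def domH0pow (d : ℕ) (γ : ℝ) : Set (L2 d) :=
  {v | MemLp (fun ξ : Sp d => ((‖ξ‖ ^ (2 * γ) : ℝ) : ℂ) * fourierL2 d v ξ) 2 volume}

/-- `H₀^γ v = F* (|ξ|^(2γ) v̂)`. -/
def H0pow {d : ℕ} (γ : ℝ) (v : L2 d) : L2 d :=
  (fourierL2 d).symm (mulL2 (fun ξ : Sp d => ((‖ξ‖ ^ (2 * γ) : ℝ) : ℂ)) (fourierL2 d v))

/-- The graph norm of `D(H₀)`. -/
def normH0 {d : ℕ} (v : L2 d) : ℝ := Real.sqrt (‖v‖ ^ 2 + ‖H0 v‖ ^ 2)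

/-- The graph norm of `D(H₀^γ)`. -/
def normH0pow {d : ℕ} (γ : ℝ) (v : L2 d) : ℝ := Real.sqrt (‖v‖ ^ 2 + ‖H0pow γ v‖ ^ 2)

/-! ### Initial data -/

/-- `F* C₀(ℝ^d)`, where `C₀` stands for compactly supported continuous functions. -/
def fourierC0 (d : ℕ) : Set (L2 d) :=
  {v | ∃ f : Sp d → ℂ, Continuous f ∧ HasCompactSupport f ∧ fourierL2 d v =ᵐ[volume] f}

/-- The space `U_{α,β}` of initial data. -/
def initialSpace (d : ℕ) (α β : ℝ) : Set (L2 d) :=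
  if α < β then domH0 d else if α = β then domH0pow d (1 / α) else fourierC0 d

/-- The norm of `U_{α,β}`. -/
def initialNorm {d : ℕ} (α β : ℝ) (v : L2 d) : ℝ :=
  if α < β then normH0 v else normH0pow (1 / α) v

/-- The support of (the class of) a function: the points near which it does not vanish a.e. -/
def suppL2 {d : ℕ} (f : L2 d) : Set (Sp d) :=
  {ξ | ∀ r > 0, ¬ ((f : Sp d → ℂ) =ᵐ[volume.restrict (Metric.ball ξ r)] 0)}

/-- `Λ = max {|ξ| : ξ ∈ supp û₀}` (equal to `0` when `u₀ = 0`). -/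
def freqRadius {d : ℕ} (u₀ : L2 d) : ℝ :=
  sSup ((fun ξ : Sp d => ‖ξ‖) '' suppL2 (fourierL2 d u₀))

/-! ### The Mittag-Leffler function -/

/-- `E_{a,c}(z) = ∑ zⁿ / Γ(a n + c)`. -/
def mittagLeffler (a c : ℝ) (z : ℂ) : ℂ :=
  ∑' n : ℕ, z ^ n / ((Real.Gamma (a * n + c) : ℝ) : ℂ)

/-! ### Functions of time with values in `L²(ℝ^d)` -/

/-- The time interval `(0,T)`, where `T = ⊤` gives `(0,∞)`. -/
def timeInterval (T : EReal) : Set ℝ := {t | 0 < t ∧ (t : EReal) < T}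

/-- `g` is the weak derivative of `u` on `J`, both being locally integrable there. -/
def HasWeakDeriv {d : ℕ} (J : Set ℝ) (u g : ℝ → L2 d) : Prop :=
  LocallyIntegrableOn u J volume ∧ LocallyIntegrableOn g J volume ∧
    ∀ φ : ℝ → ℝ, ContDiff ℝ ∞ φ → HasCompactSupport φ → tsupport φ ⊆ J →
      ∫ t in J, deriv φ t • u t = -∫ t in J, φ t • g t

/-- The Caputo derivative at time `t`, in terms of the derivative `g` of the function:
`Γ(1-α)⁻¹ ∫₀ᵗ (t-s)^(-α) g(s) ds` if `α < 1`, and `g(t)` if `α = 1`. -/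
def caputo {d : ℕ} (α : ℝ) (g : ℝ → L2 d) (t : ℝ) : L2 d :=
  if α = 1 then g t
  else (Real.Gamma (1 - α))⁻¹ • ∫ s in (0 : ℝ)..t, (t - s) ^ (-α) • g s

/-- `w` is the Caputo derivative of order `α ∈ (0,1]` of `u` on `(0,T)`: `u` is weakly
differentiable, and for a.e. `t` the integral that defines the derivative converges
absolutely in `L²(ℝ^d)` and equals `w t`. -/
def HasCaputoDeriv {d : ℕ} (α : ℝ) (T : EReal) (u w : ℝ → L2 d) : Prop :=
  ∃ g : ℝ → L2 d, HasWeakDeriv (timeInterval T) u g ∧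
    ∀ᵐ t ∂(volume.restrict (timeInterval T)),
      (α < 1 → IntervalIntegrable (fun s => (t - s) ^ (-α) • g s) volume 0 t) ∧
        w t = caputo α g t

/-- Solutions of `-i^β ∂_t^α u + H₀ u = 0` on `ℝ^d × (0,T)` with initial state `u₀`:
functions in `L¹_loc(0,T; D(H₀)) ∩ W^{1,1}_loc(0,T; L²)`, identified with their continuous
representatives, for which the equation holds a.e. and `u(t) → u₀` in `L²` as `t ↓ 0`. -/
structure IsSolution {d : ℕ} (α β : ℝ) (u₀ : L2 d) (T : EReal) (u : ℝ → L2 d) : Prop where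
  continuousOn : ContinuousOn u (timeInterval T)
  mem_dom : ∀ᵐ t ∂(volume.restrict (timeInterval T)), u t ∈ domH0 d
  locallyIntegrable_H0 : LocallyIntegrableOn (fun t => H0 (u t)) (timeInterval T) volume
  equation : ∃ w : ℝ → L2 d, HasCaputoDeriv α T u w ∧
    ∀ᵐ t ∂(volume.restrict (timeInterval T)),
      -(Complex.I ^ (β : ℂ)) • w t + H0 (u t) = 0
  initial : Tendsto u (𝓝[>] 0) (𝓝 u₀)

/-- `u ∈ C([0,T]; D(H₀))`, with the graph norm on `D(H₀)`. -/
def MemCDom {d : ℕ} (T : ℝ) (u : ℝ → L2 d) : Prop :=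
  (∀ t ∈ Icc 0 T, u t ∈ domH0 d) ∧ ContinuousOn u (Icc 0 T) ∧
    ContinuousOn (fun t => H0 (u t)) (Icc 0 T)

/-- `u ∈ W^{1,1}(0,T; L²)`. -/
def MemW11 {d : ℕ} (T : ℝ) (u : ℝ → L2 d) : Prop :=
  IntegrableOn u (Ioo 0 T) volume ∧
    ∃ g : ℝ → L2 d, HasWeakDeriv (Ioo 0 T) u g ∧ IntegrableOn g (Ioo 0 T) volume

/-- The norm of `C([0,T]; D(H₀))`, with values in `[0,∞]`. -/
def eNormCDom {d : ℕ} (T : ℝ) (u : ℝ → L2 d) : ℝ≥0∞ :=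
  ⨆ t ∈ Icc 0 T, ENNReal.ofReal (normH0 (u t))

/-- The norm of `W^{1,1}(0,T; L²)`, with values in `[0,∞]`; the infimum runs over the weak
derivatives of `u`, which agree a.e. -/
def eNormW11 {d : ℕ} (T : ℝ) (u : ℝ → L2 d) : ℝ≥0∞ :=
  (∫⁻ t in Ioo 0 T, ‖u t‖ₑ) +
    ⨅ (g : ℝ → L2 d) (_ : HasWeakDeriv (Ioo 0 T) u g), ∫⁻ t in Ioo 0 T, ‖g t‖ₑ

end TFSE

end

/-!
Under the Fourier transform the system becomes, for each `ξ`, a scalar fractional equation with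
solution `E_{α,1}((-i)^β |ξ|² t^α) û₀(ξ)`, and everything depends on the growth of
`E_{α,b}((-i)^β r)` as `r → ∞`.  Writing `1/Γ` as a Hankel integral and summing the series under the
integral sign represents `E_{α,b}` by a contour integral.  If `β > α`, the ray `(-i)^β r` lies in
the sector where the contour meets no pole, and `E_{α,b}` is bounded on it.  If `β ≤ α`, one pole
contributes `α⁻¹ z^((1-b)/α) exp(z^(1/α))`, whose modulus on the ray is
`α⁻¹ r^((1-b)/α) exp(cos(πβ/2α) r^(1/α))`; with `r = |ξ|² t^α` this is the exponential in the
estimate.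

For uniqueness, a cutoff to a ball of frequencies replaces `H₀` by a bounded operator. Integrating
the equation against the Abel kernel turns it into a Volterra equation with a weakly singular
kernel, whose only solution with vanishing initial state is zero.
-/

noncomputable section

namespace TFSE

open scoped Real

/-! ### Hankel contours in logarithmic coordinates -/

/-- The three pieces of the Hankel contour in the coordinate `w = log p`: the segment `Re w = R`,
`|Im w| ≤ φ`, and the half lines `Im w = ±φ`, `Re w > R`. In this coordinate the complex powers of
`p` become exponentials and no branch cut is needed. -/
def hankelPath (φ R : ℝ) : Fin 3 → ℝ → ℂ
  | 0, y => R + y * Complex.I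
  | 1, x => x + φ * Complex.I
  | 2, x => x - φ * Complex.I

/-- The parameter measures on the three pieces of the Hankel contour. -/
def hankelMeasure (φ R : ℝ) : Fin 3 → Measure ℝ
  | 0 => volume.restrict (Ioc (-φ) φ)
  | 1 => volume.restrict (Ioi R)
  | 2 => volume.restrict (Ioi R)

/-- The derivative of the parametrization of the pieces of the Hankel contour, with orientation. -/
def hankelCoeff : Fin 3 → ℂ
  | 0 => Complex.I
  | 1 => 1
  | 2 => -1

/-- The integral of `F` over the Hankel contour, divided by `2πi`. -/
def hankel (φ R : ℝ) (F : ℂ → ℂ) : ℂ :=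
  (2 * π * Complex.I)⁻¹ *
    ∑ j, hankelCoeff j * ∫ x, F (hankelPath φ R j x) ∂(hankelMeasure φ R j)

/-- Absolute integrability of `F` over the Hankel contour. -/
def HankelIntegrable (φ R : ℝ) (F : ℂ → ℂ) : Prop :=
  ∀ j, Integrable (fun x => F (hankelPath φ R j x)) (hankelMeasure φ R j)

/-- The closed half strip bounded by the Hankel contour. -/
def halfStrip (φ R : ℝ) : Set ℂ := Ici R ×ℂ Icc (-φ) φ

theorem continuous_hankelPath (φ R : ℝ) (j : Fin 3) : Continuous (hankelPath φ R j) := by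
  fin_cases j
  · exact continuous_const.add (Complex.continuous_ofReal.mul continuous_const)
  · exact Complex.continuous_ofReal.add continuous_const
  · exact Complex.continuous_ofReal.sub continuous_const

theorem ae_hankelPath_mem_halfStrip {φ : ℝ} (hφ : 0 ≤ φ) (R : ℝ) (j : Fin 3) :
    ∀ᵐ x ∂(hankelMeasure φ R j), hankelPath φ R j x ∈ halfStrip φ R := by
  fin_cases j
  · refine ae_restrict_of_forall_mem measurableSet_Ioc fun y hy => ?_
    simpa [hankelPath, halfStrip, Complex.mem_reProdIm] using And.intro hy.1.le hy.2
  · refine ae_restrict_of_forall_mem measurableSet_Ioi fun x hx => ?_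
    simpa [hankelPath, halfStrip, Complex.mem_reProdIm, hφ, neg_le_self hφ] using le_of_lt hx
  · refine ae_restrict_of_forall_mem measurableSet_Ioi fun x hx => ?_
    simpa [hankelPath, halfStrip, Complex.mem_reProdIm, hφ, neg_le_self hφ] using le_of_lt hx

theorem aestronglyMeasurable_hankelPath {φ R : ℝ} (hφ : 0 ≤ φ) {F : ℂ → ℂ}
    (hF : ContinuousOn F (halfStrip φ R)) (j : Fin 3) :
    AEStronglyMeasurable (fun x => F (hankelPath φ R j x)) (hankelMeasure φ R j) := by
  have hm : MeasurableSet (hankelPath φ R j ⁻¹' halfStrip φ R) :=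
    ((isClosed_Ici.reProdIm isClosed_Icc).preimage (continuous_hankelPath φ R j)).measurableSet
  rw [← Measure.restrict_eq_self_of_ae_mem (ae_hankelPath_mem_halfStrip hφ R j)]
  exact (hF.comp (continuous_hankelPath φ R j).continuousOn fun x hx => hx).aestronglyMeasurable hm

theorem hankel_congr {φ R : ℝ} (hφ : 0 ≤ φ) {F G : ℂ → ℂ} (h : EqOn F G (halfStrip φ R)) :
    hankel φ R F = hankel φ R G := by
  have hj : ∀ j, ∫ x, F (hankelPath φ R j x) ∂(hankelMeasure φ R j)
      = ∫ x, G (hankelPath φ R j x) ∂(hankelMeasure φ R j) := fun j =>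
    integral_congr_ae ((ae_hankelPath_mem_halfStrip hφ R j).mono fun x hx => h hx)
  simp only [hankel, hj]

theorem hankel_sub {φ R : ℝ} {F G : ℂ → ℂ} (hF : HankelIntegrable φ R F)
    (hG : HankelIntegrable φ R G) :
    hankel φ R (fun w => F w - G w) = hankel φ R F - hankel φ R G := by
  simp only [hankel, ← mul_sub, ← Finset.sum_sub_distrib, fun j => integral_sub (hF j) (hG j)]

theorem hankel_const_mul {φ R : ℝ} (c : ℂ) (F : ℂ → ℂ) :
    hankel φ R (fun w => c * F w) = c * hankel φ R F := by
  simp only [hankel, integral_const_mul, Finset.mul_sum, mul_left_comm]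

/-- Cauchy's theorem: the left end of the contour can be moved. -/
theorem hankel_eq_of_differentiableOn {φ R R' : ℝ} (hφ : 0 ≤ φ) (hR : R ≤ R') {F : ℂ → ℂ}
    (hF : DifferentiableOn ℂ F (Icc R R' ×ℂ Icc (-φ) φ)) (hi : HankelIntegrable φ R F) :
    hankel φ R F = hankel φ R' F := by
  have h1 : IntegrableOn (fun x : ℝ => F (x + φ * Complex.I)) (Ioi R) := hi 1
  have h2 : IntegrableOn (fun x : ℝ => F (x - φ * Complex.I)) (Ioi R) := hi 2
  have e1 := intervalIntegral.integral_interval_add_Ioi h1 (h1.mono_set (Ioi_subset_Ioi hR))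
  have e2 := intervalIntegral.integral_interval_add_Ioi h2 (h2.mono_set (Ioi_subset_Ioi hR))
  have hrect := Complex.integral_boundary_rect_eq_zero_of_differentiableOn F
    ⟨R, -φ⟩ ⟨R', φ⟩ (by simpa only [uIcc_of_le hR, uIcc_of_le (neg_le_self hφ)] using hF)
  simp only [smul_eq_mul, Complex.ofReal_neg, neg_mul, ← sub_eq_add_neg] at hrect
  simp only [hankel, Fin.sum_univ_three, hankelPath, hankelMeasure, hankelCoeff]
  rw [← intervalIntegral.integral_of_le (neg_le_self hφ),
    ← intervalIntegral.integral_of_le (neg_le_self hφ), ← e1, ← e2]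
  congr 1
  linear_combination -hrect

/-- The integrand of Hankel's formula for `1 / Γ(1 - k)`, that is, `e^p p^(k-1) dp` in the
coordinate `w = log p`. -/
def gammaKernel (k w : ℂ) : ℂ := Complex.exp (Complex.exp w + k * w)

theorem differentiable_gammaKernel (k : ℂ) : Differentiable ℂ (gammaKernel k) := by
  unfold gammaKernel
  fun_prop

theorem gammaKernel_add (k l w : ℂ) :
    gammaKernel (k + l) w = gammaKernel k w * Complex.exp (l * w) := by
  rw [gammaKernel, gammaKernel, ← Complex.exp_add]
  ring_nf

theorem norm_gammaKernel (k w : ℂ) :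
    ‖gammaKernel k w‖ = Real.exp (Real.cos w.im * Real.exp w.re + (k * w).re) := by
  rw [gammaKernel, Complex.norm_exp, Complex.add_re, Complex.exp_re, mul_comm (Real.exp _)]

theorem integrableOn_exp_mul_exp_add_Ioi (k R : ℝ) {c : ℝ} (hc : c < 0) :
    IntegrableOn (fun x => Real.exp (c * Real.exp x + k * x)) (Ioi R) := by
  have h0 : Tendsto (fun x => Real.exp (c * Real.exp x + k * x) / Real.exp (-1 * x)) atTop
      (𝓝 0) := by
    refine ((tendsto_rpow_mul_exp_neg_mul_atTop_nhds_zero (k + 1) (-c) (by linarith)).comp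
      Real.tendsto_exp_atTop).congr fun x => ?_
    rw [Function.comp_apply, ← Real.exp_mul, ← Real.exp_add, ← Real.exp_sub]
    ring_nf
  exact integrable_of_isBigO_exp_neg one_pos (by fun_prop)
    (Asymptotics.isBigO_of_div_tendsto_nhds (by simp) 0 h0)

theorem integrable_exp_mul_exp_add {k c : ℝ} (hk : 0 < k) (hc : c < 0) :
    Integrable (fun x => Real.exp (c * Real.exp x + k * x)) := by
  rw [← integrableOn_univ, ← Iic_union_Ioi (a := (0 : ℝ))]
  refine IntegrableOn.union ?_ (integrableOn_exp_mul_exp_add_Ioi k 0 hc)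
  refine (integrableOn_exp_mul_Iic hk 0).mono' (by fun_prop) (Eventually.of_forall fun x => ?_)
  rw [Real.norm_of_nonneg (Real.exp_pos _).le, Real.exp_le_exp]
  nlinarith [Real.exp_pos x]

theorem norm_gammaKernel_line (k : ℂ) (s x : ℝ) :
    ‖gammaKernel k (x + s * Complex.I)‖
      = Real.exp (-k.im * s) * Real.exp (Real.cos s * Real.exp x + k.re * x) := by
  rw [norm_gammaKernel, ← Real.exp_add]
  simp only [Complex.add_im, Complex.ofReal_im, Complex.im_ofReal_mul, Complex.I_im, mul_one,
    zero_add, Complex.add_re, Complex.ofReal_re, Complex.I_re, mul_zero, Complex.mul_re]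
  ring_nf

theorem continuous_gammaKernel_line (k : ℂ) (s : ℝ) :
    Continuous fun x : ℝ => gammaKernel k (x + s * Complex.I) := by
  unfold gammaKernel
  fun_prop

theorem integrableOn_gammaKernel_line (k : ℂ) (R : ℝ) {s : ℝ} (hs : Real.cos s < 0) :
    IntegrableOn (fun x : ℝ => gammaKernel k (x + s * Complex.I)) (Ioi R) := by
  refine ((integrableOn_exp_mul_exp_add_Ioi k.re R hs).const_mul _).mono'
    (continuous_gammaKernel_line k s).aestronglyMeasurable
    (Eventually.of_forall fun x => (norm_gammaKernel_line k s x).le)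

theorem integrable_gammaKernel_line {k : ℂ} (hk : 0 < k.re) {s : ℝ} (hs : Real.cos s < 0) :
    Integrable fun x : ℝ => gammaKernel k (x + s * Complex.I) := by
  refine ((integrable_exp_mul_exp_add hk hs).const_mul _).mono'
    (continuous_gammaKernel_line k s).aestronglyMeasurable
    (Eventually.of_forall fun x => (norm_gammaKernel_line k s x).le)

theorem hankelIntegrable_gammaKernel (k : ℂ) {φ : ℝ} (hφ : Real.cos φ < 0) (R : ℝ) :
    HankelIntegrable φ R (gammaKernel k) := by
  intro j
  fin_cases j
  · exact ((differentiable_gammaKernel k).continuous.comp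
      (continuous_hankelPath φ R 0)).integrableOn_Ioc
  · exact integrableOn_gammaKernel_line k R hφ
  · have h := integrableOn_gammaKernel_line k R (s := -φ) (by rwa [Real.cos_neg])
    simp only [Complex.ofReal_neg, neg_mul, ← sub_eq_add_neg] at h
    exact h

/-- The constant in the estimate of Hankel integrals dominated by `gammaKernel k`. -/
def hankelBound (φ R : ℝ) (k : ℂ) : ℝ :=
  ‖(2 * π * Complex.I)⁻¹‖ * ∑ j, ‖hankelCoeff j‖ *
    ∫ x, ‖gammaKernel k (hankelPath φ R j x)‖ ∂(hankelMeasure φ R j)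

section Dominated

variable {φ R K : ℝ} {k : ℂ} {F : ℂ → ℂ}

theorem HankelIntegrable.of_norm_le (hφ : 0 ≤ φ) (hcos : Real.cos φ < 0)
    (hF : ContinuousOn F (halfStrip φ R))
    (hb : ∀ w ∈ halfStrip φ R, ‖F w‖ ≤ K * ‖gammaKernel k w‖) : HankelIntegrable φ R F :=
  fun j => ((hankelIntegrable_gammaKernel k hcos R j).norm.const_mul K).mono'
    (aestronglyMeasurable_hankelPath hφ hF j)
    ((ae_hankelPath_mem_halfStrip hφ R j).mono fun _ hx => hb _ hx)

theorem norm_hankel_le (hφ : 0 ≤ φ) (hcos : Real.cos φ < 0)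
    (hb : ∀ w ∈ halfStrip φ R, ‖F w‖ ≤ K * ‖gammaKernel k w‖) :
    ‖hankel φ R F‖ ≤ K * hankelBound φ R k := by
  have hj : ∀ j, ‖∫ x, F (hankelPath φ R j x) ∂(hankelMeasure φ R j)‖
      ≤ K * ∫ x, ‖gammaKernel k (hankelPath φ R j x)‖ ∂(hankelMeasure φ R j) := fun j => by
    rw [← integral_const_mul]
    exact norm_integral_le_of_norm_le ((hankelIntegrable_gammaKernel k hcos R j).norm.const_mul K)
      ((ae_hankelPath_mem_halfStrip hφ R j).mono fun _ hx => hb _ hx)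
  rw [hankel, hankelBound, norm_mul, ← mul_left_comm, Finset.mul_sum]
  refine mul_le_mul_of_nonneg_left ((norm_sum_le _ _).trans (Finset.sum_le_sum fun j _ => ?_))
    (norm_nonneg _)
  rw [norm_mul, ← mul_left_comm]
  exact mul_le_mul_of_nonneg_left (hj j) (norm_nonneg _)

end Dominated

section Geometric

variable {φ R ρ : ℝ} {q : ℂ → ℂ}

theorem hankelIntegrable_gammaKernel_div_one_sub (hφ : 0 ≤ φ) (hcos : Real.cos φ < 0) (k : ℂ)
    (hq : ContinuousOn q (halfStrip φ R)) (hρ : ρ < 1) (hqρ : ∀ w ∈ halfStrip φ R, ‖q w‖ ≤ ρ) :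
    HankelIntegrable φ R fun w => gammaKernel k w / (1 - q w) := by
  have hlow : ∀ w ∈ halfStrip φ R, 1 - ρ ≤ ‖1 - q w‖ := fun w hw => by
    have h := norm_sub_norm_le (1 : ℂ) (q w)
    rw [norm_one] at h
    linarith [hqρ w hw]
  have hne : ∀ w ∈ halfStrip φ R, 1 - q w ≠ 0 := fun w hw =>
    norm_pos_iff.1 ((sub_pos.2 hρ).trans_le (hlow w hw))
  refine HankelIntegrable.of_norm_le (K := (1 - ρ)⁻¹) (k := k) hφ hcos
    ((differentiable_gammaKernel k).continuous.continuousOn.div (continuousOn_const.sub hq) hne)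
    fun w hw => ?_
  rw [norm_div, div_eq_inv_mul]
  have := hlow w hw
  have := sub_pos.2 hρ
  gcongr

theorem hasSum_hankel_geometric (hφ : 0 ≤ φ) (hcos : Real.cos φ < 0) (k : ℂ)
    (hq : ContinuousOn q (halfStrip φ R)) (hρ : ρ < 1) (hqρ : ∀ w ∈ halfStrip φ R, ‖q w‖ ≤ ρ) :
    HasSum (fun n : ℕ => hankel φ R fun w => gammaKernel k w * q w ^ n)
      (hankel φ R fun w => gammaKernel k w / (1 - q w)) := by
  have hρ0 : 0 ≤ ρ := (norm_nonneg _).trans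
    (hqρ (R : ℂ) (by simpa [halfStrip, Complex.mem_reProdIm] using hφ))
  refine HasSum.mul_left _ (hasSum_sum fun j _ => HasSum.mul_left _ ?_)
  have hmem := ae_hankelPath_mem_halfStrip hφ R j
  refine hasSum_integral_of_dominated_convergence
    (fun n x => ‖gammaKernel k (hankelPath φ R j x)‖ * ρ ^ n)
    (fun n => aestronglyMeasurable_hankelPath hφ
      ((differentiable_gammaKernel k).continuous.continuousOn.mul (hq.pow n)) j)
    (fun n => ?_) ?_ ?_ ?_
  · filter_upwards [hmem] with x hx
    rw [norm_mul, norm_pow]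
    gcongr
    exact hqρ _ hx
  · exact Eventually.of_forall fun x => (summable_geometric_of_lt_one hρ0 hρ).mul_left _
  · simp_rw [tsum_mul_left]
    exact (hankelIntegrable_gammaKernel k hcos R j).norm.mul_const _
  · filter_upwards [hmem] with x hx
    rw [div_eq_mul_inv]
    exact (hasSum_geometric_of_norm_lt_one ((hqρ _ hx).trans_lt hρ)).mul_left _

end Geometric

/-! ### Hankel's formula for the reciprocal of the Gamma function -/

theorem hankel_gammaKernel_left {φ : ℝ} (hφ : 0 ≤ φ) (hcos : Real.cos φ < 0) (k : ℂ) (R R' : ℝ) :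
    hankel φ R (gammaKernel k) = hankel φ R' (gammaKernel k) := by
  wlog h : R ≤ R' generalizing R R'
  · exact (this R' R (le_of_not_ge h)).symm
  exact hankel_eq_of_differentiableOn hφ h (differentiable_gammaKernel k).differentiableOn
    (hankelIntegrable_gammaKernel k hcos R)

theorem tendsto_integral_gammaKernel_segment (φ : ℝ) {k : ℂ} (hk : 0 < k.re) :
    Tendsto (fun R : ℝ => ∫ y in (-φ)..φ, gammaKernel k (R + y * Complex.I)) atBot (𝓝 0) := by
  have hexp : Tendsto (fun R : ℝ => Real.exp (Real.exp R + k.re * R + |k.im| * |φ|)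
      * |φ - -φ|) atBot (𝓝 0) := by
    have h : Tendsto (fun R : ℝ => Real.exp R + k.re * R + |k.im| * |φ|) atBot atBot :=
      tendsto_atBot_add_const_right _ _
        (Real.tendsto_exp_atBot.add_atBot (tendsto_id.const_mul_atBot hk))
    simpa using (Real.tendsto_exp_atBot.comp h).mul_const |φ - -φ|
  refine squeeze_zero_norm (fun R =>
    intervalIntegral.norm_integral_le_of_norm_le_const fun y hy => ?_) hexp
  have hy' : |y| ≤ |φ| := by
    rcases mem_uIoc.1 hy with h | h
    · exact (abs_le.2 ⟨h.1.le, h.2⟩).trans (le_abs_self φ)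
    · exact (abs_le.2 ⟨by linarith [h.1], by linarith [h.2]⟩).trans (neg_le_abs φ)
  have him : -k.im * y ≤ |k.im| * |φ| :=
    (le_abs_self _).trans (by rw [abs_mul, abs_neg]; gcongr)
  rw [norm_gammaKernel_line, ← Real.exp_add, Real.exp_le_exp]
  nlinarith [Real.cos_le_one y, Real.exp_pos R]

theorem hankel_gammaKernel_eq_sub_lines {φ : ℝ} (hφ : 0 ≤ φ) (hcos : Real.cos φ < 0) {k : ℂ}
    (hk : 0 < k.re) (R : ℝ) :
    hankel φ R (gammaKernel k) = (2 * π * Complex.I)⁻¹ *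
      ((∫ x : ℝ, gammaKernel k (x + φ * Complex.I)) -
        ∫ x : ℝ, gammaKernel k (x + (-φ : ℝ) * Complex.I)) := by
  have hline : ∀ s : ℝ, Real.cos s < 0 → Tendsto
      (fun R' : ℝ => ∫ x in Ioi R', gammaKernel k (x + s * Complex.I)) atBot
      (𝓝 (∫ x : ℝ, gammaKernel k (x + s * Complex.I))) := fun s hs =>
    (aecover_Ioi tendsto_id).integral_tendsto_of_countably_generated
      (integrable_gammaKernel_line hk hs)
  have hlim := (((tendsto_integral_gammaKernel_segment φ hk).const_mul Complex.I).add
    ((hline φ hcos).sub (hline (-φ) (by rwa [Real.cos_neg])))).const_mul (2 * π * Complex.I)⁻¹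
  rw [mul_zero, zero_add] at hlim
  refine tendsto_nhds_unique (tendsto_const_nhds.congr fun R' => ?_) hlim
  rw [hankel_gammaKernel_left hφ hcos k R R', hankel]
  simp only [Fin.sum_univ_three, hankelPath, hankelMeasure, hankelCoeff, Complex.ofReal_neg,
    neg_mul, one_mul, ← sub_eq_add_neg, intervalIntegral.integral_of_le (neg_le_self hφ),
    add_sub_assoc]

theorem norm_cpow_mul_exp_neg_mul (a r : ℂ) {t : ℝ} (ht : 0 < t) :
    ‖(t : ℂ) ^ (a - 1) * Complex.exp (-(r * t))‖ = t ^ (a.re - 1) * Real.exp (-(r.re * t)) := by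
  rw [norm_mul, Complex.norm_cpow_eq_rpow_re_of_pos ht, Complex.norm_exp, Complex.sub_re,
    Complex.one_re, Complex.neg_re, Complex.re_mul_ofReal]

theorem aestronglyMeasurable_cpow_mul_exp_neg_mul (a r : ℂ) :
    AEStronglyMeasurable (fun t : ℝ => (t : ℂ) ^ (a - 1) * Complex.exp (-(r * t)))
      (volume.restrict (Ioi 0)) := by
  refine ContinuousOn.aestronglyMeasurable (ContinuousOn.mul (fun t ht => ?_) (by fun_prop))
    measurableSet_Ioi
  exact (Complex.continuousAt_ofReal_cpow_const t _ (Or.inr (ne_of_gt ht))).continuousWithinAt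

theorem integrableOn_rpow_mul_exp_neg_mul {s b : ℝ} (hs : -1 < s) (hb : 0 < b) :
    IntegrableOn (fun t => t ^ s * Real.exp (-(b * t))) (Ioi 0) := by
  simpa only [Real.rpow_one, neg_mul] using integrableOn_rpow_mul_exp_neg_mul_rpow hs one_pos hb

theorem differentiableOn_integral_cpow_mul_exp_neg_mul {a : ℂ} (ha : 0 < a.re) :
    DifferentiableOn ℂ (fun r : ℂ => ∫ t : ℝ in Ioi 0, (t : ℂ) ^ (a - 1) * Complex.exp (-(r * t)))
      {r | 0 < r.re} := by
  intro r₀ (hr₀ : 0 < r₀.re)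
  refine DifferentiableAt.differentiableWithinAt ?_
  have hint : IntegrableOn (fun t : ℝ => (t : ℂ) ^ (a - 1) * Complex.exp (-(r₀ * t))) (Ioi 0) :=
    (integrableOn_rpow_mul_exp_neg_mul (show -1 < a.re - 1 by linarith) hr₀).mono'
      (aestronglyMeasurable_cpow_mul_exp_neg_mul a r₀)
      (ae_restrict_of_forall_mem measurableSet_Ioi fun t ht =>
        (norm_cpow_mul_exp_neg_mul a r₀ ht).le)
  refine (hasDerivAt_integral_of_dominated_loc_of_deriv_le
    (Metric.closedBall_mem_nhds r₀ (half_pos hr₀))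
    (F' := fun r t => (t : ℂ) ^ (a - 1) * Complex.exp (-(r * t)) * (-t))
    (Eventually.of_forall fun r => aestronglyMeasurable_cpow_mul_exp_neg_mul a r) hint
    ((aestronglyMeasurable_cpow_mul_exp_neg_mul a r₀).mul (by fun_prop))
    (bound := fun t => t ^ a.re * Real.exp (-(r₀.re / 2 * t))) ?_
    (integrableOn_rpow_mul_exp_neg_mul (by linarith) (half_pos hr₀))
    (Eventually.of_forall fun t r _ => ?_)).2.differentiableAt
  · refine ae_restrict_of_forall_mem measurableSet_Ioi fun t (ht : 0 < t) r hr => ?_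
    have hre : r₀.re / 2 ≤ r.re := by
      have h := (Complex.re_le_norm (r₀ - r)).trans (mem_closedBall_iff_norm'.1 hr)
      rw [Complex.sub_re] at h
      linarith
    rw [norm_mul, norm_cpow_mul_exp_neg_mul a r ht, norm_neg, Complex.norm_of_nonneg ht.le,
      mul_right_comm, ← Real.rpow_add_one ht.ne', sub_add_cancel]
    gcongr
  · rw [mul_assoc]
    exact (hasDerivAt_mul_const (t : ℂ)).neg.cexp.const_mul _

/-- `Complex.integral_cpow_mul_exp_neg_mul_Ioi` continued analytically to complex dilations. -/
theorem integral_cpow_mul_exp_neg_mul_of_re_pos {a r : ℂ} (ha : 0 < a.re) (hr : 0 < r.re) :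
    ∫ t : ℝ in Ioi 0, (t : ℂ) ^ (a - 1) * Complex.exp (-(r * t))
      = (1 / r) ^ a * Complex.Gamma a := by
  have hopen : IsOpen {r : ℂ | 0 < r.re} := isOpen_lt continuous_const Complex.continuous_re
  have hright : DifferentiableOn ℂ (fun r : ℂ => (1 / r) ^ a * Complex.Gamma a) {r | 0 < r.re} := by
    intro z (hz : 0 < z.re)
    have hz0 : z ≠ 0 := by rintro rfl; exact lt_irrefl _ hz
    have hslit : 1 / z ∈ Complex.slitPlane := by
      rw [one_div]
      exact Or.inl (by rw [Complex.inv_re]; exact div_pos hz (Complex.normSq_pos.2 hz0))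
    exact (((differentiableAt_const _).div differentiableAt_id hz0).cpow
      (differentiableAt_const _) hslit |>.mul_const _).differentiableWithinAt
  have hreal : ∃ᶠ z : ℂ in 𝓝[≠] 1, ∫ t : ℝ in Ioi 0, (t : ℂ) ^ (a - 1) * Complex.exp (-(z * t))
      = (1 / z) ^ a * Complex.Gamma a := by
    have hmap : Tendsto ((↑) : ℝ → ℂ) (𝓝[>] 1) (𝓝[≠] 1) :=
      tendsto_nhdsWithin_of_tendsto_nhds_of_eventually_within _
        ((Complex.continuous_ofReal.tendsto' 1 1 Complex.ofReal_one).mono_left nhdsWithin_le_nhds)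
        (eventually_mem_nhdsWithin.mono fun x hx => by
          simpa using (ne_of_gt (mem_Ioi.1 hx) : x ≠ 1))
    refine hmap.frequently (eventually_mem_nhdsWithin.mono fun x hx => ?_).frequently
    exact Complex.integral_cpow_mul_exp_neg_mul_Ioi ha (one_pos.trans (mem_Ioi.1 hx))
  exact AnalyticOnNhd.eqOn_of_preconnected_of_frequently_eq
    ((differentiableOn_integral_cpow_mul_exp_neg_mul ha).analyticOnNhd hopen)
    (hright.analyticOnNhd hopen) (convex_halfSpace_re_gt 0).isPreconnected
    (show (0 : ℝ) < (1 : ℂ).re by simp) hreal hr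

/-- Since `-e^{is} = e^{-i(τ - s)}`, the substitution `t = e^x` turns the integral over the line
`Im w = s` into an Euler integral with dilation `e^{-i(τ - s)}`. -/
theorem integral_gammaKernel_line {k : ℂ} (hk : 0 < k.re) {s τ : ℝ} (hs : |τ - s| < π / 2)
    (hτ : Complex.exp (τ * Complex.I) = -1) :
    ∫ x : ℝ, gammaKernel k (x + s * Complex.I)
      = Complex.exp (k * (τ * Complex.I)) * Complex.Gamma k := by
  set r : ℂ := Complex.exp (-((τ - s : ℝ) * Complex.I)) with hr
  have hrs : -r = Complex.exp (s * Complex.I) := by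
    rw [hr, neg_eq_neg_one_mul, ← hτ, ← Complex.exp_add]
    push_cast
    ring_nf
  have hr0 : 0 < r.re := by
    rw [hr, ← neg_mul, ← Complex.ofReal_neg, Complex.exp_ofReal_mul_I_re, Real.cos_neg]
    exact Real.cos_pos_of_mem_Ioo (abs_lt.1 hs)
  have hpow : (1 / r) ^ k = Complex.exp (k * ((τ - s : ℝ) * Complex.I)) := by
    obtain ⟨h1, h2⟩ := abs_lt.1 hs
    rw [hr, one_div, ← Complex.exp_neg, neg_neg,
      Complex.cpow_def_of_ne_zero (Complex.exp_ne_zero _),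
      Complex.log_exp (by rw [Complex.im_ofReal_mul, Complex.I_im]; linarith [Real.pi_pos])
        (by rw [Complex.im_ofReal_mul, Complex.I_im]; linarith [Real.pi_pos]), mul_comm]
  have hsub := integral_image_eq_integral_abs_deriv_smul (s := univ) (f := Real.exp)
    (f' := Real.exp) MeasurableSet.univ (fun x _ => (Real.hasDerivAt_exp x).hasDerivWithinAt)
    Real.exp_injective.injOn (fun t => (t : ℂ) ^ (k - 1) * Complex.exp (-(r * t)))
  rw [image_univ, Real.range_exp, integral_cpow_mul_exp_neg_mul_of_re_pos hk hr0,
    setIntegral_univ] at hsub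
  calc ∫ x : ℝ, gammaKernel k (x + s * Complex.I)
      = Complex.exp (k * (s * Complex.I)) * ((1 / r) ^ k * Complex.Gamma k) := by
        rw [hsub, ← integral_const_mul]
        refine integral_congr_ae (Eventually.of_forall fun x => ?_)
        have hexp : ((Real.exp x : ℝ) : ℂ) ≠ 0 := by exact_mod_cast (Real.exp_pos x).ne'
        simp only [abs_of_pos (Real.exp_pos x), Complex.real_smul]
        rw [Complex.cpow_def_of_ne_zero hexp, ← Complex.ofReal_log (Real.exp_pos x).le,
          Real.log_exp, Complex.ofReal_exp, ← Complex.exp_add, ← Complex.exp_add,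
          ← Complex.exp_add, gammaKernel, Complex.exp_add x, ← hrs]
        ring_nf
    _ = Complex.exp (k * (τ * Complex.I)) * Complex.Gamma k := by
        rw [hpow, ← mul_assoc, ← Complex.exp_add]
        push_cast
        ring_nf

section Hankel

variable {φ : ℝ} (hφ : φ ∈ Ioc (π / 2) π)
include hφ

theorem nonneg_of_mem_Ioc_pi : 0 ≤ φ := (half_pos Real.pi_pos).le.trans hφ.1.le

theorem cos_neg_of_mem_Ioc_pi : Real.cos φ < 0 :=
  Real.cos_neg_of_pi_div_two_lt_of_lt hφ.1 (by linarith [hφ.2, Real.pi_pos])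

theorem hankel_gammaKernel_of_re_pos {k : ℂ} (hk : 0 < k.re) (R : ℝ) :
    hankel φ R (gammaKernel k) = (Complex.Gamma (1 - k))⁻¹ := by
  have hupper := integral_gammaKernel_line hk (s := φ) (τ := π)
    (by rw [abs_lt]; constructor <;> linarith [hφ.1, hφ.2]) Complex.exp_pi_mul_I
  have hlower := integral_gammaKernel_line hk (s := -φ) (τ := -π)
    (by rw [abs_lt]; constructor <;> linarith [hφ.1, hφ.2])
    (by rw [Complex.ofReal_neg, neg_mul, Complex.exp_neg, Complex.exp_pi_mul_I]; norm_num)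
  have hsin : Complex.exp (k * (π * Complex.I)) - Complex.exp (k * ((-π : ℝ) * Complex.I))
      = 2 * Complex.I * Complex.sin (π * k) := by
    rw [Complex.sin, Complex.ofReal_neg]
    ring_nf
    rw [Complex.I_sq]
    ring
  have hΓ : Complex.Gamma k ≠ 0 := Complex.Gamma_ne_zero_of_re_pos hk
  have hπ : (π : ℂ) ≠ 0 := by exact_mod_cast Real.pi_ne_zero
  rw [hankel_gammaKernel_eq_sub_lines (nonneg_of_mem_Ioc_pi hφ) (cos_neg_of_mem_Ioc_pi hφ) hk,
    hupper, hlower, ← sub_mul, hsin,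
    eq_div_of_mul_eq hΓ ((mul_comm _ _).trans (Complex.Gamma_mul_Gamma_one_sub k)), inv_div]
  field_simp

omit hφ in
/-- Dominates the kernel and its `k`-derivative for `k` in a unit ball. -/
theorem norm_mul_norm_gammaKernel_le {k k₀ : ℂ} (hk : ‖k - k₀‖ ≤ 1) {R : ℝ} {w : ℂ}
    (hw : w ∈ halfStrip φ R) :
    ‖w‖ * ‖gammaKernel k w‖ ≤ Real.exp (2 * (2 * |R| + φ)) * ‖gammaKernel (k₀ + 2) w‖ := by
  obtain ⟨hre, him⟩ := Complex.mem_reProdIm.1 hw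
  have hnorm : ‖w‖ ≤ w.re + 2 * |R| + φ := by
    have h1 : |w.re| ≤ w.re + 2 * |R| := abs_le.2 ⟨by linarith [neg_abs_le R, mem_Ici.1 hre],
      by linarith [abs_nonneg R]⟩
    linarith [Complex.norm_le_abs_re_add_abs_im w, abs_le.2 him]
  have hkw : (k * w).re ≤ (k₀ * w).re + ‖w‖ := by
    have h := (Complex.re_le_norm ((k - k₀) * w)).trans
      ((norm_mul _ _).trans_le (mul_le_of_le_one_left (norm_nonneg w) hk))
    rw [sub_mul, Complex.sub_re] at h
    linarith
  have hadd : ((k₀ + 2) * w).re = (k₀ * w).re + 2 * w.re := by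
    rw [add_mul, Complex.add_re, ← Complex.ofReal_ofNat, Complex.re_ofReal_mul]
  have hexp : ‖w‖ ≤ Real.exp ‖w‖ := by linarith [Real.add_one_le_exp ‖w‖]
  refine (mul_le_mul_of_nonneg_right hexp (norm_nonneg _)).trans ?_
  rw [norm_gammaKernel, norm_gammaKernel, ← Real.exp_add, ← Real.exp_add, Real.exp_le_exp,
    hadd]
  linarith

theorem differentiable_hankel_gammaKernel (R : ℝ) :
    Differentiable ℂ fun k => hankel φ R (gammaKernel k) := by
  intro k₀
  have hcos := cos_neg_of_mem_Ioc_pi hφ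
  have hpath : ∀ j, DifferentiableAt ℂ
      (fun k => ∫ x, gammaKernel k (hankelPath φ R j x) ∂(hankelMeasure φ R j)) k₀ := fun j => by
    refine (hasDerivAt_integral_of_dominated_loc_of_deriv_le (Metric.closedBall_mem_nhds k₀ one_pos)
      (F' := fun k x => gammaKernel k (hankelPath φ R j x) * hankelPath φ R j x)
      (Eventually.of_forall fun k => (hankelIntegrable_gammaKernel k hcos R j).1)
      (hankelIntegrable_gammaKernel k₀ hcos R j)
      ((hankelIntegrable_gammaKernel k₀ hcos R j).1.mul
        (continuous_hankelPath φ R j).aestronglyMeasurable)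
      (bound := fun x => Real.exp (2 * (2 * |R| + φ)) * ‖gammaKernel (k₀ + 2) (hankelPath φ R j x)‖)
      ?_ ((hankelIntegrable_gammaKernel (k₀ + 2) hcos R j).norm.const_mul _)
      (Eventually.of_forall fun x k _ => ?_)).2.differentiableAt
    · filter_upwards [ae_hankelPath_mem_halfStrip (nonneg_of_mem_Ioc_pi hφ) R j] with x hx k hk
      rw [norm_mul, mul_comm]
      exact norm_mul_norm_gammaKernel_le (mem_closedBall_iff_norm.1 hk) hx
    · exact ((hasDerivAt_mul_const (hankelPath φ R j x)).const_add _).cexp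
  exact (DifferentiableAt.fun_sum fun j _ => (hpath j).const_mul _).const_mul _

theorem hankel_gammaKernel (k : ℂ) (R : ℝ) :
    hankel φ R (gammaKernel k) = (Complex.Gamma (1 - k))⁻¹ := by
  have hΓ : Differentiable ℂ fun k : ℂ => (Complex.Gamma (1 - k))⁻¹ :=
    Complex.differentiable_one_div_Gamma.comp (differentiable_id.const_sub 1)
  have hnear : ∀ᶠ l : ℂ in 𝓝 1, hankel φ R (gammaKernel l) = (Complex.Gamma (1 - l))⁻¹ :=
    (Complex.continuous_re.continuousAt.eventually_const_lt (by simp)).mono fun l hl =>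
      hankel_gammaKernel_of_re_pos hφ hl R
  exact congrFun (AnalyticOnNhd.eq_of_eventuallyEq
    (Complex.analyticOnNhd_univ_iff_differentiable.2 (differentiable_hankel_gammaKernel hφ R))
    (Complex.analyticOnNhd_univ_iff_differentiable.2 hΓ) hnear) k

end Hankel

/-! ### Contour integrals for Mittag-Leffler functions -/

theorem norm_exp_neg_mul (a : ℝ) (w : ℂ) : ‖Complex.exp (-(a * w))‖ = Real.exp (-(a * w.re)) := by
  rw [Complex.norm_exp, Complex.neg_re, Complex.re_ofReal_mul]

theorem norm_exp_neg_mul_sub_le {a φ R : ℝ} (ha : 0 < a) (w₀ : ℂ) {w : ℂ}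
    (hw : w ∈ halfStrip φ R) :
    ‖Complex.exp (-(a * (w - w₀)))‖ ≤ Real.exp (-(a * (R - w₀.re))) := by
  have hR : R ≤ w.re := (Complex.mem_reProdIm.1 hw).1
  rw [norm_exp_neg_mul, Complex.sub_re]
  gcongr

theorem exp_neg_mul_sub_lt_one {a R x : ℝ} (ha : 0 < a) (hR : x < R) :
    Real.exp (-(a * (R - x))) < 1 :=
  Real.exp_lt_one_iff.2 (neg_lt_zero.2 (mul_pos ha (sub_pos.2 hR)))

section Hankel

variable {φ : ℝ} (hφ : φ ∈ Ioc (π / 2) π) {a R : ℝ} (ha : 0 < a) {w₀ : ℂ} (hR : w₀.re < R)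
include hφ ha hR

theorem hankelIntegrable_gammaKernel_div_one_sub_exp (k : ℂ) :
    HankelIntegrable φ R fun w => gammaKernel k w / (1 - Complex.exp (-(a * (w - w₀)))) :=
  hankelIntegrable_gammaKernel_div_one_sub (nonneg_of_mem_Ioc_pi hφ) (cos_neg_of_mem_Ioc_pi hφ) k
    (by fun_prop) (exp_neg_mul_sub_lt_one ha hR) fun _ => norm_exp_neg_mul_sub_le ha w₀

theorem hasSum_mittagLeffler_exp (b : ℝ) :
    HasSum (fun n : ℕ => Complex.exp (a * w₀) ^ n / ((Real.Gamma (a * n + b) : ℝ) : ℂ))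
      (hankel φ R fun w => gammaKernel (1 - b) w / (1 - Complex.exp (-(a * (w - w₀))))) := by
  refine (hasSum_hankel_geometric (nonneg_of_mem_Ioc_pi hφ) (cos_neg_of_mem_Ioc_pi hφ) (1 - b)
    (q := fun w => Complex.exp (-(a * (w - w₀)))) (by fun_prop)
    (exp_neg_mul_sub_lt_one ha hR) fun _ => norm_exp_neg_mul_sub_le ha w₀).congr_fun fun n => ?_
  have hpow : ∀ w, gammaKernel (1 - b) w * Complex.exp (-(a * (w - w₀))) ^ n
      = Complex.exp (a * w₀) ^ n * gammaKernel (1 - b + -(a * n)) w := fun w => by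
    rw [gammaKernel_add, mul_left_comm, ← Complex.exp_nat_mul, ← Complex.exp_nat_mul,
      ← Complex.exp_add]
    ring_nf
  simp only [hpow]
  rw [hankel_const_mul, hankel_gammaKernel hφ, div_eq_mul_inv, ← Complex.Gamma_ofReal]
  push_cast
  ring_nf

theorem mittagLeffler_exp_eq_hankel (b : ℝ) :
    mittagLeffler a b (Complex.exp (a * w₀))
      = hankel φ R fun w => gammaKernel (1 - b) w / (1 - Complex.exp (-(a * (w - w₀)))) :=
  (hasSum_mittagLeffler_exp hφ ha hR b).tsum_eq

end Hankel

theorem summable_mittagLeffler {a : ℝ} (ha : 0 < a) (b : ℝ) (z : ℂ) :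
    Summable fun n : ℕ => z ^ n / ((Real.Gamma (a * n + b) : ℝ) : ℂ) := by
  rcases eq_or_ne z 0 with rfl | hz
  · exact (hasSum_single 0 fun n hn => by rw [zero_pow hn, zero_div]).summable
  have hexp : Complex.exp (a * (Complex.log z / a)) = z := by
    rw [mul_div_cancel₀ _ (by exact_mod_cast ha.ne'), Complex.exp_log hz]
  have hsum := (hasSum_mittagLeffler_exp (φ := π) ⟨by linarith [Real.pi_pos], le_rfl⟩ ha
    (lt_add_one (Complex.log z / a).re) b).summable
  rwa [hexp] at hsum

theorem hasSum_mittagLeffler {a : ℝ} (ha : 0 < a) (b : ℝ) (z : ℂ) :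
    HasSum (fun n : ℕ => z ^ n / ((Real.Gamma (a * n + b) : ℝ) : ℂ)) (mittagLeffler a b z) :=
  (summable_mittagLeffler ha b z).hasSum

theorem continuous_mittagLeffler {a : ℝ} (ha : 0 < a) (b : ℝ) :
    Continuous (mittagLeffler a b) := by
  refine continuous_iff_continuousAt.2 fun z => ?_
  refine (continuousOn_tsum (s := Metric.ball 0 (‖z‖ + 1)) (fun n => by fun_prop)
    (summable_mittagLeffler ha b ((‖z‖ + 1 : ℝ) : ℂ)).norm fun n w hw => ?_).continuousAt
    (Metric.isOpen_ball.mem_nhds (by simp))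
  have hw' : ‖w‖ ≤ ‖((‖z‖ + 1 : ℝ) : ℂ)‖ :=
    (mem_ball_zero_iff.1 hw).le.trans ((le_abs_self _).trans_eq (Complex.norm_real _).symm)
  rw [norm_div, norm_div, norm_pow, norm_pow]
  gcongr

theorem mittagLeffler_one_one (z : ℂ) : mittagLeffler 1 1 z = Complex.exp z := by
  simp only [Complex.exp_eq_exp_ℂ, NormedSpace.exp_eq_tsum_div, mittagLeffler, one_mul,
    Real.Gamma_nat_eq_factorial, Complex.ofReal_natCast]

theorem mittagLeffler_zero (a b : ℝ) : mittagLeffler a b 0 = (((Real.Gamma b)⁻¹ : ℝ) : ℂ) := by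
  rw [mittagLeffler, tsum_eq_single 0 fun n hn => by rw [zero_pow hn, zero_div]]
  simp

/-- Moving the contour to `Re w = 0` makes the bound independent of `w₀` and `R`. -/
theorem norm_hankel_gammaKernel_mul_le {φ R K : ℝ} (hφ : φ ∈ Ioc (π / 2) π) (hR : 0 ≤ R) (k : ℂ)
    {B : ℂ → ℂ} {w₀ : ℂ}
    (hB : DifferentiableOn ℂ B (Complex.im ⁻¹' Icc (-φ - w₀.im) (φ - w₀.im)))
    (hK : ∀ ζ ∈ Complex.im ⁻¹' Icc (-φ - w₀.im) (φ - w₀.im), ‖B ζ‖ ≤ K) :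
    ‖hankel φ R fun w => gammaKernel k w * B (w - w₀)‖ ≤ K * hankelBound φ 0 k := by
  have hφ0 := nonneg_of_mem_Ioc_pi hφ
  have hcos := cos_neg_of_mem_Ioc_pi hφ
  have hstrip : ∀ w : ℂ, w.im ∈ Icc (-φ) φ →
      w - w₀ ∈ Complex.im ⁻¹' Icc (-φ - w₀.im) (φ - w₀.im) := fun w hw => by
    rw [mem_preimage, Complex.sub_im]
    exact ⟨sub_le_sub_right hw.1 _, sub_le_sub_right hw.2 _⟩
  have hd : DifferentiableOn ℂ (fun w => gammaKernel k w * B (w - w₀))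
      (Complex.im ⁻¹' Icc (-φ) φ) :=
    (differentiable_gammaKernel k).differentiableOn.mul (hB.comp (by fun_prop) hstrip)
  have hb : ∀ w ∈ halfStrip φ 0, ‖gammaKernel k w * B (w - w₀)‖ ≤ K * ‖gammaKernel k w‖ :=
    fun w hw => by
      rw [norm_mul, mul_comm]
      exact mul_le_mul_of_nonneg_right (hK _ (hstrip w (Complex.mem_reProdIm.1 hw).2))
        (norm_nonneg _)
  rw [← hankel_eq_of_differentiableOn hφ0 hR (hd.mono fun w hw => (Complex.mem_reProdIm.1 hw).2)
    (HankelIntegrable.of_norm_le hφ0 hcos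
      (hd.continuousOn.mono fun w hw => (Complex.mem_reProdIm.1 hw).2) hb)]
  exact norm_hankel_le hφ0 hcos hb

theorem exists_norm_le_on_strip {c d K : ℝ} {B : ℂ → ℂ}
    (hB : ContinuousOn B (Complex.im ⁻¹' Icc c d)) (hK : ∀ ζ : ℂ, 1 ≤ |ζ.re| → ‖B ζ‖ ≤ K) :
    ∃ K', ∀ ζ ∈ Complex.im ⁻¹' Icc c d, ‖B ζ‖ ≤ K' := by
  have hc : IsCompact (Icc (-1) 1 ×ℂ Icc c d) := isCompact_Icc.reProdIm isCompact_Icc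
  obtain ⟨K₁, hK₁⟩ := hc.exists_bound_of_continuousOn
    (hB.mono fun ζ hζ => (Complex.mem_reProdIm.1 hζ).2)
  refine ⟨max K K₁, fun ζ hζ => ?_⟩
  rcases le_or_gt 1 |ζ.re| with h | h
  · exact (hK ζ h).trans (le_max_left _ _)
  · exact (hK₁ ζ (Complex.mem_reProdIm.2 ⟨abs_le.1 h.le, hζ⟩)).trans (le_max_right _ _)

theorem norm_exp_div_one_sub_exp_le {a c : ℝ} (ha : 0 < a) (hc : c ∈ Icc 0 a) {ζ : ℂ}
    (hζ : 1 ≤ |ζ.re|) :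
    ‖Complex.exp (-(c * ζ)) / (1 - Complex.exp (-(a * ζ)))‖ ≤ (1 - Real.exp (-a))⁻¹ := by
  obtain ⟨hc0, hca⟩ := hc
  have hea : 0 < 1 - Real.exp (-a) := by simpa using ha
  have hreal : Real.exp (-(c * ζ.re)) * (1 - Real.exp (-a)) ≤ |1 - Real.exp (-(a * ζ.re))| := by
    rcases le_abs'.1 hζ with h | h
    · have hle : Real.exp (-(c * ζ.re)) ≤ Real.exp (-(a * ζ.re)) :=
        Real.exp_le_exp.2 (by nlinarith)
      have hone : 1 ≤ Real.exp (-(a * ζ.re)) * Real.exp (-a) := by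
        rw [← Real.exp_add]
        exact Real.one_le_exp (by nlinarith)
      rw [abs_sub_comm]
      exact le_trans (by nlinarith) (le_abs_self _)
    · have hone : Real.exp (-(c * ζ.re)) ≤ 1 := Real.exp_le_one_iff.2 (by nlinarith)
      have hle : Real.exp (-(a * ζ.re)) ≤ Real.exp (-a) := Real.exp_le_exp.2 (by nlinarith)
      exact le_trans (by nlinarith) (le_abs_self _)
  have hden : Real.exp (-(c * ζ.re)) * (1 - Real.exp (-a)) ≤ ‖1 - Complex.exp (-(a * ζ))‖ := by
    have h := abs_norm_sub_norm_le (1 : ℂ) (Complex.exp (-(a * ζ)))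
    rw [norm_exp_neg_mul, norm_one] at h
    exact hreal.trans h
  have hpos : 0 < ‖1 - Complex.exp (-(a * ζ))‖ := (mul_pos (Real.exp_pos _) hea).trans_le hden
  rwa [norm_div, norm_exp_neg_mul, div_le_iff₀ hpos, inv_mul_eq_div, le_div_iff₀ hea]

theorem one_sub_exp_neg_ne_zero {z : ℂ} (hz : z ≠ 0) (him : |z.im| < 2 * π) :
    1 - Complex.exp (-z) ≠ 0 := by
  intro h
  obtain ⟨n, hn⟩ := Complex.exp_eq_one_iff.1 (sub_eq_zero.1 h).symm
  have hzn : z = -(n * (2 * π * Complex.I)) := by rw [← hn, neg_neg]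
  have hlt : |(n : ℝ)| < 1 := by
    have hzim : z.im = -(n * (2 * π)) := by simp [hzn]
    rw [hzim, abs_neg, abs_mul, abs_of_pos Real.two_pi_pos] at him
    exact (mul_lt_iff_lt_one_left Real.two_pi_pos).1 him
  have hn0 : n = 0 := Int.abs_lt_one_iff.1 (by exact_mod_cast hlt)
  exact hz (by rw [hzn, hn0]; simp)

theorem exists_norm_mittagLeffler_exp_le {α θ : ℝ} (hα : 0 < α) (hθ : π / 2 < θ)
    (hαθ : α * (θ + π / 2) < 2 * π) (b : ℝ) :
    ∃ C, ∀ w₀ : ℂ, w₀.im = -θ → ‖mittagLeffler α b (Complex.exp (α * w₀))‖ ≤ C := by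
  have hlt : π / 2 < 2 * π / α - θ := by
    rw [lt_sub_iff_add_lt', lt_div_iff₀' hα]
    exact hαθ
  obtain ⟨φ, hφ1, hφ⟩ := exists_between (lt_min (lt_min (half_lt_self Real.pi_pos) hθ) hlt)
  obtain ⟨⟨hφπ, hφθ⟩, hφα⟩ : (φ < π ∧ φ < θ) ∧ φ < 2 * π / α - θ := by
    simpa only [lt_min_iff] using hφ
  rw [lt_sub_iff_add_lt', lt_div_iff₀' hα] at hφα
  have hne : ∀ ζ ∈ Complex.im ⁻¹' Icc (θ - φ) (θ + φ), 1 - Complex.exp (-(α * ζ)) ≠ 0 := by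
    rintro ζ ⟨h1, h2⟩
    have hpos : 0 < ζ.im := (sub_pos.2 hφθ).trans_le h1
    have him : (α * ζ).im = α * ζ.im := Complex.im_ofReal_mul α ζ
    refine one_sub_exp_neg_ne_zero (fun h => ?_) ?_
    · rw [h, Complex.zero_im] at him
      exact (mul_pos hα hpos).ne him
    · rw [him, abs_of_pos (mul_pos hα hpos)]
      exact (mul_le_mul_of_nonneg_left h2 hα.le).trans_lt hφα
  have hd : DifferentiableOn ℂ (fun ζ => 1 / (1 - Complex.exp (-(α * ζ))))
      (Complex.im ⁻¹' Icc (θ - φ) (θ + φ)) := DifferentiableOn.div (by fun_prop) (by fun_prop) hne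
  obtain ⟨K, hK⟩ := exists_norm_le_on_strip hd.continuousOn fun ζ hζ => by
    simpa using norm_exp_div_one_sub_exp_le hα ⟨le_rfl, hα.le⟩ hζ
  refine ⟨K * hankelBound φ 0 (1 - b), fun w₀ hw₀ => ?_⟩
  rw [show θ - φ = -φ - w₀.im by rw [hw₀]; ring, show θ + φ = φ - w₀.im by rw [hw₀]; ring] at hd hK
  rw [mittagLeffler_exp_eq_hankel ⟨hφ1, hφπ.le⟩ hα
    ((lt_add_one _).trans_le (le_max_right 0 (w₀.re + 1))) b]
  simpa only [mul_one_div] using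
    norm_hankel_gammaKernel_mul_le ⟨hφ1, hφπ.le⟩ (le_max_left 0 (w₀.re + 1)) (1 - b) hd hK

/-- The function `ζ ↦ (1 - exp(-aζ)) / ζ`, extended to `0`. -/
def expQuot (a : ℝ) : ℂ → ℂ := dslope (fun ζ => 1 - Complex.exp (-(a * ζ))) 0

theorem differentiable_expQuot (a : ℝ) : Differentiable ℂ (expQuot a) := by
  rw [← differentiableOn_univ, expQuot, Complex.differentiableOn_dslope univ_mem]
  fun_prop

theorem expQuot_zero (a : ℝ) : expQuot a 0 = a := by
  have h : HasDerivAt (fun ζ : ℂ => 1 - Complex.exp (-(a * ζ))) a 0 := by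
    simpa using ((hasDerivAt_const_mul (a : ℂ) (x := 0)).neg.cexp).const_sub 1
  rw [expQuot, dslope_same, h.deriv]

theorem expQuot_of_ne (a : ℝ) {ζ : ℂ} (hζ : ζ ≠ 0) :
    expQuot a ζ = (1 - Complex.exp (-(a * ζ))) / ζ := by
  rw [expQuot, dslope_of_ne _ hζ, slope_def_field]
  simp

theorem expQuot_ne_zero {a : ℝ} (ha : a ∈ Ioc 0 1) {ζ : ℂ}
    (hζ : ζ ∈ Complex.im ⁻¹' Ioo (-(2 * π)) (2 * π)) : expQuot a ζ ≠ 0 := by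
  have ha0 : (a : ℂ) ≠ 0 := by exact_mod_cast ha.1.ne'
  rcases eq_or_ne ζ 0 with rfl | h0
  · rwa [expQuot_zero]
  · rw [expQuot_of_ne a h0]
    refine div_ne_zero (one_sub_exp_neg_ne_zero (mul_ne_zero ha0 h0) ?_) h0
    rw [Complex.im_ofReal_mul, abs_mul, abs_of_pos ha.1]
    exact (mul_le_of_le_one_left (abs_nonneg _) ha.2).trans_lt (abs_lt.2 hζ)

/-- The difference of `1 / (1 - exp(-aζ))` and `a⁻¹ exp(-cζ) / (1 - exp(-ζ))`. Their poles at `0`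
cancel, so the difference is extended analytically to `0`. -/
def poleFreeKernel (a c : ℝ) : ℂ → ℂ :=
  dslope (fun ζ => 1 / expQuot a ζ - 1 / a * (Complex.exp (-(c * ζ)) / expQuot 1 ζ)) 0

theorem poleFreeKernel_of_ne (a c : ℝ) {ζ : ℂ} (hζ : ζ ≠ 0) :
    poleFreeKernel a c ζ = 1 / (1 - Complex.exp (-(a * ζ))) -
      1 / a * (Complex.exp (-(c * ζ)) / (1 - Complex.exp (-ζ))) := by
  rw [poleFreeKernel, dslope_of_ne _ hζ, slope_def_field]
  simp only [expQuot_zero, expQuot_of_ne _ hζ, Complex.ofReal_one, one_mul, mul_zero, neg_zero,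
    Complex.exp_zero, div_one, mul_one, sub_self, sub_zero]
  field_simp

theorem differentiableOn_poleFreeKernel {a : ℝ} (ha : a ∈ Ioc 0 1) (c : ℝ) :
    DifferentiableOn ℂ (poleFreeKernel a c) (Complex.im ⁻¹' Ioo (-(2 * π)) (2 * π)) := by
  have hU : Complex.im ⁻¹' Ioo (-(2 * π)) (2 * π) ∈ 𝓝 (0 : ℂ) :=
    (isOpen_Ioo.preimage Complex.continuous_im).mem_nhds (by simp [Real.pi_pos])
  refine (Complex.differentiableOn_dslope hU).2 (DifferentiableOn.sub ?_
    (DifferentiableOn.const_mul ?_ _))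
  · exact DifferentiableOn.div (by fun_prop) (differentiable_expQuot a).differentiableOn
      fun ζ => expQuot_ne_zero ha
  · exact DifferentiableOn.div (by fun_prop) (differentiable_expQuot 1).differentiableOn
      fun ζ => expQuot_ne_zero ⟨one_pos, le_rfl⟩

theorem exists_norm_poleFreeKernel_le {a c s t : ℝ} (ha : a ∈ Ioc 0 1) (hc : c ∈ Icc 0 1)
    (hs : -(2 * π) < s) (ht : t < 2 * π) :
    ∃ K, ∀ ζ ∈ Complex.im ⁻¹' Icc s t, ‖poleFreeKernel a c ζ‖ ≤ K := by
  refine exists_norm_le_on_strip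
    (K := (1 - Real.exp (-a))⁻¹ + ‖(1 / a : ℂ)‖ * (1 - Real.exp (-1))⁻¹)
    ((differentiableOn_poleFreeKernel ha c).continuousOn.mono
      (preimage_mono (Icc_subset_Ioo hs ht))) fun ζ hζ => ?_
  have h0 : ζ ≠ 0 := by
    rintro rfl
    norm_num at hζ
  rw [poleFreeKernel_of_ne a c h0]
  refine (norm_sub_le _ _).trans (add_le_add ?_ ?_)
  · simpa using norm_exp_div_one_sub_exp_le ha.1 ⟨le_rfl, ha.1.le⟩ hζ
  · rw [norm_mul]
    refine mul_le_mul_of_nonneg_left ?_ (norm_nonneg _)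
    simpa using norm_exp_div_one_sub_exp_le one_pos hc hζ

/-- Subtracting the contour representation of `exp = E_{1,1}` cancels the pole at `w₀`, which takes
the place of a residue computation. -/
theorem mittagLeffler_exp_sub_eq_hankel {φ a R : ℝ} (hφ : φ ∈ Ioc (π / 2) π) (ha : 0 < a) (b : ℝ)
    {w₀ : ℂ} (hR : w₀.re < R) :
    mittagLeffler a b (Complex.exp (a * w₀)) -
        1 / a * Complex.exp ((1 - b) * w₀) * Complex.exp (Complex.exp w₀)
      = hankel φ R fun w => gammaKernel (1 - b) w * poleFreeKernel a (1 - b) (w - w₀) := by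
  have hexp : Complex.exp (Complex.exp w₀)
      = hankel φ R fun w => gammaKernel 0 w / (1 - Complex.exp (-(w - w₀))) := by
    have h := mittagLeffler_exp_eq_hankel hφ one_pos hR 1
    simpa only [mittagLeffler_one_one, Complex.ofReal_one, one_mul, sub_self] using h
  have hint : HankelIntegrable φ R fun w => gammaKernel 0 w / (1 - Complex.exp (-(w - w₀))) := by
    simpa only [Complex.ofReal_one, one_mul] using
      hankelIntegrable_gammaKernel_div_one_sub_exp hφ one_pos hR 0
  rw [mittagLeffler_exp_eq_hankel hφ ha hR, hexp, ← hankel_const_mul,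
    ← hankel_sub (hankelIntegrable_gammaKernel_div_one_sub_exp hφ ha hR _)
      fun j => (hint j).const_mul _]
  refine hankel_congr (nonneg_of_mem_Ioc_pi hφ) fun w hw => ?_
  have hne : w - w₀ ≠ 0 := fun h => by
    have hre : R ≤ w.re := (Complex.mem_reProdIm.1 hw).1
    rw [sub_eq_zero.1 h] at hre
    exact hR.not_ge hre
  have hshift : gammaKernel (1 - b) w * Complex.exp (-((1 - b : ℝ) * (w - w₀)))
      = Complex.exp ((1 - b) * w₀) * gammaKernel 0 w := by
    rw [← zero_add (1 - (b : ℂ)), gammaKernel_add, mul_assoc, ← Complex.exp_add, mul_comm]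
    push_cast
    ring_nf
  rw [poleFreeKernel_of_ne _ _ hne]
  linear_combination 1 / a / (1 - Complex.exp (-(w - w₀))) * hshift

theorem exists_norm_mittagLeffler_exp_sub_le {a b θ : ℝ} (ha : a ∈ Ioc 0 1) (hb : b ∈ Icc 0 1)
    (hθ : |θ| < π) :
    ∃ C, ∀ w₀ : ℂ, w₀.im = -θ → ‖mittagLeffler a b (Complex.exp (a * w₀)) -
      1 / a * Complex.exp ((1 - b) * w₀) * Complex.exp (Complex.exp w₀)‖ ≤ C := by
  obtain ⟨hθ1, hθ2⟩ := abs_lt.1 hθ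
  have hφ : π ∈ Ioc (π / 2) π := ⟨half_lt_self Real.pi_pos, le_rfl⟩
  have hs : -(2 * π) < -π - -θ := by linarith
  have ht : π - -θ < 2 * π := by linarith
  obtain ⟨K, hK⟩ := exists_norm_poleFreeKernel_le (c := 1 - b) ha
    ⟨sub_nonneg.2 hb.2, sub_le_self 1 hb.1⟩ hs ht
  refine ⟨K * hankelBound π 0 (1 - b), fun w₀ hw₀ => ?_⟩
  rw [← hw₀] at hK hs ht
  rw [mittagLeffler_exp_sub_eq_hankel hφ ha.1 b
    ((lt_add_one _).trans_le (le_max_right 0 (w₀.re + 1)))]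
  exact norm_hankel_gammaKernel_mul_le hφ (le_max_left _ _) _
    ((differentiableOn_poleFreeKernel ha _).mono (preimage_mono (Icc_subset_Ioo hs ht))) hK

theorem neg_I_cpow_mul {α β r : ℝ} (hα : 0 < α) (hr : 0 < r) :
    (-Complex.I) ^ (β : ℂ) * (r : ℂ)
      = Complex.exp (α * ((Real.log r / α : ℝ) - (π * β / (2 * α) : ℝ) * Complex.I)) := by
  have hα' : (α : ℂ) ≠ 0 := by exact_mod_cast hα.ne'
  have hlog : (r : ℂ) = Complex.exp (Real.log r) := by
    rw [← Complex.ofReal_exp, Real.exp_log hr]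
  conv_lhs => rw [hlog]
  rw [Complex.cpow_def_of_ne_zero (neg_ne_zero.2 Complex.I_ne_zero), Complex.log_neg_I,
    ← Complex.exp_add]
  congr 1
  push_cast
  field_simp
  ring

theorem exists_norm_mittagLeffler_ray_le {α β : ℝ} (hα : 0 < α) (hβ1 : β ≤ 1) (hαβ : α < β)
    (b : ℝ) :
    ∃ C, ∀ r : ℝ, 0 ≤ r → ‖mittagLeffler α b ((-Complex.I) ^ (β : ℂ) * (r : ℂ))‖ ≤ C := by
  have hπ := Real.pi_pos
  have hθ : π / 2 < π * β / (2 * α) := by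
    rw [lt_div_iff₀ (by positivity)]
    nlinarith
  have hαθ : α * (π * β / (2 * α) + π / 2) < 2 * π := by
    have : α * (π * β / (2 * α) + π / 2) = π / 2 * (β + α) := by
      field_simp
    nlinarith
  obtain ⟨C, hC⟩ := exists_norm_mittagLeffler_exp_le hα hθ hαθ b
  refine ⟨max C ‖mittagLeffler α b 0‖, fun r hr => ?_⟩
  rcases hr.eq_or_lt with rfl | hr
  · rw [Complex.ofReal_zero, mul_zero]
    exact le_max_right _ _
  · rw [neg_I_cpow_mul hα hr]
    exact (hC _ (by rw [Complex.sub_im, Complex.ofReal_im, Complex.im_ofReal_mul, Complex.I_im,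
      mul_one, zero_sub])).trans (le_max_left _ _)

theorem exists_norm_mittagLeffler_ray_le_add {α β : ℝ} (hα : α ∈ Ioc 0 1) (hβ : β ∈ Ioc 0 α) {b : ℝ}
    (hb : b ∈ Icc 0 1) :
    ∃ C, 0 ≤ C ∧ ∀ r : ℝ, 0 < r → ‖mittagLeffler α b ((-Complex.I) ^ (β : ℂ) * (r : ℂ))‖ ≤
      C + 1 / α * r ^ ((1 - b) / α) * Real.exp (Real.cos (π * β / (2 * α)) * r ^ (1 / α)) := by
  have hπ := Real.pi_pos
  have hα0 := hα.1
  have hβ0 := hβ.1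
  set θ := π * β / (2 * α) with hθ
  have hθπ : |θ| < π := by
    rw [abs_of_pos (by positivity), hθ, div_lt_iff₀ (by positivity)]
    nlinarith [hβ.2]
  obtain ⟨C, hC⟩ := exists_norm_mittagLeffler_exp_sub_le hα hb hθπ
  refine ⟨max C 0, le_max_right _ _, fun r hr => ?_⟩
  set w₀ : ℂ := (Real.log r / α : ℝ) - (θ : ℝ) * Complex.I with hw₀
  have hre : w₀.re = Real.log r / α := by simp [hw₀]
  have him : w₀.im = -θ := by simp [hw₀]
  have hmain : ‖(1 / α : ℂ) * Complex.exp ((1 - b) * w₀) * Complex.exp (Complex.exp w₀)‖ =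
      1 / α * r ^ ((1 - b) / α) * Real.exp (Real.cos θ * r ^ (1 / α)) := by
    rw [← Complex.ofReal_one, ← Complex.ofReal_sub, norm_mul, norm_mul, Complex.norm_exp,
      Complex.norm_exp, Complex.re_ofReal_mul, Complex.exp_re, hre, him, Real.cos_neg,
      Real.rpow_def_of_pos hr, Real.rpow_def_of_pos hr, norm_div, Complex.norm_real,
      Complex.norm_real, norm_one, Real.norm_of_nonneg hα0.le, mul_comm (Real.cos θ)]
    ring_nf
  rw [neg_I_cpow_mul hα0 hr, ← hw₀, ← hmain]
  exact (norm_le_norm_sub_add _ _).trans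
    (add_le_add_left ((hC w₀ him).trans (le_max_left _ _)) _)

/-! ### Fractional integrals of powers and of Mittag-Leffler functions -/

theorem integral_rpow_mul_rpow {p c t : ℝ} (hp : 0 < p) (hc : 0 < c) (ht : 0 < t) :
    ∫ s in (0 : ℝ)..t, (t - s) ^ (c - 1) * s ^ (p - 1)
      = t ^ (p + c - 1) * (Real.Gamma p * Real.Gamma c / Real.Gamma (p + c)) := by
  have hΓ : ((Real.Gamma (p + c) : ℝ) : ℂ) ≠ 0 := by
    exact_mod_cast (Real.Gamma_pos_of_pos (add_pos hp hc)).ne'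
  have hbeta : Complex.betaIntegral p c
      = ((Real.Gamma p * Real.Gamma c / Real.Gamma (p + c) : ℝ) : ℂ) := by
    have h := Complex.Gamma_mul_Gamma_eq_betaIntegral (s := (p : ℂ)) (t := (c : ℂ))
      (by simpa using hp) (by simpa using hc)
    rw [← Complex.ofReal_add, Complex.Gamma_ofReal, Complex.Gamma_ofReal, Complex.Gamma_ofReal] at h
    rw [Complex.ofReal_div, Complex.ofReal_mul]
    exact eq_div_of_mul_eq hΓ ((mul_comm _ _).trans h.symm)
  have hreal : ∫ s in (0 : ℝ)..t, (s : ℂ) ^ ((p : ℂ) - 1) * ((t : ℂ) - s) ^ ((c : ℂ) - 1)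
      = ∫ s in (0 : ℝ)..t, (((t - s) ^ (c - 1) * s ^ (p - 1) : ℝ) : ℂ) := by
    refine intervalIntegral.integral_congr_ae (Eventually.of_forall fun s hs => ?_)
    rw [uIoc_of_le ht.le] at hs
    rw [Complex.ofReal_mul, Complex.ofReal_cpow (sub_nonneg.2 hs.2), Complex.ofReal_cpow hs.1.le,
      mul_comm]
    push_cast
    rfl
  have hpow : (t : ℂ) ^ ((p : ℂ) + c - 1) = ((t ^ (p + c - 1) : ℝ) : ℂ) := by
    rw [Complex.ofReal_cpow ht.le]
    push_cast
    rfl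
  have hscaled := Complex.betaIntegral_scaled (p : ℂ) (c : ℂ) ht
  rw [hreal, intervalIntegral.integral_ofReal, hbeta, hpow] at hscaled
  exact_mod_cast hscaled

theorem intervalIntegrable_rpow_mul_rpow {p c t : ℝ} (hp : 0 < p) (hc : 0 < c) (ht : 0 < t) :
    IntervalIntegrable (fun s => (t - s) ^ (c - 1) * s ^ (p - 1)) volume 0 t := by
  by_contra h
  have hbeta := integral_rpow_mul_rpow hp hc ht
  rw [intervalIntegral.integral_undef h] at hbeta
  have := Real.Gamma_pos_of_pos hp
  have := Real.Gamma_pos_of_pos hc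
  have := Real.Gamma_pos_of_pos (add_pos hp hc)
  have := Real.rpow_pos_of_pos ht (p + c - 1)
  exact absurd hbeta.symm (by positivity)

theorem integral_norm_const_mul_ofReal {X : Type*} [MeasurableSpace X] {μ : Measure X} {f : X → ℝ}
    (hf : 0 ≤ᵐ[μ] f) (z : ℂ) : ∫ x, ‖z * (f x : ℂ)‖ ∂μ = ‖∫ x, z * (f x : ℂ) ∂μ‖ := by
  rw [integral_const_mul, norm_mul, integral_complex_ofReal, Complex.norm_real,
    Real.norm_of_nonneg (integral_nonneg_of_ae hf), ← integral_const_mul]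
  refine integral_congr_ae (hf.mono fun x hx => ?_)
  simp only [norm_mul, Complex.norm_real, Real.norm_of_nonneg hx]

theorem integral_mittagLeffler_term {α c t : ℝ} (hα : 0 < α) (hc : 0 < c) (ht : 0 < t) (k : ℂ)
    (n : ℕ) :
    ∫ s in Ioc 0 t, k ^ n / ((Real.Gamma (α * n + α) : ℝ) : ℂ) *
        (((t - s) ^ (c - 1) * s ^ (α * n + α - 1) : ℝ) : ℂ)
      = ((Real.Gamma c * t ^ (α + c - 1) : ℝ) : ℂ) *
        ((k * ((t ^ α : ℝ) : ℂ)) ^ n / ((Real.Gamma (α * n + (α + c)) : ℝ) : ℂ)) := by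
  have hp : 0 < α * n + α := by positivity
  have hΓ : ((Real.Gamma (α * n + α) : ℝ) : ℂ) ≠ 0 := by
    exact_mod_cast (Real.Gamma_pos_of_pos hp).ne'
  have hpow : t ^ (α * n + α + c - 1) = t ^ (α + c - 1) * (t ^ α) ^ n := by
    rw [← Real.rpow_natCast, ← Real.rpow_mul ht.le, ← Real.rpow_add ht]
    ring_nf
  rw [integral_const_mul, integral_complex_ofReal, ← intervalIntegral.integral_of_le ht.le,
    integral_rpow_mul_rpow hp hc ht, hpow, add_assoc, mul_pow]
  push_cast
  generalize ((Real.Gamma (α * n + α) : ℝ) : ℂ) = G at hΓ ⊢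
  field_simp

theorem integral_rpow_mul_mittagLeffler {α c t : ℝ} (hα : 0 < α) (hc : 0 < c) (ht : 0 < t) (k : ℂ) :
    ∫ s in (0 : ℝ)..t, (((t - s) ^ (c - 1) * s ^ (α - 1) : ℝ) : ℂ) *
        mittagLeffler α α (k * ((s ^ α : ℝ) : ℂ))
      = ((Real.Gamma c * t ^ (α + c - 1) : ℝ) : ℂ) *
        mittagLeffler α (α + c) (k * ((t ^ α : ℝ) : ℂ)) := by
  have hint : ∀ n : ℕ, IntegrableOn (fun s => k ^ n / ((Real.Gamma (α * n + α) : ℝ) : ℂ) *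
      (((t - s) ^ (c - 1) * s ^ (α * n + α - 1) : ℝ) : ℂ)) (Ioc 0 t) := fun n =>
    ((intervalIntegrable_iff_integrableOn_Ioc_of_le ht.le).1
      (intervalIntegrable_rpow_mul_rpow (by positivity) hc ht)).ofReal.const_mul _
  have hnonneg : ∀ n : ℕ, 0 ≤ᵐ[volume.restrict (Ioc 0 t)]
      fun s => (t - s) ^ (c - 1) * s ^ (α * n + α - 1) := fun n =>
    ae_restrict_of_forall_mem measurableSet_Ioc fun s hs =>
      mul_nonneg (Real.rpow_nonneg (sub_nonneg.2 hs.2) _) (Real.rpow_nonneg hs.1.le _)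
  have hseries := (hasSum_mittagLeffler hα (α + c) (k * ((t ^ α : ℝ) : ℂ))).mul_left
    ((Real.Gamma c * t ^ (α + c - 1) : ℝ) : ℂ)
  have hswap := hasSum_integral_of_summable_integral_norm hint (by
    simp_rw [integral_norm_const_mul_ofReal (hnonneg _), integral_mittagLeffler_term hα hc ht]
    exact hseries.summable.norm)
  simp_rw [integral_mittagLeffler_term hα hc ht] at hswap
  rw [← hswap.unique hseries, intervalIntegral.integral_of_le ht.le]
  refine setIntegral_congr_fun measurableSet_Ioc fun s hs => ?_
  refine (((hasSum_mittagLeffler hα α (k * ((s ^ α : ℝ) : ℂ))).mul_left _).congr_fun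
    fun n => ?_).tsum_eq.symm
  have hpow : s ^ (α * n + α - 1) = s ^ (α - 1) * (s ^ α) ^ n := by
    rw [← Real.rpow_natCast, ← Real.rpow_mul hs.1.le, ← Real.rpow_add hs.1]
    ring_nf
  rw [hpow]
  push_cast
  ring

theorem mittagLeffler_succ {α : ℝ} (hα : 0 < α) (b : ℝ) (z : ℂ) :
    mittagLeffler α b z = (((Real.Gamma b)⁻¹ : ℝ) : ℂ) + z * mittagLeffler α (α + b) z := by
  rw [mittagLeffler, (summable_mittagLeffler hα b z).tsum_eq_zero_add, mittagLeffler,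
    ← tsum_mul_left]
  congr 1
  · simp
  · congr 1
    funext n
    rw [pow_succ, show α * ((n + 1 : ℕ) : ℝ) + b = α * n + (α + b) by push_cast; ring]
    ring

/-! ### The operator `H₀` on the Fourier side -/

theorem toTemperedDistribution_eq_smulLeftCLM_iff {d : ℕ} {m : Sp d → ℂ}
    (hm : m.HasTemperateGrowth) (f g : L2 d) :
    (f : 𝓢'(Sp d, ℂ)) = TemperedDistribution.smulLeftCLM ℂ m (g : 𝓢'(Sp d, ℂ)) ↔
      (f : Sp d → ℂ) =ᵐ[volume] fun x => m x * g x := by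
  have happly : ∀ u : 𝓢(Sp d, ℂ),
      TemperedDistribution.smulLeftCLM ℂ m (g : 𝓢'(Sp d, ℂ)) u = ∫ x, u x * (m x * g x) := by
    intro u
    rw [TemperedDistribution.smulLeftCLM_apply_apply, Lp.toTemperedDistribution_apply]
    refine integral_congr_ae (Eventually.of_forall fun x => ?_)
    simp only [SchwartzMap.smulLeftCLM_apply_apply hm, smul_eq_mul]
    ring
  constructor
  · intro h
    refine ae_eq_of_integral_contDiff_smul_eq ((Lp.memLp f).locallyIntegrable (by norm_num))
      (LocallyIntegrable.continuous_smul hm.1.continuous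
        ((Lp.memLp g).locallyIntegrable (by norm_num))) fun ψ hψ hsupp => ?_
    have hψ' : ContDiff ℝ ∞ (Complex.ofRealCLM ∘ ψ) := by fun_prop
    have htest := DFunLike.congr_fun h (HasCompactSupport.toSchwartzMap (hsupp.comp_left rfl) hψ')
    rw [happly, Lp.toTemperedDistribution_apply] at htest
    simpa [Complex.real_smul] using htest
  · intro h
    ext u
    rw [happly, Lp.toTemperedDistribution_apply]
    exact integral_congr_ae (h.mono fun x hx => by simp only [smul_eq_mul, hx])

theorem fourierL2_ae {d : ℕ} (v : L2 d) :
    (fourierL2 d v : Sp d → ℂ) =ᵐ[volume] fun ξ =>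
      ((((2 * π)⁻¹ : ℝ) ^ ((d : ℝ) / 2) : ℝ) : ℂ) * (𝓕 v : L2 d) ((2 * π)⁻¹ • ξ) :=
  (memLp_dilate (inv_pos.2 Real.two_pi_pos) (𝓕 v : L2 d)).coeFn_toLp

theorem fourier_ae {d : ℕ} (v : L2 d) :
    ((𝓕 v : L2 d) : Sp d → ℂ) =ᵐ[volume] fun ξ =>
      (((2 * π : ℝ) ^ ((d : ℝ) / 2) : ℝ) : ℂ) * fourierL2 d v ((2 * π) • ξ) := by
  filter_upwards [(quasi_dilate Real.two_pi_pos).ae (fourierL2_ae v)] with ξ hξ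
  rw [hξ, smul_smul, inv_mul_cancel₀ (by positivity), one_smul, ← mul_assoc, ← Complex.ofReal_mul,
    Real.inv_rpow (by positivity), mul_inv_cancel₀ (by positivity), Complex.ofReal_one, one_mul]

theorem hasTemperateGrowth_norm_sq (d : ℕ) :
    (fun x : Sp d => ((‖x‖ ^ 2 : ℝ) : ℂ)).HasTemperateGrowth := by
  fun_prop

theorem fourier_neg_laplacian {d : ℕ} (v : L2 d) :
    𝓕 (-Δ (v : 𝓢'(Sp d, ℂ))) = TemperedDistribution.smulLeftCLM ℂ
      (fun x : Sp d => (((2 * π) ^ 2 * ‖x‖ ^ 2 : ℝ) : ℂ)) ((𝓕 v : L2 d) : 𝓢'(Sp d, ℂ)) := by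
  have hsmul : (fun x : Sp d => (((2 * π) ^ 2 * ‖x‖ ^ 2 : ℝ) : ℂ))
      = (((2 * π) ^ 2 : ℝ) : ℂ) • fun x : Sp d => ((‖x‖ ^ 2 : ℝ) : ℂ) := by
    funext x
    rw [Pi.smul_apply, smul_eq_mul, Complex.ofReal_mul]
  rw [hsmul, TemperedDistribution.smulLeftCLM_smul (hasTemperateGrowth_norm_sq d),
    TemperedDistribution.laplacian_eq_fourierMultiplierCLM, neg_smul, neg_neg,
    ← Complex.coe_smul, FourierTransform.fourier_smul,
    TemperedDistribution.fourierMultiplierCLM_apply, FourierTransform.fourier_fourierInv_eq,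
    Lp.fourier_toTemperedDistribution_eq]
  rfl

theorem fourier_H0_ae {d : ℕ} {v : L2 d} (hv : v ∈ domH0 d) :
    ((𝓕 (H0 v) : L2 d) : Sp d → ℂ) =ᵐ[volume]
      fun x => (((2 * π) ^ 2 * ‖x‖ ^ 2 : ℝ) : ℂ) * (𝓕 v : L2 d) x := by
  rw [← toTemperedDistribution_eq_smulLeftCLM_iff (by fun_prop), ← fourier_neg_laplacian,
    ← H0_spec hv, Lp.fourier_toTemperedDistribution_eq]

theorem fourierL2_H0 {d : ℕ} {v : L2 d} (hv : v ∈ domH0 d) :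
    (fourierL2 d (H0 v) : Sp d → ℂ) =ᵐ[volume]
      fun ξ => ((‖ξ‖ ^ 2 : ℝ) : ℂ) * fourierL2 d v ξ := by
  have hc : 0 < (2 * π)⁻¹ := inv_pos.2 Real.two_pi_pos
  filter_upwards [fourierL2_ae (H0 v), fourierL2_ae v, (quasi_dilate hc).ae (fourier_H0_ae hv)]
    with ξ hHv hv hdil
  have hnorm : (2 * π) ^ 2 * ‖(2 * π)⁻¹ • ξ‖ ^ 2 = ‖ξ‖ ^ 2 := by
    rw [norm_smul, Real.norm_of_nonneg hc.le, ← mul_pow, mul_inv_cancel_left₀ Real.two_pi_pos.ne']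
  rw [hHv, hv, hdil, hnorm, mul_left_comm]

theorem memLp_one_add_norm_sq_mul_fourier {d : ℕ} {v : L2 d}
    (h : MemLp (fun ξ : Sp d => ((‖ξ‖ ^ 2 : ℝ) : ℂ) * fourierL2 d v ξ) 2 volume) :
    MemLp (fun x : Sp d => ((1 + ‖x‖ ^ 2 : ℝ) : ℂ) * (𝓕 v : L2 d) x) 2 volume := by
  have hc := Real.two_pi_pos
  have hv := (Lp.memLp (fourierL2 d v)).add h
  refine (memLp_dilate hc hv.toLp).mono (Continuous.aestronglyMeasurable (by fun_prop) |>.mul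
    (Lp.aestronglyMeasurable _)) ?_
  filter_upwards [(quasi_dilate hc).ae hv.coeFn_toLp, fourier_ae v] with x hx hfx
  have hpi : (1 : ℝ) ≤ (2 * π) ^ 2 := one_le_pow₀ (by linarith [Real.pi_gt_three])
  rw [hx, hfx, Pi.add_apply, ← one_add_mul, mul_left_comm, norm_mul, norm_mul, norm_mul, norm_mul,
    ← Complex.ofReal_one, ← Complex.ofReal_add, Complex.norm_real (1 + _),
    Complex.norm_real (1 + _), Real.norm_of_nonneg (by positivity),
    Real.norm_of_nonneg (by positivity), norm_smul, Real.norm_of_nonneg hc.le, mul_pow]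
  gcongr
  exact le_mul_of_one_le_left (sq_nonneg _) hpi

theorem mem_domH0_iff {d : ℕ} {v : L2 d} :
    v ∈ domH0 d ↔ MemLp (fun ξ : Sp d => ((‖ξ‖ ^ 2 : ℝ) : ℂ) * fourierL2 d v ξ) 2 volume := by
  refine ⟨fun hv => (memLp_congr_ae (fourierL2_H0 hv)).1 (Lp.memLp _), fun h => ?_⟩
  have hmem := memLp_one_add_norm_sq_mul_fourier h
  refine TemperedDistribution.memSobolev_iff_exists_smulLeftCLM_fourier.2 ⟨hmem.toLp, ?_⟩
  rw [Lp.fourier_toTemperedDistribution_eq]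
  refine ((toTemperedDistribution_eq_smulLeftCLM_iff (by fun_prop) _ _).2
    (hmem.coeFn_toLp.trans (Eventually.of_forall fun x => ?_))).symm
  simp only [div_self (two_ne_zero : (2 : ℝ) ≠ 0), Real.rpow_one]

/-! ### Multiplication operators depending on time -/

theorem norm_sq_L2 {X : Type*} [MeasurableSpace X] {μ : Measure X} (f : Lp ℂ 2 μ) :
    ‖f‖ ^ 2 = ∫ x, ‖f x‖ ^ 2 ∂μ := by
  have hinner : ((‖f‖ ^ 2 : ℝ) : ℂ) = ∫ x, ((‖f x‖ ^ 2 : ℝ) : ℂ) ∂μ := by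
    rw [Complex.ofReal_pow]
    refine (inner_self_eq_norm_sq_to_K (𝕜 := ℂ) f).symm.trans ?_
    rw [L2.inner_def]
    refine integral_congr_ae (Eventually.of_forall fun x => ?_)
    exact (inner_self_eq_norm_sq_to_K (𝕜 := ℂ) (f x)).trans (Complex.ofReal_pow _ _).symm
  rw [integral_complex_ofReal] at hinner
  exact Complex.ofReal_injective hinner

theorem tendsto_L2_of_dominated {X ι : Type*} [MeasurableSpace X] {μ : Measure X} {l : Filter ι}
    [l.IsCountablyGenerated] {F : ι → Lp ℂ 2 μ} {f G : Lp ℂ 2 μ} {g : ι → X → ℂ} {K : ℝ}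
    (hF : ∀ᶠ i in l, F i =ᵐ[μ] g i) (hb : ∀ᶠ i in l, ∀ᵐ x ∂μ, ‖g i x - f x‖ ≤ K * ‖G x‖)
    (hlim : ∀ᵐ x ∂μ, Tendsto (fun i => g i x) l (𝓝 (f x))) : Tendsto F l (𝓝 f) := by
  have hint : Tendsto (fun i => ∫ x, ‖g i x - f x‖ ^ 2 ∂μ) l (𝓝 (∫ _, (0 : ℝ) ∂μ)) := by
    refine tendsto_integral_filter_of_dominated_convergence (fun x => K ^ 2 * ‖G x‖ ^ 2) ?_ ?_
      (((Lp.memLp G).integrable_norm_pow (by norm_num)).const_mul _) ?_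
    · filter_upwards [hF] with i hi
      exact (((Lp.aestronglyMeasurable _).congr hi).sub (Lp.aestronglyMeasurable f)).norm.pow 2
    · filter_upwards [hb] with i hi
      filter_upwards [hi] with x hx
      rw [Real.norm_of_nonneg (by positivity), ← mul_pow]
      exact pow_le_pow_left₀ (norm_nonneg _) hx 2
    · filter_upwards [hlim] with x hx
      simpa using ((tendsto_sub_nhds_zero_iff.2 hx).norm.pow 2)
  have hsq : Tendsto (fun i => ‖F i - f‖ ^ 2) l (𝓝 0) := by
    rw [integral_zero] at hint
    refine hint.congr' ?_
    filter_upwards [hF] with i hi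
    rw [norm_sq_L2]
    refine integral_congr_ae ?_
    filter_upwards [hi, Lp.coeFn_sub (F i) f] with x hx hsub
    rw [hsub, Pi.sub_apply, hx]
  have hnorm := hsq.sqrt
  simp only [Real.sqrt_sq (norm_nonneg _), Real.sqrt_zero] at hnorm
  exact tendsto_iff_norm_sub_tendsto_zero.2 hnorm

theorem mulL2_ae {d : ℕ} {m : Sp d → ℂ} {f : L2 d} (h : MemLp (fun ξ => m ξ * f ξ) 2 volume) :
    (mulL2 m f : Sp d → ℂ) =ᵐ[volume] fun ξ => m ξ * f ξ := by
  rw [mulL2, dif_pos h]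
  exact h.coeFn_toLp

theorem mulL2_ae_of_le {d : ℕ} {m : Sp d → ℂ} (hm : AEStronglyMeasurable m volume) {h G : L2 d}
    {K : ℝ} (hb : ∀ᵐ ξ, ‖m ξ * h ξ‖ ≤ K * ‖G ξ‖) :
    (mulL2 m h : Sp d → ℂ) =ᵐ[volume] fun ξ => m ξ * h ξ :=
  mulL2_ae ((Lp.memLp G).of_le_mul (hm.mul (Lp.aestronglyMeasurable h)) hb)

theorem norm_mulL2_le {d : ℕ} {m : Sp d → ℂ} (hm : AEStronglyMeasurable m volume) {h G : L2 d}
    {K : ℝ} (hb : ∀ᵐ ξ, ‖m ξ * h ξ‖ ≤ K * ‖G ξ‖) : ‖mulL2 m h‖ ≤ K * ‖G‖ := by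
  refine Lp.norm_le_mul_norm_of_ae_le_mul ?_
  filter_upwards [mulL2_ae_of_le hm hb, hb] with ξ hmul hle
  rwa [hmul]

theorem continuousWithinAt_mulL2 {d : ℕ} {ι : Type*} [TopologicalSpace ι]
    [FirstCountableTopology ι] {S : Set ι} {t₀ : ι} (ht₀ : t₀ ∈ S) {m : ι → Sp d → ℂ} {h G : L2 d}
    {K : ℝ} (hmeas : ∀ t, AEStronglyMeasurable (m t) volume)
    (hm : ∀ ξ, ContinuousWithinAt (fun t => m t ξ) S t₀)
    (hb : ∀ᶠ t in 𝓝[S] t₀, ∀ᵐ ξ, ‖m t ξ * h ξ‖ ≤ K * ‖G ξ‖) :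
    ContinuousWithinAt (fun t => mulL2 (m t) h) S t₀ := by
  have hb₀ : ∀ᵐ ξ, ‖m t₀ ξ * h ξ‖ ≤ K * ‖G ξ‖ := hb.self_of_nhdsWithin ht₀
  have hm₀ := mulL2_ae_of_le (hmeas t₀) hb₀
  refine tendsto_L2_of_dominated (G := G) (K := 2 * K)
    (hb.mono fun t ht => mulL2_ae_of_le (hmeas t) ht) ?_ ?_
  · filter_upwards [hb] with t ht
    filter_upwards [ht, hb₀, hm₀] with ξ hξ hξ₀ hmul
    rw [hmul]
    linarith [norm_sub_le (m t ξ * h ξ) (m t₀ ξ * h ξ)]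
  · filter_upwards [hm₀] with ξ hmul
    rw [hmul]
    exact (hm ξ).tendsto.mul_const (h ξ)

section IntegralMultiplier

variable {T X : Type*} [MeasurableSpace T] [MeasurableSpace X] {ν : Measure T} {μ : Measure X}
  [SFinite ν] {m : T → X → ℂ} {h G : Lp ℂ 2 μ} {k : T → ℝ}

theorem memLp_integral_mul (hm : Measurable (Function.uncurry m)) (hk : Integrable k ν)
    (hb : ∀ᵐ ξ ∂μ, ∀ᵐ t ∂ν, ‖m t ξ * h ξ‖ ≤ k t * ‖G ξ‖) :
    MemLp (fun ξ => (∫ t, m t ξ ∂ν) * h ξ) 2 μ := by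
  refine (Lp.memLp G).of_le_mul (c := ∫ t, k t ∂ν)
    (hm.stronglyMeasurable.integral_prod_left'.aestronglyMeasurable.mul
      (Lp.aestronglyMeasurable h)) ?_
  filter_upwards [hb] with ξ hξ
  rw [← integral_mul_const, ← integral_mul_const]
  exact norm_integral_le_of_norm_le (hk.mul_const _) hξ

variable [SFinite μ]

theorem integrable_prod_mul_conj (hm : Measurable (Function.uncurry m)) (hk : Integrable k ν)
    (hb : ∀ᵐ ξ ∂μ, ∀ᵐ t ∂ν, ‖m t ξ * h ξ‖ ≤ k t * ‖G ξ‖) (ψ : Lp ℂ 2 μ) :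
    Integrable (fun p : T × X => m p.1 p.2 * h p.2 * starRingEnd ℂ (ψ p.2)) (ν.prod μ) := by
  have hmeas : AEStronglyMeasurable (fun p : T × X => m p.1 p.2 * h p.2 * starRingEnd ℂ (ψ p.2))
      (ν.prod μ) :=
    (hm.aestronglyMeasurable.mul (Lp.aestronglyMeasurable h).comp_snd).mul
      (Complex.continuous_conj.comp_aestronglyMeasurable (Lp.aestronglyMeasurable ψ)).comp_snd
  have hGψ : Integrable (fun ξ => ‖G ξ‖ * ‖ψ ξ‖) μ :=
    (Lp.memLp G).norm.integrable_mul (Lp.memLp ψ).norm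
  have hle : ∀ᵐ ξ ∂μ, ∀ᵐ t ∂ν,
      ‖m t ξ * h ξ * starRingEnd ℂ (ψ ξ)‖ ≤ k t * (‖G ξ‖ * ‖ψ ξ‖) := by
    filter_upwards [hb] with ξ hξ
    filter_upwards [hξ] with t ht
    rw [norm_mul, RCLike.norm_conj, ← mul_assoc]
    gcongr
  refine (integrable_prod_iff' hmeas).2 ⟨?_, ?_⟩
  · filter_upwards [hle, hmeas.prodMk_right] with ξ hξ hmeasξ
    exact (hk.mul_const _).mono' hmeasξ hξ
  · refine (hGψ.const_mul (∫ t, k t ∂ν)).mono' hmeas.norm.prod_swap.integral_prod_right' ?_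
    filter_upwards [hle] with ξ hξ
    rw [Real.norm_of_nonneg (integral_nonneg fun _ => norm_nonneg _), ← integral_mul_const]
    exact integral_mono_of_nonneg (Eventually.of_forall fun _ => norm_nonneg _)
      (hk.mul_const _) hξ

theorem integral_L2_ae {f : T → Lp ℂ 2 μ} (hfi : Integrable f ν)
    (hm : Measurable (Function.uncurry m)) (hf : ∀ᵐ t ∂ν, f t =ᵐ[μ] fun ξ => m t ξ * h ξ)
    (hk : Integrable k ν) (hb : ∀ᵐ ξ ∂μ, ∀ᵐ t ∂ν, ‖m t ξ * h ξ‖ ≤ k t * ‖G ξ‖) :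
    (∫ t, f t ∂ν : Lp ℂ 2 μ) =ᵐ[μ] fun ξ => (∫ t, m t ξ ∂ν) * h ξ := by
  have hJ := memLp_integral_mul hm hk hb
  suffices htoLp : ∫ t, f t ∂ν = hJ.toLp by
    rw [htoLp]
    exact hJ.coeFn_toLp
  refine ext_inner_left ℂ fun ψ => ?_
  have hleft : ∫ t, inner ℂ ψ (f t) ∂ν
      = ∫ t, ∫ ξ, m t ξ * h ξ * starRingEnd ℂ (ψ ξ) ∂μ ∂ν := by
    refine integral_congr_ae (hf.mono fun t ht => ?_)
    simp only [L2.inner_def]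
    refine integral_congr_ae (ht.mono fun ξ hξ => ?_)
    simp only [RCLike.inner_apply, hξ]
  have hright : ∫ ξ, inner ℂ (ψ ξ) ((hJ.toLp : Lp ℂ 2 μ) ξ) ∂μ
      = ∫ ξ, ∫ t, m t ξ * h ξ * starRingEnd ℂ (ψ ξ) ∂ν ∂μ := by
    refine integral_congr_ae (hJ.coeFn_toLp.mono fun ξ hξ => ?_)
    simp only [RCLike.inner_apply, hξ, integral_mul_const]
  rw [← integral_inner hfi, L2.inner_def, hleft, hright]
  exact integral_integral_swap (integrable_prod_mul_conj hm hk hb ψ)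

end IntegralMultiplier

/-! ### The solution on the Fourier side -/

/-- The Fourier multiplier of the solution operator at time `t`. -/
def solSymbol {d : ℕ} (α : ℝ) (κ : ℂ) (t : ℝ) (ξ : Sp d) : ℂ :=
  mittagLeffler α 1 (κ * ((‖ξ‖ ^ 2 * t ^ α : ℝ) : ℂ))

/-- The time derivative of `solSymbol`. -/
def derivSymbol {d : ℕ} (α : ℝ) (κ : ℂ) (t : ℝ) (ξ : Sp d) : ℂ :=
  κ * ((‖ξ‖ ^ 2 * t ^ (α - 1) : ℝ) : ℂ) *
    mittagLeffler α α (κ * ((‖ξ‖ ^ 2 * t ^ α : ℝ) : ℂ))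

/-- Bounds for the solution symbol and its derivative where `h ≠ 0`, which suffice to solve the
equation with initial state `F* h`. -/
structure SymbolBound {d : ℕ} (α γ C X : ℝ) (κ : ℂ) (h : L2 d) : Prop where
  pos : 0 < α
  le_one : α ≤ 1
  one_le : 1 ≤ γ
  const_nonneg : 0 ≤ C
  rate_nonneg : 0 ≤ X
  memLp : MemLp (fun ξ : Sp d => ((‖ξ‖ ^ (2 * γ) : ℝ) : ℂ) * h ξ) 2 volume
  sol_le : ∀ᵐ ξ, h ξ ≠ 0 → ∀ t, 0 ≤ t → ‖solSymbol α κ t ξ‖ ≤ C * Real.exp (X * t)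
  deriv_le : ∀ᵐ ξ, h ξ ≠ 0 → ∀ t, 0 < t →
    ‖derivSymbol α κ t ξ‖ ≤ C * (t ^ (α - 1) + 1) * Real.exp (X * t) * (1 + ‖ξ‖ ^ (2 * γ))

theorem measurable_solSymbol {d : ℕ} {α : ℝ} (hα : 0 < α) (κ : ℂ) (t : ℝ) :
    Measurable (solSymbol (d := d) α κ t) :=
  (continuous_mittagLeffler hα 1).measurable.comp (g := mittagLeffler α 1) (by fun_prop)

theorem measurable_derivSymbol {d : ℕ} {α : ℝ} (hα : 0 < α) (κ : ℂ) :
    Measurable (Function.uncurry (derivSymbol (d := d) α κ)) :=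
  Measurable.mul (by fun_prop)
    ((continuous_mittagLeffler hα α).measurable.comp (g := mittagLeffler α α) (by fun_prop))

theorem continuous_solSymbol {d : ℕ} {α : ℝ} (hα : 0 < α) (κ : ℂ) (ξ : Sp d) :
    Continuous fun t => solSymbol α κ t ξ := by
  have hpow : Continuous fun t : ℝ => t ^ α := Real.continuous_rpow_const hα.le
  exact (continuous_mittagLeffler hα 1).comp (g := mittagLeffler α 1) (by fun_prop)

theorem continuousOn_derivSymbol {d : ℕ} {α : ℝ} (hα : 0 < α) (κ : ℂ) (ξ : Sp d) :
    ContinuousOn (fun t => derivSymbol α κ t ξ) (Ioi 0) := by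
  have hpow : Continuous fun t : ℝ => t ^ α := Real.continuous_rpow_const hα.le
  have hpow_sub_one : ContinuousOn (fun t : ℝ => t ^ (α - 1)) (Ioi 0) := fun t ht =>
    (Real.continuousAt_rpow_const t (α - 1) (Or.inl (ne_of_gt ht))).continuousWithinAt
  refine ContinuousOn.mul (continuousOn_const.mul (Complex.continuous_ofReal.comp_continuousOn
    (continuousOn_const.mul hpow_sub_one))) (Continuous.continuousOn ?_)
  exact (continuous_mittagLeffler hα α).comp (g := mittagLeffler α α) (by fun_prop)

theorem solSymbol_zero {d : ℕ} {α : ℝ} (hα : 0 < α) (κ : ℂ) (ξ : Sp d) :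
    solSymbol α κ 0 ξ = 1 := by
  rw [solSymbol, Real.zero_rpow hα.ne', mul_zero, Complex.ofReal_zero, mul_zero,
    mittagLeffler_zero, Real.Gamma_one, inv_one, Complex.ofReal_one]

theorem integral_mul_derivSymbol {d : ℕ} {α c t : ℝ} (hα : 0 < α) (hc : 0 < c) (ht : 0 < t)
    (κ : ℂ) (ξ : Sp d) :
    ∫ s in (0 : ℝ)..t, (((t - s) ^ (c - 1) : ℝ) : ℂ) * derivSymbol α κ s ξ
      = κ * ((‖ξ‖ ^ 2 : ℝ) : ℂ) * (((Real.Gamma c * t ^ (α + c - 1) : ℝ) : ℂ) *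
        mittagLeffler α (α + c) (κ * ((‖ξ‖ ^ 2 * t ^ α : ℝ) : ℂ))) := by
  have hassoc : ∀ x : ℝ, κ * ((‖ξ‖ ^ 2 * x : ℝ) : ℂ) = κ * ((‖ξ‖ ^ 2 : ℝ) : ℂ) * (x : ℂ) :=
    fun x => by rw [Complex.ofReal_mul, mul_assoc]
  rw [hassoc (t ^ α), ← integral_rpow_mul_mittagLeffler hα hc ht,
    ← intervalIntegral.integral_const_mul]
  refine intervalIntegral.integral_congr fun s _ => ?_
  simp only [derivSymbol, hassoc, Complex.ofReal_mul (_ ^ (c - 1))]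
  ring

/-- The Fourier transform of the solution. -/
def solHat {d : ℕ} (α : ℝ) (κ : ℂ) (h : L2 d) (t : ℝ) : L2 d := mulL2 (solSymbol α κ t) h

/-- The Fourier transform of the time derivative of the solution. -/
def derivHat {d : ℕ} (α : ℝ) (κ : ℂ) (h : L2 d) (t : ℝ) : L2 d := mulL2 (derivSymbol α κ t) h

/-- The Fourier transform of `H₀` applied to the solution. -/
def lapHat {d : ℕ} (α : ℝ) (κ : ℂ) (h : L2 d) (t : ℝ) : L2 d :=
  mulL2 (fun ξ => ((‖ξ‖ ^ 2 : ℝ) : ℂ) * solSymbol α κ t ξ) h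

/-- The weighted function `(1 + |ξ|^(2γ)) h`, which dominates all the multipliers applied to `h`. -/
def weighted {d : ℕ} (γ : ℝ) (h : L2 d) : L2 d :=
  h + mulL2 (fun ξ : Sp d => ((‖ξ‖ ^ (2 * γ) : ℝ) : ℂ)) h

theorem sq_le_one_add_rpow {x γ : ℝ} (hx : 0 ≤ x) (hγ : 1 ≤ γ) : x ^ 2 ≤ 1 + x ^ (2 * γ) := by
  rcases le_total x 1 with h | h
  · exact (pow_le_one₀ hx h).trans (le_add_of_nonneg_right (Real.rpow_nonneg hx _))
  · rw [← Real.rpow_natCast x 2]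
    have := Real.rpow_le_rpow_of_exponent_le h (show ((2 : ℕ) : ℝ) ≤ 2 * γ by push_cast; linarith)
    linarith

namespace SymbolBound

variable {d : ℕ} {α γ C X : ℝ} {κ : ℂ} {h : L2 d} (B : SymbolBound α γ C X κ h)
include B

theorem norm_weighted_ae : ∀ᵐ ξ, ‖weighted γ h ξ‖ = (1 + ‖ξ‖ ^ (2 * γ)) * ‖h ξ‖ := by
  filter_upwards [Lp.coeFn_add h (mulL2 (fun ξ : Sp d => ((‖ξ‖ ^ (2 * γ) : ℝ) : ℂ)) h),
    mulL2_ae B.memLp] with ξ hadd hmul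
  rw [weighted, hadd, Pi.add_apply, hmul, ← one_add_mul, norm_mul, ← Complex.ofReal_one,
    ← Complex.ofReal_add, Complex.norm_real, Real.norm_of_nonneg (by positivity)]

theorem const_mul_exp_le {s t : ℝ} (hst : s ≤ t) :
    C * Real.exp (X * s) ≤ C * Real.exp (X * t) :=
  mul_le_mul_of_nonneg_left
    (Real.exp_le_exp.2 (mul_le_mul_of_nonneg_left hst B.rate_nonneg)) B.const_nonneg

theorem sol_mul_le : ∀ᵐ ξ, ∀ s t, 0 ≤ s → s ≤ t →
    ‖solSymbol α κ s ξ * h ξ‖ ≤ C * Real.exp (X * t) * ‖h ξ‖ := by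
  filter_upwards [B.sol_le] with ξ hξ s t hs hst
  by_cases h0 : h ξ = 0
  · simp [h0]
  · rw [norm_mul]
    gcongr
    exact (hξ h0 s hs).trans (B.const_mul_exp_le hst)

theorem lap_mul_le : ∀ᵐ ξ, ∀ s t, 0 ≤ s → s ≤ t →
    ‖((‖ξ‖ ^ 2 : ℝ) : ℂ) * solSymbol α κ s ξ * h ξ‖
      ≤ C * Real.exp (X * t) * ‖weighted γ h ξ‖ := by
  filter_upwards [B.sol_mul_le, B.norm_weighted_ae] with ξ hξ hweight s t hs hst
  rw [mul_assoc, norm_mul, Complex.norm_real, Real.norm_of_nonneg (by positivity), hweight,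
    mul_left_comm]
  exact mul_le_mul (sq_le_one_add_rpow (norm_nonneg ξ) B.one_le) (hξ s t hs hst) (norm_nonneg _)
    (by positivity)

theorem deriv_mul_le : ∀ᵐ ξ, ∀ s t, 0 < s → s ≤ t →
    ‖derivSymbol α κ s ξ * h ξ‖
      ≤ (s ^ (α - 1) + 1) * (C * Real.exp (X * t)) * ‖weighted γ h ξ‖ := by
  filter_upwards [B.deriv_le, B.norm_weighted_ae] with ξ hξ hweight s t hs hst
  have hexp := B.const_mul_exp_le hst
  by_cases h0 : h ξ = 0
  · have := B.const_nonneg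
    rw [h0, mul_zero, norm_zero]
    positivity
  · rw [norm_mul, hweight, ← mul_assoc]
    gcongr
    calc ‖derivSymbol α κ s ξ‖
        ≤ C * (s ^ (α - 1) + 1) * Real.exp (X * s) * (1 + ‖ξ‖ ^ (2 * γ)) := hξ h0 s hs
      _ = (s ^ (α - 1) + 1) * (C * Real.exp (X * s)) * (1 + ‖ξ‖ ^ (2 * γ)) := by ring
      _ ≤ (s ^ (α - 1) + 1) * (C * Real.exp (X * t)) * (1 + ‖ξ‖ ^ (2 * γ)) := by gcongr

theorem aestronglyMeasurable_sol (t : ℝ) :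
    AEStronglyMeasurable (solSymbol (d := d) α κ t) volume :=
  (measurable_solSymbol B.pos κ t).aestronglyMeasurable

theorem aestronglyMeasurable_lap (t : ℝ) :
    AEStronglyMeasurable (fun ξ : Sp d => ((‖ξ‖ ^ 2 : ℝ) : ℂ) * solSymbol α κ t ξ) volume :=
  AEStronglyMeasurable.mul (by fun_prop) (B.aestronglyMeasurable_sol t)

theorem aestronglyMeasurable_deriv (t : ℝ) :
    AEStronglyMeasurable (derivSymbol (d := d) α κ t) volume :=
  ((measurable_derivSymbol B.pos κ).comp measurable_prodMk_left).aestronglyMeasurable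

theorem memLp_sol {t : ℝ} (ht : 0 ≤ t) : MemLp (fun ξ => solSymbol α κ t ξ * h ξ) 2 volume :=
  (Lp.memLp h).of_le_mul
    ((B.aestronglyMeasurable_sol t).mul (Lp.aestronglyMeasurable h))
    (B.sol_mul_le.mono fun _ hξ => hξ t t ht le_rfl)

theorem solHat_ae {t : ℝ} (ht : 0 ≤ t) :
    (solHat α κ h t : Sp d → ℂ) =ᵐ[volume] fun ξ => solSymbol α κ t ξ * h ξ :=
  mulL2_ae (B.memLp_sol ht)

theorem lapHat_ae {t : ℝ} (ht : 0 ≤ t) :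
    (lapHat α κ h t : Sp d → ℂ) =ᵐ[volume]
      fun ξ => ((‖ξ‖ ^ 2 : ℝ) : ℂ) * solSymbol α κ t ξ * h ξ :=
  mulL2_ae_of_le (B.aestronglyMeasurable_lap t) (B.lap_mul_le.mono fun _ hξ => hξ t t ht le_rfl)

theorem derivHat_ae {t : ℝ} (ht : 0 < t) :
    (derivHat α κ h t : Sp d → ℂ) =ᵐ[volume] fun ξ => derivSymbol α κ t ξ * h ξ :=
  mulL2_ae_of_le (B.aestronglyMeasurable_deriv t)
    (B.deriv_mul_le.mono fun _ hξ => hξ t t ht le_rfl)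

theorem norm_solHat_le {s t : ℝ} (hs : 0 ≤ s) (hst : s ≤ t) :
    ‖solHat α κ h s‖ ≤ C * Real.exp (X * t) * ‖h‖ :=
  norm_mulL2_le (B.aestronglyMeasurable_sol s) (B.sol_mul_le.mono fun _ hξ => hξ s t hs hst)

theorem norm_lapHat_le {s t : ℝ} (hs : 0 ≤ s) (hst : s ≤ t) :
    ‖lapHat α κ h s‖ ≤ C * Real.exp (X * t) * ‖weighted γ h‖ :=
  norm_mulL2_le (B.aestronglyMeasurable_lap s) (B.lap_mul_le.mono fun _ hξ => hξ s t hs hst)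

theorem norm_derivHat_le {s t : ℝ} (hs : 0 < s) (hst : s ≤ t) :
    ‖derivHat α κ h s‖ ≤ (s ^ (α - 1) + 1) * (C * Real.exp (X * t)) * ‖weighted γ h‖ :=
  norm_mulL2_le (B.aestronglyMeasurable_deriv s) (B.deriv_mul_le.mono fun _ hξ => hξ s t hs hst)

theorem continuousOn_solHat : ContinuousOn (solHat α κ h) (Ici 0) := by
  intro t₀ ht₀
  refine continuousWithinAt_mulL2 ht₀ (G := h) (K := C * Real.exp (X * (t₀ + 1)))
    B.aestronglyMeasurable_sol
    (fun ξ => (continuous_solSymbol B.pos κ ξ).continuousWithinAt) ?_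
  filter_upwards [self_mem_nhdsWithin, nhdsWithin_le_nhds (Iic_mem_nhds (lt_add_one t₀))]
    with t ht htle
  filter_upwards [B.sol_mul_le] with ξ hξ using hξ t _ ht htle

theorem continuousOn_lapHat : ContinuousOn (lapHat α κ h) (Ici 0) := by
  intro t₀ ht₀
  refine continuousWithinAt_mulL2 ht₀ (G := weighted γ h) (K := C * Real.exp (X * (t₀ + 1)))
    B.aestronglyMeasurable_lap
    (fun ξ => (continuous_const.mul (continuous_solSymbol B.pos κ ξ)).continuousWithinAt) ?_
  filter_upwards [self_mem_nhdsWithin, nhdsWithin_le_nhds (Iic_mem_nhds (lt_add_one t₀))]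
    with t ht htle
  filter_upwards [B.lap_mul_le] with ξ hξ using hξ t _ ht htle

theorem continuousOn_derivHat : ContinuousOn (derivHat α κ h) (Ioi 0) := by
  intro t₀ ht₀
  have hhalf : 0 < t₀ / 2 := half_pos ht₀
  refine continuousWithinAt_mulL2 ht₀ (G := weighted γ h)
    (K := ((t₀ / 2) ^ (α - 1) + 1) * (C * Real.exp (X * (t₀ + 1)))) B.aestronglyMeasurable_deriv
    (fun ξ => continuousOn_derivSymbol B.pos κ ξ t₀ ht₀) ?_
  filter_upwards [nhdsWithin_le_nhds (Iic_mem_nhds (lt_add_one t₀)),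
    nhdsWithin_le_nhds (Ici_mem_nhds (half_lt_self ht₀))] with t htle hle
  have hpow : t ^ (α - 1) ≤ (t₀ / 2) ^ (α - 1) :=
    Real.rpow_le_rpow_of_nonpos hhalf hle (sub_nonpos.2 B.le_one)
  filter_upwards [B.deriv_mul_le] with ξ hξ
  refine (hξ t _ (hhalf.trans_le hle) htle).trans ?_
  have := B.const_nonneg
  gcongr

theorem solHat_zero : solHat α κ h 0 = h := by
  apply Lp.ext
  filter_upwards [B.solHat_ae le_rfl] with ξ hξ
  rw [hξ, solSymbol_zero B.pos, one_mul]

theorem integrableOn_kernel_mul_weight {c t : ℝ} (hc : 0 < c) (ht : 0 < t) (M : ℝ) :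
    IntegrableOn (fun s => (t - s) ^ (c - 1) * ((s ^ (α - 1) + 1) * M)) (Ioc 0 t) := by
  have hα := (intervalIntegrable_iff_integrableOn_Ioc_of_le ht.le).1
    (intervalIntegrable_rpow_mul_rpow B.pos hc ht)
  have hone := (intervalIntegrable_iff_integrableOn_Ioc_of_le ht.le).1
    (intervalIntegrable_rpow_mul_rpow one_pos hc ht)
  refine IntegrableOn.congr_fun (Integrable.mul_const (Integrable.add hα hone) M) (fun s _ => ?_)
    measurableSet_Ioc
  simp only [Pi.add_apply, sub_self, Real.rpow_zero, mul_one]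
  ring

theorem integrableOn_smul_derivHat {c t : ℝ} (hc : 0 < c) (ht : 0 < t) :
    IntegrableOn (fun s => (t - s) ^ (c - 1) • derivHat α κ h s) (Ioc 0 t) := by
  refine ((B.integrableOn_kernel_mul_weight hc ht (C * Real.exp (X * t))).mul_const
    ‖weighted γ h‖).mono' ?_ (ae_restrict_of_forall_mem measurableSet_Ioc fun s hs => ?_)
  · exact AEStronglyMeasurable.smul
      (Measurable.aestronglyMeasurable (f := fun s : ℝ => (t - s) ^ (c - 1)) (by fun_prop))
      ((B.continuousOn_derivHat.mono Ioc_subset_Ioi_self).aestronglyMeasurable measurableSet_Ioc)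
  · have hpow : 0 ≤ (t - s) ^ (c - 1) := Real.rpow_nonneg (sub_nonneg.2 hs.2) _
    rw [norm_smul, Real.norm_of_nonneg hpow, mul_assoc]
    exact mul_le_mul_of_nonneg_left (B.norm_derivHat_le hs.1 hs.2) hpow

theorem integral_smul_derivHat_ae_eq_symbol {c t : ℝ} (hc : 0 < c) (ht : 0 < t) :
    ((∫ s in (0 : ℝ)..t, (t - s) ^ (c - 1) • derivHat α κ h s : L2 d) : Sp d → ℂ) =ᵐ[volume]
      fun ξ => (∫ s in (0 : ℝ)..t, (((t - s) ^ (c - 1) : ℝ) : ℂ) * derivSymbol α κ s ξ) * h ξ := by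
  simp only [intervalIntegral.integral_of_le ht.le]
  refine integral_L2_ae (G := weighted γ h) (B.integrableOn_smul_derivHat hc ht)
    (Measurable.mul (by fun_prop) (measurable_derivSymbol B.pos κ))
    (ae_restrict_of_forall_mem measurableSet_Ioc fun s hs => ?_)
    (B.integrableOn_kernel_mul_weight hc ht (C * Real.exp (X * t))) ?_
  · filter_upwards [Lp.coeFn_smul ((t - s) ^ (c - 1)) (derivHat α κ h s), B.derivHat_ae hs.1]
      with ξ hsmul hderiv
    rw [hsmul, Pi.smul_apply, hderiv, Complex.real_smul, mul_assoc]
  · filter_upwards [B.deriv_mul_le] with ξ hξ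
    refine ae_restrict_of_forall_mem measurableSet_Ioc fun s hs => ?_
    have hpow : 0 ≤ (t - s) ^ (c - 1) := Real.rpow_nonneg (sub_nonneg.2 hs.2) _
    rw [mul_assoc, norm_mul, Complex.norm_real, Real.norm_of_nonneg hpow, mul_assoc _ _ ‖_‖]
    exact mul_le_mul_of_nonneg_left (hξ s t hs.1 hs.2) hpow

theorem integral_smul_derivHat_ae {c t : ℝ} (hc : 0 < c) (ht : 0 < t) :
    ((∫ s in (0 : ℝ)..t, (t - s) ^ (c - 1) • derivHat α κ h s : L2 d) : Sp d → ℂ) =ᵐ[volume]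
      fun ξ => κ * ((‖ξ‖ ^ 2 : ℝ) : ℂ) * (((Real.Gamma c * t ^ (α + c - 1) : ℝ) : ℂ) *
        mittagLeffler α (α + c) (κ * ((‖ξ‖ ^ 2 * t ^ α : ℝ) : ℂ))) * h ξ := by
  filter_upwards [B.integral_smul_derivHat_ae_eq_symbol hc ht] with ξ hξ
  rw [hξ, integral_mul_derivSymbol B.pos hc ht]

theorem integral_derivHat {t : ℝ} (ht : 0 < t) :
    ∫ s in (0 : ℝ)..t, derivHat α κ h s = solHat α κ h t - h := by
  have hint := B.integral_smul_derivHat_ae one_pos ht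
  simp only [sub_self, Real.rpow_zero, one_smul] at hint
  apply Lp.ext
  filter_upwards [hint, Lp.coeFn_sub (solHat α κ h t) h, B.solHat_ae ht.le] with ξ hξ hsub hsol
  rw [hξ, hsub, Pi.sub_apply, hsol, solSymbol, mittagLeffler_succ B.pos 1, Real.Gamma_one,
    add_sub_cancel_right]
  push_cast
  ring

theorem integral_caputo_derivHat (hα : α < 1) {t : ℝ} (ht : 0 < t) :
    ∫ s in (0 : ℝ)..t, (t - s) ^ (-α) • derivHat α κ h s
      = Real.Gamma (1 - α) • κ • lapHat α κ h t := by
  have hint := B.integral_smul_derivHat_ae (c := 1 - α) (sub_pos.2 hα) ht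
  simp only [sub_sub_cancel_left, add_sub_cancel, sub_self, Real.rpow_zero, mul_one] at hint
  apply Lp.ext
  filter_upwards [hint, Lp.coeFn_smul (Real.Gamma (1 - α)) (κ • lapHat α κ h t),
    Lp.coeFn_smul κ (lapHat α κ h t), B.lapHat_ae ht.le] with ξ hξ hsmul hsmul' hlap
  rw [hξ, hsmul, Pi.smul_apply, hsmul', Pi.smul_apply, hlap, solSymbol, Complex.real_smul,
    smul_eq_mul]
  ring

theorem derivHat_of_eq_one (hα : α = 1) {t : ℝ} (ht : 0 < t) :
    derivHat α κ h t = κ • lapHat α κ h t := by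
  apply Lp.ext
  filter_upwards [B.derivHat_ae ht, Lp.coeFn_smul κ (lapHat α κ h t), B.lapHat_ae ht.le]
    with ξ hderiv hsmul hlap
  rw [hderiv, hsmul, Pi.smul_apply, hlap, solSymbol, derivSymbol, hα, sub_self, Real.rpow_zero,
    mul_one, smul_eq_mul]
  ring

end SymbolBound

/-! ### Existence -/

theorem measurableSet_timeInterval (T : EReal) : MeasurableSet (timeInterval T) :=
  (measurableSet_lt measurable_const measurable_id).inter
    (measurableSet_lt measurable_coe_real_ereal measurable_const)

theorem isOpen_timeInterval (T : EReal) : IsOpen (timeInterval T) :=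
  (isOpen_lt continuous_const continuous_id).inter
    (isOpen_lt continuous_coe_real_ereal continuous_const)

theorem timeInterval_subset_Ioi (T : EReal) : timeInterval T ⊆ Ioi 0 := fun _ ht => ht.1

section TestFunction

variable {E : Type*} [NormedAddCommGroup E] [NormedSpace ℝ E] {J : Set ℝ} {φ : ℝ → ℝ}

theorem integrable_smul_of_tsupport_subset (hJ : IsOpen J) (hφ : Continuous φ)
    (hc : HasCompactSupport φ) (hs : tsupport φ ⊆ J) {u : ℝ → E} (hu : ContinuousOn u J) :
    Integrable fun t => φ t • u t := by
  refine (continuous_of_tsupport fun t ht => ?_).integrable_of_hasCompactSupport hc.smul_right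
  exact hφ.continuousAt.smul
    (hu.continuousAt (hJ.mem_nhds (hs (tsupport_smul_subset_left φ u ht))))

theorem hasDerivAt_smul_of_tsupport_subset (hφ : Differentiable ℝ φ) (hs : tsupport φ ⊆ J)
    {u g : ℝ → E} (hd : ∀ t ∈ J, HasDerivAt u (g t) t) (t : ℝ) :
    HasDerivAt (fun t => φ t • u t) (deriv φ t • u t + φ t • g t) t := by
  by_cases ht : t ∈ tsupport φ
  · rw [add_comm]
    exact (hφ t).hasDerivAt.smul (hd t (hs ht))
  · rw [image_eq_zero_of_notMem_tsupport ht, deriv_of_notMem_tsupport ht, zero_smul, zero_smul,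
      add_zero]
    exact HasDerivAt.of_notMem_tsupport fun h => ht (tsupport_smul_subset_left φ u h)

theorem setIntegral_smul_eq_integral (hs : tsupport φ ⊆ J) (u : ℝ → E) :
    ∫ t in J, φ t • u t = ∫ t, φ t • u t := by
  refine setIntegral_eq_integral_of_forall_compl_eq_zero fun t ht => ?_
  rw [image_eq_zero_of_notMem_tsupport fun h => ht (hs h), zero_smul]

end TestFunction

theorem hasWeakDeriv_of_hasDerivAt {d : ℕ} {J : Set ℝ} (hJ : IsOpen J) {u g : ℝ → L2 d}
    (hg : ContinuousOn g J) (hd : ∀ t ∈ J, HasDerivAt u (g t) t) : HasWeakDeriv J u g := by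
  have hu : ContinuousOn u J := fun t ht => (hd t ht).continuousAt.continuousWithinAt
  refine ⟨hu.locallyIntegrableOn hJ.measurableSet, hg.locallyIntegrableOn hJ.measurableSet,
    fun φ hφ hc hs => ?_⟩
  have hs' : tsupport (deriv φ) ⊆ J := tsupport_deriv_subset.trans hs
  have hderiv : Integrable fun t => deriv φ t • u t :=
    integrable_smul_of_tsupport_subset hJ (hφ.continuous_deriv (by simp)) hc.deriv hs' hu
  have hg : Integrable fun t => φ t • g t :=
    integrable_smul_of_tsupport_subset hJ hφ.continuous hc hs hg
  have hu : Integrable fun t => φ t • u t :=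
    integrable_smul_of_tsupport_subset hJ hφ.continuous hc hs hu
  rw [setIntegral_smul_eq_integral hs', setIntegral_smul_eq_integral hs, eq_neg_iff_add_eq_zero,
    ← integral_add hderiv hg]
  exact integral_eq_zero_of_hasDerivAt_of_integrable
    (hasDerivAt_smul_of_tsupport_subset (hφ.differentiable (by simp)) hs hd) (hderiv.add hg) hu

theorem rpow_le_one_add {x a : ℝ} (hx : 0 ≤ x) (ha : 0 ≤ a) (ha1 : a ≤ 1) : x ^ a ≤ 1 + x := by
  rcases le_total x 1 with hx1 | hx1
  · linarith [Real.rpow_le_one hx hx1 ha]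
  · linarith [Real.rpow_le_self_of_one_le hx1 ha1]

/-- The solution with initial state `F* h`. -/
def sol {d : ℕ} (α : ℝ) (κ : ℂ) (h : L2 d) (t : ℝ) : L2 d :=
  (fourierL2 d).symm (solHat α κ h t)

/-- The time derivative of the solution with initial state `F* h`. -/
def solDeriv {d : ℕ} (α : ℝ) (κ : ℂ) (h : L2 d) (t : ℝ) : L2 d :=
  (fourierL2 d).symm (derivHat α κ h t)

/-- The inverse Fourier transform as a real-linear map, for use with real derivatives and
integrals in time. -/
def fourierInvCLM (d : ℕ) : L2 d →L[ℝ] L2 d :=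
  (fourierL2 d).symm.toContinuousLinearEquiv.toContinuousLinearMap.restrictScalars ℝ

namespace SymbolBound

variable {d : ℕ} {α γ C X : ℝ} {κ : ℂ} {h : L2 d} (B : SymbolBound α γ C X κ h)
include B

theorem sol_mem_domH0 {t : ℝ} (ht : 0 ≤ t) : sol α κ h t ∈ domH0 d := by
  rw [mem_domH0_iff, sol, LinearIsometryEquiv.apply_symm_apply]
  refine (memLp_congr_ae ?_).1 (Lp.memLp (lapHat α κ h t))
  filter_upwards [B.lapHat_ae ht, B.solHat_ae ht] with ξ hlap hsol
  rw [hlap, hsol, mul_assoc]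

theorem H0_sol {t : ℝ} (ht : 0 ≤ t) :
    H0 (sol α κ h t) = (fourierL2 d).symm (lapHat α κ h t) := by
  rw [LinearIsometryEquiv.eq_symm_apply]
  apply Lp.ext
  have hH0 := fourierL2_H0 (B.sol_mem_domH0 ht)
  rw [sol, LinearIsometryEquiv.apply_symm_apply] at hH0
  filter_upwards [hH0, B.lapHat_ae ht, B.solHat_ae ht] with ξ hξ hlap hsol
  rw [sol, hξ, hlap, hsol, mul_assoc]

theorem norm_sol_le {s t : ℝ} (hs : 0 ≤ s) (hst : s ≤ t) :
    ‖sol α κ h s‖ ≤ C * Real.exp (X * t) * ‖h‖ := by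
  rw [sol, LinearIsometryEquiv.norm_map]
  exact B.norm_solHat_le hs hst

theorem norm_H0_sol_le {s t : ℝ} (hs : 0 ≤ s) (hst : s ≤ t) :
    ‖H0 (sol α κ h s)‖ ≤ C * Real.exp (X * t) * ‖weighted γ h‖ := by
  rw [B.H0_sol hs, LinearIsometryEquiv.norm_map]
  exact B.norm_lapHat_le hs hst

theorem norm_solDeriv_le {s t : ℝ} (hs : 0 < s) (hst : s ≤ t) :
    ‖solDeriv α κ h s‖ ≤ (s ^ (α - 1) + 1) * (C * Real.exp (X * t)) * ‖weighted γ h‖ := by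
  rw [solDeriv, LinearIsometryEquiv.norm_map]
  exact B.norm_derivHat_le hs hst

theorem continuousOn_sol : ContinuousOn (sol α κ h) (Ici 0) :=
  (fourierL2 d).symm.continuous.comp_continuousOn B.continuousOn_solHat

theorem continuousOn_H0_sol : ContinuousOn (fun t => H0 (sol α κ h t)) (Ici 0) :=
  ((fourierL2 d).symm.continuous.comp_continuousOn B.continuousOn_lapHat).congr
    fun _ ht => B.H0_sol ht

theorem continuousOn_solDeriv : ContinuousOn (solDeriv α κ h) (Ioi 0) :=
  (fourierL2 d).symm.continuous.comp_continuousOn B.continuousOn_derivHat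

theorem integrableOn_smul_solDeriv {c t : ℝ} (hc : 0 < c) (ht : 0 < t) :
    IntegrableOn (fun s => (t - s) ^ (c - 1) • solDeriv α κ h s) (Ioc 0 t) := by
  refine ((fourierInvCLM d).integrable_comp (B.integrableOn_smul_derivHat hc ht)).congr
    (Eventually.of_forall fun s => ?_)
  exact (fourierInvCLM d).map_smul _ _

theorem integrableOn_derivHat {t : ℝ} (ht : 0 < t) : IntegrableOn (derivHat α κ h) (Ioc 0 t) := by
  simpa using B.integrableOn_smul_derivHat one_pos ht

theorem hasDerivAt_sol {t : ℝ} (ht : 0 < t) : HasDerivAt (sol α κ h) (solDeriv α κ h t) t := by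
  have hprimitive : HasDerivAt (fun s => h + ∫ r in (0 : ℝ)..s, derivHat α κ h r)
      (derivHat α κ h t) t := by
    refine HasDerivAt.const_add h (intervalIntegral.integral_hasDerivAt_right
      ((intervalIntegrable_iff_integrableOn_Ioc_of_le ht.le).2 (B.integrableOn_derivHat ht)) ?_ ?_)
    · exact B.continuousOn_derivHat.stronglyMeasurableAtFilter isOpen_Ioi t ht
    · exact B.continuousOn_derivHat.continuousAt (Ioi_mem_nhds ht)
  have hsolHat : HasDerivAt (solHat α κ h) (derivHat α κ h t) t := by
    refine hprimitive.congr_of_eventuallyEq ?_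
    filter_upwards [Ioi_mem_nhds ht] with s hs
    rw [B.integral_derivHat hs, add_sub_cancel]
  exact (fourierInvCLM d).hasFDerivAt.comp_hasDerivAt t hsolHat

theorem hasWeakDeriv_sol {J : Set ℝ} (hJ : IsOpen J) (hJ0 : J ⊆ Ioi 0) :
    HasWeakDeriv J (sol α κ h) (solDeriv α κ h) :=
  hasWeakDeriv_of_hasDerivAt hJ (B.continuousOn_solDeriv.mono hJ0)
    fun _ ht => B.hasDerivAt_sol (hJ0 ht)

theorem caputo_solDeriv {t : ℝ} (ht : 0 < t) :
    caputo α (solDeriv α κ h) t = κ • H0 (sol α κ h t) := by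
  rw [caputo, B.H0_sol ht.le]
  split_ifs with hα1
  · rw [solDeriv, B.derivHat_of_eq_one hα1 ht, map_smul]
  · have hα : α < 1 := lt_of_le_of_ne B.le_one hα1
    have hint : ∫ s in (0 : ℝ)..t, (t - s) ^ (-α) • solDeriv α κ h s
        = fourierInvCLM d (∫ s in (0 : ℝ)..t, (t - s) ^ (-α) • derivHat α κ h s) := by
      have hi : IntervalIntegrable (fun s => (t - s) ^ (-α) • derivHat α κ h s) volume 0 t := by
        rw [intervalIntegrable_iff_integrableOn_Ioc_of_le ht.le]
        simpa only [sub_sub_cancel_left] using B.integrableOn_smul_derivHat (sub_pos.2 hα) ht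
      rw [← (fourierInvCLM d).intervalIntegral_comp_comm hi]
      exact intervalIntegral.integral_congr fun s _ => ((fourierInvCLM d).map_smul _ _).symm
    rw [hint, B.integral_caputo_derivHat hα ht, (fourierInvCLM d).map_smul, smul_smul,
      inv_mul_cancel₀ (Real.Gamma_pos_of_pos (sub_pos.2 hα)).ne', one_smul]
    exact (fourierL2 d).symm.map_smul _ _

theorem hasCaputoDeriv_sol (T : EReal) :
    HasCaputoDeriv α T (sol α κ h) (fun t => κ • H0 (sol α κ h t)) := by
  refine ⟨solDeriv α κ h, B.hasWeakDeriv_sol (isOpen_timeInterval T) (timeInterval_subset_Ioi T),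
    ae_restrict_of_forall_mem (measurableSet_timeInterval T) fun t ht =>
      ⟨fun hα => ?_, (B.caputo_solDeriv ht.1).symm⟩⟩
  rw [intervalIntegrable_iff_integrableOn_Ioc_of_le ht.1.le]
  simpa only [sub_sub_cancel_left] using B.integrableOn_smul_solDeriv (sub_pos.2 hα) ht.1

theorem isSolution_sol {β : ℝ} (hκ : Complex.I ^ (β : ℂ) * κ = 1) (T : EReal) :
    IsSolution α β ((fourierL2 d).symm h) T (sol α κ h) where
  continuousOn := B.continuousOn_sol.mono fun _ ht => ht.1.le
  mem_dom := ae_restrict_of_forall_mem (measurableSet_timeInterval T)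
    fun _ ht => B.sol_mem_domH0 ht.1.le
  locallyIntegrable_H0 := (B.continuousOn_H0_sol.mono fun _ ht => ht.1.le).locallyIntegrableOn
    (measurableSet_timeInterval T)
  equation := by
    refine ⟨_, B.hasCaputoDeriv_sol T, Eventually.of_forall fun t => ?_⟩
    rw [smul_smul, neg_mul, hκ, neg_smul, one_smul, neg_add_cancel]
  initial := by
    have hlim := (B.continuousOn_sol 0 self_mem_Ici).tendsto
    rw [sol, B.solHat_zero] at hlim
    exact hlim.mono_left (nhdsWithin_mono _ Ioi_subset_Ici_self)

theorem memCDom_sol (T : ℝ) : MemCDom T (sol α κ h) :=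
  ⟨fun _ ht => B.sol_mem_domH0 ht.1, B.continuousOn_sol.mono fun _ ht => ht.1,
    B.continuousOn_H0_sol.mono fun _ ht => ht.1⟩

theorem memW11_sol {T : ℝ} (hT : 0 < T) : MemW11 T (sol α κ h) := by
  have hsol : IntegrableOn (sol α κ h) (Icc 0 T) :=
    (B.continuousOn_sol.mono fun _ ht => ht.1).integrableOn_Icc
  have hderiv : IntegrableOn (solDeriv α κ h) (Ioc 0 T) := by
    simpa using B.integrableOn_smul_solDeriv one_pos hT
  exact ⟨hsol.mono_set Ioo_subset_Icc_self, solDeriv α κ h,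
    B.hasWeakDeriv_sol isOpen_Ioo fun _ ht => ht.1, hderiv.mono_set Ioo_subset_Ioc_self⟩

theorem eNormCDom_sol_le (T : ℝ) : eNormCDom T (sol α κ h) ≤
    ENNReal.ofReal (C * Real.exp (X * T) * (‖h‖ + ‖weighted γ h‖)) := by
  refine iSup₂_le fun t ht => ENNReal.ofReal_le_ofReal ?_
  calc normH0 (sol α κ h t) ≤ ‖sol α κ h t‖ + ‖H0 (sol α κ h t)‖ := by
        refine Real.sqrt_le_iff.2 ⟨by positivity, ?_⟩
        nlinarith [norm_nonneg (sol α κ h t), norm_nonneg (H0 (sol α κ h t))]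
    _ ≤ C * Real.exp (X * T) * (‖h‖ + ‖weighted γ h‖) := by
        rw [mul_add]
        exact add_le_add (B.norm_sol_le ht.1 ht.2) (B.norm_H0_sol_le ht.1 ht.2)

theorem lintegral_sol_le (T : ℝ) :
    ∫⁻ t in Ioo 0 T, ‖sol α κ h t‖ₑ ≤ ENNReal.ofReal (C * Real.exp (X * T) * ‖h‖ * T) := by
  have hC := B.const_nonneg
  calc ∫⁻ t in Ioo 0 T, ‖sol α κ h t‖ₑ
      ≤ ∫⁻ _ in Ioo 0 T, ENNReal.ofReal (C * Real.exp (X * T) * ‖h‖) := by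
        refine setLIntegral_mono measurable_const fun t ht => ?_
        rw [← ofReal_norm]
        exact ENNReal.ofReal_le_ofReal (B.norm_sol_le ht.1.le ht.2.le)
    _ = ENNReal.ofReal (C * Real.exp (X * T) * ‖h‖ * T) := by
        rw [setLIntegral_const, Real.volume_Ioo, sub_zero, ← ENNReal.ofReal_mul (by positivity)]

theorem lintegral_solDeriv_le {T : ℝ} (hT : 0 < T) : ∫⁻ t in Ioo 0 T, ‖solDeriv α κ h t‖ₑ
    ≤ ENNReal.ofReal ((T ^ α / α + T) * (C * Real.exp (X * T) * ‖weighted γ h‖)) := by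
  have hC := B.const_nonneg
  set M := C * Real.exp (X * T) * ‖weighted γ h‖ with hM
  have hpow : IntervalIntegrable (fun t : ℝ => t ^ (α - 1)) volume 0 T :=
    intervalIntegral.intervalIntegrable_rpow' (by linarith [B.pos])
  have hint : IntegrableOn (fun t : ℝ => (t ^ (α - 1) + 1) * M) (Ioo 0 T) :=
    ((intervalIntegrable_iff_integrableOn_Ioc_of_le hT.le).1
      ((hpow.add intervalIntegrable_const).mul_const M)).mono_set Ioo_subset_Ioc_self
  have hintegral : ∫ t in Ioo 0 T, (t ^ (α - 1) + 1) * M = (T ^ α / α + T) * M := by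
    rw [← integral_Ioc_eq_integral_Ioo, ← intervalIntegral.integral_of_le hT.le,
      intervalIntegral.integral_mul_const, intervalIntegral.integral_add hpow
      intervalIntegrable_const, integral_rpow (Or.inl (by linarith [B.pos])),
      intervalIntegral.integral_const, sub_add_cancel, Real.zero_rpow B.pos.ne', sub_zero,
      smul_eq_mul, mul_one, sub_zero]
  have hnonneg : ∀ t ∈ Ioo 0 T, 0 ≤ (t ^ (α - 1) + 1) * M := fun t ht => by
    have := Real.rpow_nonneg ht.1.le (α - 1)
    positivity
  rw [← hintegral, ofReal_integral_eq_lintegral_ofReal hint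
    (ae_restrict_of_forall_mem measurableSet_Ioo hnonneg)]
  refine setLIntegral_mono (by fun_prop) fun t ht => ?_
  rw [← ofReal_norm]
  refine ENNReal.ofReal_le_ofReal ((B.norm_solDeriv_le ht.1 ht.2.le).trans_eq ?_)
  rw [hM, mul_assoc]

theorem eNormW11_sol_le {T : ℝ} (hT : 0 < T) : eNormW11 T (sol α κ h) ≤
    ENNReal.ofReal (C * Real.exp (X * T) * ‖h‖ * T) +
      ENNReal.ofReal ((T ^ α / α + T) * (C * Real.exp (X * T) * ‖weighted γ h‖)) :=
  add_le_add (B.lintegral_sol_le T)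
    ((iInf₂_le (solDeriv α κ h) (B.hasWeakDeriv_sol isOpen_Ioo fun _ ht => ht.1)).trans
      (B.lintegral_solDeriv_le hT))

theorem eNorm_sol_le {T : ℝ} (hT : 0 < T) :
    eNormCDom T (sol α κ h) + eNormW11 T (sol α κ h) ≤
      ENNReal.ofReal (C * (6 + 2 / α) * (1 + T) * Real.exp (X * T) *
        √(‖h‖ ^ 2 + ‖mulL2 (fun ξ : Sp d => ((‖ξ‖ ^ (2 * γ) : ℝ) : ℂ)) h‖ ^ 2)) := by
  have hC := B.const_nonneg
  have hα := B.pos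
  set g := mulL2 (fun ξ : Sp d => ((‖ξ‖ ^ (2 * γ) : ℝ) : ℂ)) h
  set N := √(‖h‖ ^ 2 + ‖g‖ ^ 2)
  have hh : ‖h‖ ≤ N := Real.le_sqrt_of_sq_le (le_add_of_nonneg_right (sq_nonneg _))
  have hweighted : ‖weighted γ h‖ ≤ 2 * N := by
    have hgN : ‖g‖ ≤ N := Real.le_sqrt_of_sq_le (le_add_of_nonneg_left (sq_nonneg _))
    exact (norm_add_le h g).trans (by linarith)
  refine (add_le_add (B.eNormCDom_sol_le T) (B.eNormW11_sol_le hT)).trans ?_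
  rw [← ENNReal.ofReal_add (by positivity) (by positivity),
    ← ENNReal.ofReal_add (by positivity) (by positivity)]
  refine ENNReal.ofReal_le_ofReal ?_
  calc C * Real.exp (X * T) * (‖h‖ + ‖weighted γ h‖) + (C * Real.exp (X * T) * ‖h‖ * T +
        (T ^ α / α + T) * (C * Real.exp (X * T) * ‖weighted γ h‖))
      ≤ C * Real.exp (X * T) * (N + 2 * N) + (C * Real.exp (X * T) * N * T +
        ((1 + T) / α + T) * (C * Real.exp (X * T) * (2 * N))) := by
        gcongr
        exact rpow_le_one_add hT.le hα.le B.le_one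
    _ = C * Real.exp (X * T) * N * (3 * (1 + T) + 2 / α * (1 + T)) := by ring
    _ ≤ C * Real.exp (X * T) * N * (6 * (1 + T) + 2 / α * (1 + T)) := by gcongr; norm_num
    _ = C * (6 + 2 / α) * (1 + T) * Real.exp (X * T) * N := by ring

end SymbolBound

/-! ### Weak derivatives and increments -/

/-- The smooth approximation of the indicator function of `(a, ∞)` which increases from `0` to `1`
on `[a, a + ε]`. -/
def smoothStep (a ε x : ℝ) : ℝ := Real.smoothTransition ((x - a) / ε)

section SmoothStep

variable {a b ε x : ℝ}

theorem contDiff_smoothStep (a ε : ℝ) : ContDiff ℝ ∞ (smoothStep a ε) :=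
  (Real.smoothTransition.contDiff (n := ⊤)).comp (by fun_prop : ContDiff ℝ ∞ fun x => (x - a) / ε)

theorem continuous_deriv_smoothStep (a ε : ℝ) : Continuous (deriv (smoothStep a ε)) :=
  (contDiff_smoothStep a ε).continuous_deriv (by simp)

theorem monotone_smoothStep (hε : 0 < ε) : Monotone (smoothStep a ε) := fun _ _ hxy =>
  Real.smoothTransition.monotone (by gcongr)

theorem smoothStep_of_le (hε : 0 < ε) (hx : x ≤ a) : smoothStep a ε x = 0 :=
  Real.smoothTransition.zero_of_nonpos (div_nonpos_of_nonpos_of_nonneg (sub_nonpos.2 hx) hε.le)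

theorem smoothStep_of_add_le (hε : 0 < ε) (hx : a + ε ≤ x) : smoothStep a ε x = 1 :=
  Real.smoothTransition.one_of_one_le (by rw [one_le_div hε]; linarith)

theorem deriv_smoothStep_of_add_lt (hε : 0 < ε) (hx : a + ε < x) :
    deriv (smoothStep a ε) x = 0 := by
  have hone : smoothStep a ε =ᶠ[𝓝 x] fun _ => 1 := by
    filter_upwards [Ioi_mem_nhds hx] with y hy using smoothStep_of_add_le hε (le_of_lt hy)
  rw [hone.deriv_eq, deriv_const]

theorem eventually_smoothStep_eq_indicator (a x : ℝ) :
    ∀ᶠ ε in 𝓝[>] 0, smoothStep a ε x = (Ioi a).indicator 1 x := by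
  rcases le_or_gt x a with hx | hx
  · filter_upwards [self_mem_nhdsWithin] with ε hε
    rw [smoothStep_of_le hε hx, indicator_of_notMem (notMem_Ioi.2 hx)]
  · filter_upwards [Ioo_mem_nhdsGT (sub_pos.2 hx)] with ε hε
    rw [smoothStep_of_add_le hε.1 (by linarith [hε.2]), indicator_of_mem (mem_Ioi.2 hx),
      Pi.one_apply]

theorem setIntegral_deriv_smoothStep (hε : 0 < ε) (hb : a + ε ≤ b) :
    ∫ x in Icc a b, deriv (smoothStep a ε) x = 1 := by
  have hab : a ≤ b := by linarith
  rw [integral_Icc_eq_integral_Ioc, ← intervalIntegral.integral_of_le hab,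
    intervalIntegral.integral_deriv_eq_sub
      (fun x _ => (contDiff_smoothStep a ε).differentiable (by simp) x)
      ((continuous_deriv_smoothStep a ε).intervalIntegrable a b),
    smoothStep_of_add_le hε hb, smoothStep_of_le hε le_rfl, sub_zero]

theorem tendsto_setIntegral_deriv_smoothStep_smul {E : Type*} [NormedAddCommGroup E]
    [NormedSpace ℝ E] [CompleteSpace E] {u : ℝ → E} (hab : a < b)
    (hu : ContinuousOn u (Icc a b)) :
    Tendsto (fun ε => ∫ x in Icc a b, deriv (smoothStep a ε) x • u x) (𝓝[>] 0) (𝓝 (u a)) := by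
  refine tendsto_setIntegral_peak_smul_of_integrableOn_of_tendsto measurableSet_Icc
    measurableSet_Icc Subset.rfl self_mem_nhdsWithin measure_Icc_lt_top.ne ?_ ?_ ?_
    (Eventually.of_forall fun ε => (continuous_deriv_smoothStep a ε).aestronglyMeasurable)
    hu.integrableOn_Icc (hu a (left_mem_Icc.2 hab.le))
  · filter_upwards [self_mem_nhdsWithin] with ε hε x _ using
      (monotone_smoothStep hε).deriv_nonneg
  · intro U hU haU
    obtain ⟨c, hac, hc⟩ := mem_nhdsGE_iff_exists_Ico_subset.1
      (mem_nhdsWithin_of_mem_nhds (hU.mem_nhds haU))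
    refine Metric.tendstoUniformlyOn_iff.2 fun δ hδ => ?_
    filter_upwards [Ioo_mem_nhdsGT (sub_pos.2 hac)] with ε hε x hx
    have hcx : c ≤ x := not_lt.1 fun hxc => hx.2 (hc ⟨hx.1.1, hxc⟩)
    rwa [deriv_smoothStep_of_add_lt hε.1 (by linarith [hε.2]), Pi.zero_apply, dist_self]
  · refine tendsto_const_nhds.congr' ?_
    filter_upwards [Ioo_mem_nhdsGT (sub_pos.2 hab)] with ε hε
    rw [setIntegral_deriv_smoothStep hε.1 (by linarith [hε.2])]

end SmoothStep

/-- The smooth approximation of the indicator function of `(s, t]` used to test weak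
derivatives. -/
def smoothCutoff (s t ε x : ℝ) : ℝ := smoothStep s ε x - smoothStep t ε x

section SmoothCutoff

variable {s t b ε x : ℝ}

theorem contDiff_smoothCutoff (s t ε : ℝ) : ContDiff ℝ ∞ (smoothCutoff s t ε) :=
  (contDiff_smoothStep s ε).sub (contDiff_smoothStep t ε)

theorem deriv_smoothCutoff (s t ε x : ℝ) :
    deriv (smoothCutoff s t ε) x = deriv (smoothStep s ε) x - deriv (smoothStep t ε) x :=
  deriv_fun_sub ((contDiff_smoothStep s ε).differentiable (by simp) x)
    ((contDiff_smoothStep t ε).differentiable (by simp) x)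

theorem abs_smoothCutoff_le_one : |smoothCutoff s t ε x| ≤ 1 :=
  abs_sub_le_iff.2
    ⟨(sub_le_self _ (Real.smoothTransition.nonneg _)).trans (Real.smoothTransition.le_one _),
      (sub_le_self _ (Real.smoothTransition.nonneg _)).trans (Real.smoothTransition.le_one _)⟩

theorem tsupport_smoothCutoff_subset (hst : s ≤ t) (hε : 0 < ε) (hb : t + ε ≤ b) :
    tsupport (smoothCutoff s t ε) ⊆ Icc s b := by
  refine closure_minimal (fun x hx => by_contra fun hxs => hx ?_) isClosed_Icc
  rw [mem_Icc, not_and_or, not_le, not_le] at hxs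
  rcases hxs with hxs | hbx
  · rw [smoothCutoff, smoothStep_of_le hε hxs.le, smoothStep_of_le hε (hxs.le.trans hst), sub_zero]
  · rw [smoothCutoff, smoothStep_of_add_le hε (by linarith), smoothStep_of_add_le hε (by linarith),
      sub_self]

theorem eventually_smoothCutoff_eq_indicator (hst : s ≤ t) (x : ℝ) :
    ∀ᶠ ε in 𝓝[>] 0, smoothCutoff s t ε x = (Ioc s t).indicator 1 x := by
  filter_upwards [eventually_smoothStep_eq_indicator s x, eventually_smoothStep_eq_indicator t x]
    with ε hs ht
  rw [smoothCutoff, hs, ht, ← Ioi_sdiff_Ioi, indicator_sdiff (Ioi_subset_Ioi hst), Pi.sub_apply]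

variable {E : Type*} [NormedAddCommGroup E] [NormedSpace ℝ E]

theorem tendsto_setIntegral_smoothCutoff_smul {g : ℝ → E} (hst : s ≤ t) (htb : t ≤ b)
    (hg : IntegrableOn g (Icc s b)) :
    Tendsto (fun ε => ∫ x in Icc s b, smoothCutoff s t ε x • g x) (𝓝[>] 0)
      (𝓝 (∫ x in s..t, g x)) := by
  have hlim : ∫ x in s..t, g x = ∫ x in Icc s b, (Ioc s t).indicator (1 : ℝ → ℝ) x • g x := by
    have hsmul : ∀ x, (Ioc s t).indicator (1 : ℝ → ℝ) x • g x = (Ioc s t).indicator g x :=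
      fun x => by simp only [indicator_apply, Pi.one_apply, ite_smul, one_smul, zero_smul]
    simp_rw [hsmul]
    rw [setIntegral_indicator measurableSet_Ioc, intervalIntegral.integral_of_le hst,
      inter_eq_right.2 (Ioc_subset_Icc_self.trans (Icc_subset_Icc_right htb))]
  rw [hlim]
  refine tendsto_integral_filter_of_dominated_convergence (fun x => ‖g x‖)
    (Eventually.of_forall fun ε =>
      (contDiff_smoothCutoff s t ε).continuous.aestronglyMeasurable.smul hg.1)
    (Eventually.of_forall fun ε => Eventually.of_forall fun x => ?_) hg.norm
    (Eventually.of_forall fun x => ?_)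
  · rw [norm_smul]
    exact mul_le_of_le_one_left (norm_nonneg _) abs_smoothCutoff_le_one
  · refine tendsto_const_nhds.congr' ?_
    filter_upwards [eventually_smoothCutoff_eq_indicator hst x] with ε hε
    rw [hε]

theorem tendsto_setIntegral_deriv_smoothCutoff_smul [CompleteSpace E] {u : ℝ → E} (hst : s ≤ t)
    (htb : t < b) (hu : ContinuousOn u (Icc s b)) :
    Tendsto (fun ε => ∫ x in Icc s b, deriv (smoothCutoff s t ε) x • u x) (𝓝[>] 0)
      (𝓝 (u s - u t)) := by
  have hsub : Icc t b ⊆ Icc s b := Icc_subset_Icc_left hst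
  refine ((tendsto_setIntegral_deriv_smoothStep_smul (hst.trans_lt htb) hu).sub
    (tendsto_setIntegral_deriv_smoothStep_smul htb (hu.mono hsub))).congr' ?_
  filter_upwards [self_mem_nhdsWithin] with ε hε
  have hzero : ∫ x in Icc t b, deriv (smoothStep t ε) x • u x
      = ∫ x in Icc s b, deriv (smoothStep t ε) x • u x := by
    refine (setIntegral_eq_of_subset_of_forall_sdiff_eq_zero measurableSet_Icc hsub
      fun x hx => ?_).symm
    have hxt : x < t := not_le.1 fun htx => hx.2 ⟨htx, hx.1.2⟩
    have hconst : smoothStep t ε =ᶠ[𝓝 x] fun _ => 0 := by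
      filter_upwards [Iio_mem_nhds hxt] with y hy using smoothStep_of_le hε (le_of_lt hy)
    rw [hconst.deriv_eq, deriv_const, zero_smul]
  have hint : ∀ a, IntegrableOn (fun x => deriv (smoothStep a ε) x • u x) (Icc s b) := fun a =>
    ((continuous_deriv_smoothStep a ε).continuousOn.smul hu).integrableOn_Icc
  rw [hzero, ← integral_sub (hint s) (hint t)]
  simp only [deriv_smoothCutoff, sub_smul]

end SmoothCutoff

theorem HasWeakDeriv.sub_eq_integral {d : ℕ} {J : Set ℝ} (hJ : IsOpen J) {u g : ℝ → L2 d}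
    (hu : ContinuousOn u J) (hw : HasWeakDeriv J u g) {s t : ℝ} (hst : s ≤ t)
    (hsub : Icc s t ⊆ J) : u t - u s = ∫ x in s..t, g x := by
  obtain ⟨c, htc, hc⟩ := mem_nhdsGE_iff_exists_Icc_subset.1
    (mem_nhdsWithin_of_mem_nhds (hJ.mem_nhds (hsub (right_mem_Icc.2 hst))))
  have hsc : Icc s c ⊆ J := (Icc_union_Icc_eq_Icc hst (le_of_lt htc)).symm.subset.trans
    (union_subset hsub hc)
  have hparts : ∀ᶠ ε in 𝓝[>] 0, ∫ x in Icc s c, deriv (smoothCutoff s t ε) x • u x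
      = -∫ x in Icc s c, smoothCutoff s t ε x • g x := by
    filter_upwards [Ioo_mem_nhdsGT (sub_pos.2 htc)] with ε hε
    have hsupp : tsupport (smoothCutoff s t ε) ⊆ Icc s c :=
      tsupport_smoothCutoff_subset hst hε.1 (by linarith [hε.2])
    have hsupp' := tsupport_deriv_subset.trans hsupp
    rw [setIntegral_smul_eq_integral hsupp', setIntegral_smul_eq_integral hsupp,
      ← setIntegral_smul_eq_integral (hsupp'.trans hsc),
      ← setIntegral_smul_eq_integral (hsupp.trans hsc)]
    exact hw.2.2 _ (contDiff_smoothCutoff s t ε)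
      (isCompact_Icc.of_isClosed_subset (isClosed_tsupport _) hsupp) (hsupp.trans hsc)
  have hlim := tendsto_nhds_unique_of_eventuallyEq
    (tendsto_setIntegral_deriv_smoothCutoff_smul hst htc (hu.mono hsc))
    (tendsto_setIntegral_smoothCutoff_smul hst (le_of_lt htc)
      (hw.2.1.integrableOn_compact_subset hsc isCompact_Icc)).neg hparts
  rw [← neg_sub, hlim, neg_neg]

/-! ### Abel's integral equation -/

section Abel

variable {α s t τ : ℝ}

theorem integral_rpow_mul_rpow_translate (hα : 0 < α) (hα1 : α < 1) (hst : s < t) :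
    ∫ τ in s..t, (t - τ) ^ (α - 1) * (τ - s) ^ (-α) = Real.Gamma α * Real.Gamma (1 - α) := by
  have hbeta := integral_rpow_mul_rpow (p := 1 - α) (c := α) (t := t - s) (by linarith) hα
    (by linarith)
  have htranslate := intervalIntegral.integral_comp_sub_right (a := s) (b := t)
    (fun x : ℝ => (t - s - x) ^ (α - 1) * x ^ (1 - α - 1)) s
  rw [sub_self, hbeta] at htranslate
  have hintegrand : ∀ τ : ℝ, (t - s - (τ - s)) ^ (α - 1) * (τ - s) ^ (1 - α - 1)
      = (t - τ) ^ (α - 1) * (τ - s) ^ (-α) := fun τ => by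
    congr 2 <;> ring
  simp_rw [hintegrand] at htranslate
  rw [htranslate]
  simp [mul_comm]

theorem intervalIntegrable_rpow_mul_rpow_translate (hα : 0 < α) (hα1 : α < 1) (hst : s < t) :
    IntervalIntegrable (fun τ => (t - τ) ^ (α - 1) * (τ - s) ^ (-α)) volume s t := by
  have htranslate := (intervalIntegrable_rpow_mul_rpow (p := 1 - α) (c := α) (t := t - s)
    (by linarith) hα (by linarith)).comp_sub_right s
  rw [zero_add, sub_add_cancel] at htranslate
  refine htranslate.congr fun τ _ => ?_
  congr 2 <;> ring

/-- The product of the two conjugate Abel kernels, over the triangle `s < τ`. It is the integrand,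
in the intermediate time `τ`, of the composition of the two Abel transforms from time `s` to time
`t`. -/
def abelKernel (α t τ s : ℝ) : ℝ :=
  (Ioi s).indicator (fun τ => (t - τ) ^ (α - 1) * (τ - s) ^ (-α)) τ

theorem measurable_uncurry_abelKernel (α t : ℝ) :
    Measurable (Function.uncurry (abelKernel α t)) := by
  have huncurry : Function.uncurry (abelKernel α t) = {p : ℝ × ℝ | p.2 < p.1}.indicator
      fun p => (t - p.1) ^ (α - 1) * (p.1 - p.2) ^ (-α) := by
    ext ⟨τ, s⟩
    simp [abelKernel, indicator, Function.uncurry]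
  rw [huncurry]
  exact Measurable.indicator (by fun_prop) (measurableSet_lt measurable_snd measurable_fst)

theorem abelKernel_nonneg (hτ : τ ≤ t) : 0 ≤ abelKernel α t τ s :=
  indicator_apply_nonneg fun h => mul_nonneg (Real.rpow_nonneg (sub_nonneg.2 hτ) _)
    (Real.rpow_nonneg (sub_nonneg.2 (le_of_lt (mem_Ioi.1 h))) _)

theorem integrableOn_abelKernel (hα : 0 < α) (hα1 : α < 1) (hs : s ∈ Ioo 0 t) :
    IntegrableOn (fun τ => abelKernel α t τ s) (Ioc 0 t) := by
  unfold abelKernel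
  rw [IntegrableOn, integrable_indicator_iff measurableSet_Ioi, IntegrableOn,
    Measure.restrict_restrict measurableSet_Ioi, inter_comm, Ioc_inter_Ioi, max_eq_right hs.1.le]
  exact (intervalIntegrable_iff_integrableOn_Ioc_of_le hs.2.le).1
    (intervalIntegrable_rpow_mul_rpow_translate hα hα1 hs.2)

theorem integral_abelKernel (hα : 0 < α) (hα1 : α < 1) (hs : s ∈ Ioo 0 t) :
    ∫ τ in Ioc 0 t, abelKernel α t τ s = Real.Gamma α * Real.Gamma (1 - α) := by
  unfold abelKernel
  rw [setIntegral_indicator measurableSet_Ioi, Ioc_inter_Ioi, max_eq_right hs.1.le,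
    ← intervalIntegral.integral_of_le hs.2.le, integral_rpow_mul_rpow_translate hα hα1 hs.2]

variable {E : Type*} [NormedAddCommGroup E] [NormedSpace ℝ E] {q : ℝ → E}

theorem setIntegral_abelKernel_smul (hτ : τ ∈ Ioc 0 t) (q : ℝ → E) :
    ∫ s in Ioc 0 t, abelKernel α t τ s • q s
      = (t - τ) ^ (α - 1) • ∫ s in (0 : ℝ)..τ, (τ - s) ^ (-α) • q s := by
  have hset : Ioc 0 t ∩ Iio τ = Ioo 0 τ := by
    ext x
    exact ⟨fun h => ⟨h.1.1, h.2⟩, fun h => ⟨⟨h.1, h.2.le.trans hτ.2⟩, h.2⟩⟩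
  rw [intervalIntegral.integral_of_le hτ.1.le, ← integral_smul,
    ← restrict_Ioo_eq_restrict_Ioc (a := 0) (b := τ), ← hset,
    ← setIntegral_indicator measurableSet_Iio]
  refine integral_congr_ae (Eventually.of_forall fun s => ?_)
  simp only [abelKernel, indicator, mem_Iio, mem_Ioi]
  split_ifs
  · rw [smul_smul]
  · rw [zero_smul]

theorem ae_restrict_Ioc_mem_Ioo (a b : ℝ) : ∀ᵐ s ∂volume.restrict (Ioc a b), s ∈ Ioo a b := by
  rw [← restrict_Ioo_eq_restrict_Ioc]
  exact ae_restrict_mem measurableSet_Ioo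

theorem integrable_prod_abelKernel_smul (hα : 0 < α) (hα1 : α < 1)
    (hq : IntegrableOn q (Ioc 0 t)) :
    Integrable (Function.uncurry fun τ s => abelKernel α t τ s • q s)
      ((volume.restrict (Ioc 0 t)).prod (volume.restrict (Ioc 0 t))) := by
  have hmeas : AEStronglyMeasurable (Function.uncurry fun τ s => abelKernel α t τ s • q s)
      ((volume.restrict (Ioc 0 t)).prod (volume.restrict (Ioc 0 t))) :=
    (measurable_uncurry_abelKernel α t).aestronglyMeasurable.smul hq.1.comp_snd
  refine (integrable_prod_iff' hmeas).2 ⟨?_, ?_⟩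
  · filter_upwards [ae_restrict_Ioc_mem_Ioo 0 t] with s hs
    exact (integrableOn_abelKernel hα hα1 hs).smul_const (q s)
  · refine (hq.norm.const_mul (Real.Gamma α * Real.Gamma (1 - α))).congr ?_
    filter_upwards [ae_restrict_Ioc_mem_Ioo 0 t] with s hs
    rw [← integral_abelKernel hα hα1 hs, ← integral_mul_const]
    refine setIntegral_congr_fun measurableSet_Ioc fun τ hτ => ?_
    rw [Function.uncurry_apply_pair, norm_smul, Real.norm_of_nonneg (abelKernel_nonneg hτ.2)]

theorem integral_abel [CompleteSpace E] (hα : 0 < α) (hα1 : α < 1) (ht : 0 ≤ t)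
    (hq : IntervalIntegrable q volume 0 t) :
    ∫ τ in (0 : ℝ)..t, (t - τ) ^ (α - 1) • ∫ s in (0 : ℝ)..τ, (τ - s) ^ (-α) • q s
      = (Real.Gamma α * Real.Gamma (1 - α)) • ∫ s in (0 : ℝ)..t, q s := by
  have hswap := integral_integral_swap (integrable_prod_abelKernel_smul hα hα1
    ((intervalIntegrable_iff_integrableOn_Ioc_of_le ht).1 hq))
  rw [intervalIntegral.integral_of_le ht, intervalIntegral.integral_of_le ht, ← integral_smul]
  calc _ = ∫ τ in Ioc 0 t, ∫ s in Ioc 0 t, abelKernel α t τ s • q s :=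
        setIntegral_congr_fun measurableSet_Ioc fun τ hτ => (setIntegral_abelKernel_smul hτ q).symm
    _ = ∫ s in Ioc 0 t, ∫ τ in Ioc 0 t, abelKernel α t τ s • q s := hswap
    _ = _ := by
        refine integral_congr_ae ?_
        filter_upwards [ae_restrict_Ioc_mem_Ioo 0 t] with s hs
        rw [integral_smul_const, integral_abelKernel hα hα1 hs]

end Abel

/-! ### A Gronwall inequality with a weakly singular kernel -/

section Gronwall

variable {α K M b t μ : ℝ} {f : ℝ → ℝ}

theorem integral_rpow_mul_exp_le (hα : 0 < α) (hμ : 0 < μ) (ht : 0 ≤ t) :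
    ∫ s in (0 : ℝ)..t, (t - s) ^ (α - 1) * Real.exp (μ * s)
      ≤ Real.exp (μ * t) * ((1 / μ) ^ α * Real.Gamma α) := by
  have hreflect := intervalIntegral.integral_comp_sub_left (a := 0) (b := t)
    (fun x : ℝ => x ^ (α - 1) * Real.exp (μ * (t - x))) t
  simp only [sub_sub_cancel, sub_self, sub_zero] at hreflect
  have hint : IntegrableOn (fun x : ℝ => x ^ (α - 1) * Real.exp (-(μ * x))) (Ioi 0) := by
    simpa using integrableOn_rpow_mul_exp_neg_mul_rpow (p := 1) (s := α - 1) (b := μ)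
      (by linarith) one_pos hμ
  have hfactor : ∀ x : ℝ, x ^ (α - 1) * Real.exp (μ * (t - x))
      = Real.exp (μ * t) * (x ^ (α - 1) * Real.exp (-(μ * x))) := fun x => by
    rw [show μ * (t - x) = μ * t + -(μ * x) by ring, Real.exp_add]; ring
  rw [hreflect, ← Real.integral_rpow_mul_exp_neg_mul_Ioi hα hμ, ← integral_const_mul,
    intervalIntegral.integral_of_le ht]
  simp_rw [hfactor]
  refine setIntegral_mono_set (hint.const_mul _)
    (ae_restrict_of_forall_mem measurableSet_Ioi fun x hx => ?_) Ioc_subset_Ioi_self.eventuallyLE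
  have := Real.rpow_nonneg (le_of_lt (mem_Ioi.1 hx)) (α - 1)
  simp only [Pi.zero_apply]
  positivity

theorem intervalIntegrable_sub_rpow (hα : 0 < α) :
    IntervalIntegrable (fun s => (t - s) ^ (α - 1)) volume 0 t := by
  simpa using ((intervalIntegral.intervalIntegrable_rpow' (a := 0) (b := t)
    (show -1 < α - 1 by linarith)).comp_sub_left t).symm

theorem exists_rate_mul_Gamma_le_half (hα : 0 < α) (hK : 0 ≤ K) :
    ∃ μ : ℝ, 0 < μ ∧ K * ((1 / μ) ^ α * Real.Gamma α) ≤ 1 / 2 := by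
  have hB : 0 < 2 * K * Real.Gamma α + 1 := by positivity
  refine ⟨(2 * K * Real.Gamma α + 1) ^ (1 / α), by positivity, ?_⟩
  rw [Real.div_rpow zero_le_one (by positivity), Real.one_rpow, ← Real.rpow_mul hB.le,
    one_div_mul_cancel hα.ne', Real.rpow_one, one_div, ← div_eq_inv_mul, ← mul_div_assoc,
    div_le_iff₀ hB]
  linarith

theorem integral_rpow_mul_le_of_le_exp {A : ℝ} (hα : 0 < α) (hμ : 0 < μ) (ht : 0 ≤ t)
    (hA : 0 ≤ A) (hf0 : ∀ s ∈ Ioc 0 t, 0 ≤ f s) (hf : ∀ s ∈ Ioc 0 t, f s ≤ A * Real.exp (μ * s)) :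
    ∫ s in (0 : ℝ)..t, (t - s) ^ (α - 1) * f s
      ≤ Real.exp (μ * t) * ((1 / μ) ^ α * Real.Gamma α) * A := by
  have hkernel : ∀ s ∈ Ioc 0 t, 0 ≤ (t - s) ^ (α - 1) := fun s hs =>
    Real.rpow_nonneg (sub_nonneg.2 hs.2) _
  have hmono : ∫ s in (0 : ℝ)..t, (t - s) ^ (α - 1) * f s
      ≤ ∫ s in (0 : ℝ)..t, (t - s) ^ (α - 1) * Real.exp (μ * s) * A := by
    rw [intervalIntegral.integral_of_le ht, intervalIntegral.integral_of_le ht]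
    refine integral_mono_of_nonneg
      (ae_restrict_of_forall_mem measurableSet_Ioc fun s hs => mul_nonneg (hkernel s hs) (hf0 s hs))
      ((intervalIntegrable_iff_integrableOn_Ioc_of_le ht).1
        (((intervalIntegrable_sub_rpow hα).mul_continuousOn
          (g := fun s => Real.exp (μ * s)) (by fun_prop)).mul_const A))
      (ae_restrict_of_forall_mem measurableSet_Ioc fun s hs => ?_)
    simp only
    linarith [mul_le_mul_of_nonneg_left (hf s hs) (hkernel s hs)]
  rw [intervalIntegral.integral_mul_const] at hmono
  exact hmono.trans (mul_le_mul_of_nonneg_right (integral_rpow_mul_exp_le hα hμ ht) hA)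

-- In the weighted norm `sup e^{-μt} |f t|` the integral operator is a contraction of ratio `1/2`.
theorem le_geometric_mul_exp_of_le_integral (hα : 0 < α) (hK : 0 ≤ K) (hμ : 0 < μ)
    (hrate : K * ((1 / μ) ^ α * Real.Gamma α) ≤ 1 / 2)
    (hf0 : ∀ t ∈ Ioc 0 b, 0 ≤ f t) (hfM : ∀ t ∈ Ioc 0 b, f t ≤ M)
    (hf : ∀ t ∈ Ioc 0 b, f t ≤ K * ∫ s in (0 : ℝ)..t, (t - s) ^ (α - 1) * f s) (n : ℕ) :
    ∀ t ∈ Ioc 0 b, f t ≤ M * (1 / 2) ^ n * Real.exp (μ * t) := by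
  have hM : ∀ t ∈ Ioc 0 b, 0 ≤ M := fun t ht => (hf0 t ht).trans (hfM t ht)
  induction n with
  | zero =>
    intro t ht
    rw [pow_zero, mul_one]
    exact (hfM t ht).trans
      (le_mul_of_one_le_right (hM t ht) (Real.one_le_exp (mul_nonneg hμ.le ht.1.le)))
  | succ n ih =>
    intro t ht
    have hM0 := hM t ht
    have hsub : ∀ s ∈ Ioc 0 t, s ∈ Ioc 0 b := fun s hs => ⟨hs.1, hs.2.trans ht.2⟩
    calc f t ≤ K * ∫ s in (0 : ℝ)..t, (t - s) ^ (α - 1) * f s := hf t ht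
      _ ≤ K * (Real.exp (μ * t) * ((1 / μ) ^ α * Real.Gamma α) * (M * (1 / 2) ^ n)) :=
          mul_le_mul_of_nonneg_left (integral_rpow_mul_le_of_le_exp hα hμ ht.1.le (by positivity)
            (fun s hs => hf0 s (hsub s hs)) fun s hs => ih s (hsub s hs)) hK
      _ = K * ((1 / μ) ^ α * Real.Gamma α) * (M * (1 / 2) ^ n * Real.exp (μ * t)) := by ring
      _ ≤ 1 / 2 * (M * (1 / 2) ^ n * Real.exp (μ * t)) :=
          mul_le_mul_of_nonneg_right hrate (by positivity)
      _ = M * (1 / 2) ^ (n + 1) * Real.exp (μ * t) := by rw [pow_succ]; ring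

theorem eq_zero_of_le_integral (hα : 0 < α) (hK : 0 ≤ K)
    (hf0 : ∀ t ∈ Ioc 0 b, 0 ≤ f t) (hfM : ∀ t ∈ Ioc 0 b, f t ≤ M)
    (hf : ∀ t ∈ Ioc 0 b, f t ≤ K * ∫ s in (0 : ℝ)..t, (t - s) ^ (α - 1) * f s) :
    ∀ t ∈ Ioc 0 b, f t = 0 := by
  obtain ⟨μ, hμ, hrate⟩ := exists_rate_mul_Gamma_le_half hα hK
  intro t ht
  refine le_antisymm ?_ (hf0 t ht)
  have hlim : Tendsto (fun n : ℕ => M * (1 / 2 : ℝ) ^ n * Real.exp (μ * t)) atTop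
      (𝓝 (M * 0 * Real.exp (μ * t))) :=
    ((tendsto_pow_atTop_nhds_zero_of_lt_one (by norm_num) (by norm_num)).const_mul M).mul_const _
  rw [mul_zero, zero_mul] at hlim
  exact ge_of_tendsto' hlim fun n =>
    le_geometric_mul_exp_of_le_integral hα hK hμ hrate hf0 hfM hf n t ht

end Gronwall

/-! ### Bounded Fourier multipliers -/

/-- Multiplication by a function `m ∈ L^∞` as a bounded operator on `L²`. -/
def mulCLM {d : ℕ} {m : Sp d → ℂ} (hm : MemLp m ∞ volume) : L2 d →L[ℂ] L2 d :=
  (ContinuousLinearMap.mul ℂ ℂ).holderL volume ∞ 2 2 (hm.toLp m)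

theorem mulCLM_ae {d : ℕ} {m : Sp d → ℂ} (hm : MemLp m ∞ volume) (f : L2 d) :
    (mulCLM hm f : Sp d → ℂ) =ᵐ[volume] fun ξ => m ξ * f ξ := by
  filter_upwards [ContinuousLinearMap.coeFn_holder (r := 2) (ContinuousLinearMap.mul ℂ ℂ)
    (hm.toLp m) f, hm.coeFn_toLp] with ξ hξ hmξ
  rw [← hmξ]
  exact hξ

theorem memLp_top_indicator_closedBall {d : ℕ} {m : Sp d → ℂ} (hm : Continuous m) (R : ℝ) :
    MemLp ((Metric.closedBall 0 R).indicator m) ∞ volume := by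
  obtain ⟨K, hK⟩ := (isCompact_closedBall (0 : Sp d) R).exists_bound_of_continuousOn
    hm.continuousOn
  refine memLp_top_of_bound (hm.aestronglyMeasurable.indicator measurableSet_closedBall) |K|
    (Eventually.of_forall fun ξ => ?_)
  by_cases hξ : ξ ∈ Metric.closedBall 0 R
  · rw [indicator_of_mem hξ]
    exact (hK ξ hξ).trans (le_abs_self K)
  · rw [indicator_of_notMem hξ, norm_zero]
    exact abs_nonneg K

-- `Q` cuts the Fourier transform off outside a ball, where `|ξ|²` is bounded.
theorem exists_truncation (d : ℕ) (R : ℝ) : ∃ Q A : L2 d →L[ℂ] L2 d,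
    (∀ v ∈ domH0 d, Q (H0 v) = A (Q v)) ∧
      ∀ v, Q v = 0 → ∀ᵐ ξ, ‖ξ‖ ≤ R → fourierL2 d v ξ = 0 := by
  have hp : MemLp ((Metric.closedBall (0 : Sp d) R).indicator fun _ => (1 : ℂ)) ∞ volume :=
    memLp_top_indicator_closedBall continuous_const R
  have ha : MemLp ((Metric.closedBall (0 : Sp d) R).indicator fun ξ => ((‖ξ‖ ^ 2 : ℝ) : ℂ)) ∞
      volume := memLp_top_indicator_closedBall (by fun_prop) R
  refine ⟨(mulCLM hp).comp (fourierL2 d).toContinuousLinearEquiv.toContinuousLinearMap,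
    mulCLM ha, fun v hv => ?_, fun v hv => ?_⟩
  · change mulCLM hp (fourierL2 d (H0 v)) = mulCLM ha (mulCLM hp (fourierL2 d v))
    apply Lp.ext
    filter_upwards [mulCLM_ae hp (fourierL2 d (H0 v)), mulCLM_ae ha (mulCLM hp (fourierL2 d v)),
      mulCLM_ae hp (fourierL2 d v), fourierL2_H0 hv] with ξ hleft hright hcut hH0
    rw [hleft, hright, hcut, hH0]
    simp only [indicator]
    split_ifs <;> simp
  · change mulCLM hp (fourierL2 d v) = 0 at hv
    have hcut := mulCLM_ae hp (fourierL2 d v)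
    rw [hv] at hcut
    filter_upwards [hcut, Lp.coeFn_zero ℂ 2 (volume : Measure (Sp d))] with ξ hξ hzero hle
    rw [hzero] at hξ
    simpa [indicator, hle] using hξ.symm

/-! ### Uniqueness of solutions -/

theorem sub_eq_integral_of_tendsto {E : Type*} [NormedAddCommGroup E] [NormedSpace ℝ E]
    {y p : ℝ → E} {y₀ : E} {t : ℝ} (ht : 0 < t) (hp : IntervalIntegrable p volume 0 t)
    (hy : Tendsto y (𝓝[>] 0) (𝓝 y₀)) (h : ∀ s ∈ Ioo 0 t, y t - y s = ∫ x in s..t, p x) :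
    y t - y₀ = ∫ x in (0 : ℝ)..t, p x := by
  have hprimitive : Tendsto (fun s => ∫ x in t..s, p x) (𝓝[>] 0) (𝓝 (∫ x in t..0, p x)) := by
    refine (intervalIntegral.continuousOn_primitive_interval' hp right_mem_uIcc
      0 left_mem_uIcc).tendsto.mono_left ?_
    rw [uIcc_of_le ht.le]
    exact nhdsWithin_le_of_mem (Icc_mem_nhdsGT_of_mem ⟨le_rfl, ht⟩)
  have hincrement : Tendsto (fun s => y t - y s) (𝓝[>] 0) (𝓝 (-∫ x in t..0, p x)) := by
    refine hprimitive.neg.congr' ?_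
    filter_upwards [Ioo_mem_nhdsGT ht] with s hs
    rw [h s hs, intervalIntegral.integral_symm, neg_neg]
  rw [tendsto_nhds_unique (tendsto_const_nhds.sub hy) hincrement,
    ← intervalIntegral.integral_symm]

theorem Icc_subset_timeInterval {T : EReal} {s t : ℝ} (hs : 0 < s) (ht : t ∈ timeInterval T) :
    Icc s t ⊆ timeInterval T := fun _ hx =>
  ⟨hs.trans_le hx.1, (EReal.coe_le_coe_iff.2 hx.2).trans_lt ht.2⟩

theorem Ioc_subset_timeInterval {T : EReal} {t : ℝ} (ht : t ∈ timeInterval T) :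
    Ioc 0 t ⊆ timeInterval T := fun _ hx =>
  ⟨hx.1, (EReal.coe_le_coe_iff.2 hx.2).trans_lt ht.2⟩

theorem exists_gt_of_ae {J : Set ℝ} (hJ : IsOpen J) {P : ℝ → Prop}
    (hP : ∀ᵐ t ∂(volume.restrict J), P t) {t : ℝ} (ht : t ∈ J) : ∃ τ, t < τ ∧ P τ := by
  obtain ⟨b, htb, hb⟩ := mem_nhdsGE_iff_exists_Ico_subset.1
    (mem_nhdsWithin_of_mem_nhds (hJ.mem_nhds ht))
  have : NeBot (ae (volume.restrict (Ioo t b))) := by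
    rw [ae_neBot, Ne, Measure.restrict_eq_zero]
    simpa using htb
  obtain ⟨τ, hPτ, hτ⟩ := ((ae_restrict_of_ae_restrict_of_subset
    (Ioo_subset_Ico_self.trans hb) hP).and (ae_restrict_mem measurableSet_Ioo)).exists
  exact ⟨τ, hτ.1, hPτ⟩

theorem intervalIntegrable_of_rpow_smul {E : Type*} [NormedAddCommGroup E] [NormedSpace ℝ E]
    {α t τ : ℝ} (hα : 0 ≤ α) (ht : 0 ≤ t) (htτ : t ≤ τ) {g : ℝ → E}
    (hg : IntervalIntegrable (fun s => (τ - s) ^ (-α) • g s) volume 0 τ) :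
    IntervalIntegrable g volume 0 t := by
  have hprod : IntervalIntegrable (fun s => (τ - s) ^ α • (τ - s) ^ (-α) • g s) volume 0 τ :=
    hg.continuousOn_smul (f := fun s => (τ - s) ^ α)
      (ContinuousOn.rpow_const (by fun_prop) fun _ _ => Or.inr hα)
  rw [intervalIntegrable_iff_integrableOn_Ioo_of_le (ht.trans htτ)] at hprod
  rw [intervalIntegrable_iff_integrableOn_Ioo_of_le ht]
  refine (hprod.congr_fun (fun s hs => ?_) measurableSet_Ioo).mono_set (Ioo_subset_Ioo_right htτ)
  rw [smul_smul, ← Real.rpow_add (sub_pos.2 hs.2), add_neg_cancel, Real.rpow_zero, one_smul]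

section Caputo

variable {d : ℕ} {α t : ℝ}

theorem caputo_map (hα1 : α ≤ 1) (Q : L2 d →L[ℂ] L2 d) {g : ℝ → L2 d}
    (hg : α < 1 → IntervalIntegrable (fun s => (t - s) ^ (-α) • g s) volume 0 t) :
    caputo α (fun s => Q (g s)) t = Q (caputo α g t) := by
  rcases hα1.eq_or_lt with rfl | hα1
  · rw [caputo, caputo, if_pos rfl, if_pos rfl]
  · simp only [caputo, if_neg hα1.ne, Q.map_smul_of_tower,
      ← Q.intervalIntegral_comp_comm (hg hα1)]

theorem integral_rpow_smul_caputo (hα : 0 < α) (hα1 : α ≤ 1) (ht : 0 ≤ t) {p : ℝ → L2 d}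
    (hp : IntervalIntegrable p volume 0 t) :
    ∫ s in (0 : ℝ)..t, (t - s) ^ (α - 1) • caputo α p s
      = Real.Gamma α • ∫ s in (0 : ℝ)..t, p s := by
  rcases hα1.eq_or_lt with rfl | hα1
  · simp [caputo]
  · have hΓ := (Real.Gamma_pos_of_pos (sub_pos.2 hα1)).ne'
    simp only [caputo, if_neg hα1.ne, smul_comm _ (Real.Gamma (1 - α))⁻¹]
    rw [intervalIntegral.integral_smul, integral_abel hα hα1 ht hp, smul_smul,
      mul_comm (Real.Gamma α), inv_mul_cancel_left₀ hΓ]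

end Caputo

namespace IsSolution

variable {d : ℕ} {α β : ℝ} {κ : ℂ} {u₀ : L2 d} {T : EReal} {u v : ℝ → L2 d}
  {Q A : L2 d →L[ℂ] L2 d}

theorem continuousOn_update (hv : IsSolution α β u₀ T v) {t : ℝ} (ht : t ∈ timeInterval T) :
    ContinuousOn (Function.update v 0 u₀) (Icc 0 t) := by
  rw [continuousOn_update_iff, Icc_sdiff_left]
  exact ⟨hv.continuousOn.mono (Ioc_subset_timeInterval ht), fun _ =>
    hv.initial.mono_left (nhdsWithin_mono _ Ioc_subset_Ioi_self)⟩

theorem exists_hasWeakDeriv_caputo_map (hα1 : α ≤ 1) (hκ : Complex.I ^ (β : ℂ) * κ = 1)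
    (hv : IsSolution α β u₀ T v) (hQ : ∀ v ∈ domH0 d, Q (H0 v) = A (Q v)) :
    ∃ g : ℝ → L2 d, HasWeakDeriv (timeInterval T) v g ∧ ∀ᵐ s ∂(volume.restrict (timeInterval T)),
      (α < 1 → IntervalIntegrable (fun r => (s - r) ^ (-α) • g r) volume 0 s) ∧
        caputo α (fun r => Q (g r)) s = (κ • A) (Q (v s)) := by
  obtain ⟨w, ⟨g, hg, hgw⟩, heq⟩ := hv.equation
  refine ⟨g, hg, ?_⟩
  filter_upwards [hgw, heq, hv.mem_dom] with s ⟨hkernel, hw⟩ heq hdom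
  have hH0 : H0 (v s) = Complex.I ^ (β : ℂ) • w s := by
    rw [neg_smul, neg_add_eq_zero] at heq
    exact heq.symm
  refine ⟨hkernel, ?_⟩
  rw [caputo_map hα1 Q hkernel, smul_apply, ← hQ _ hdom, hH0, map_smul, smul_smul, mul_comm κ, hκ,
    one_smul, hw]

-- A truncated solution solves an ordinary Volterra equation with a bounded operator.
theorem volterra (hα : 0 < α) (hα1 : α ≤ 1) (hκ : Complex.I ^ (β : ℂ) * κ = 1)
    (hv : IsSolution α β u₀ T v) (hQ : ∀ v ∈ domH0 d, Q (H0 v) = A (Q v)) {t : ℝ}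
    (ht : t ∈ timeInterval T) :
    Q (v t) - Q u₀ = (Real.Gamma α)⁻¹ •
      ∫ s in (0 : ℝ)..t, (t - s) ^ (α - 1) • (κ • A) (Q (Function.update v 0 u₀ s)) := by
  obtain ⟨g, hg, hgcap⟩ := hv.exists_hasWeakDeriv_caputo_map hα1 hκ hQ
  have hcap : ∀ᵐ s ∂(volume.restrict (Ioc 0 t)),
      caputo α (fun r => Q (g r)) s = (κ • A) (Q (Function.update v 0 u₀ s)) := by
    filter_upwards [ae_restrict_of_ae_restrict_of_subset (Ioc_subset_timeInterval ht) hgcap,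
      ae_restrict_mem measurableSet_Ioc] with s hs hs0
    rw [Function.update_of_ne hs0.1.ne', hs.2]
  have hQg : IntervalIntegrable (fun s => Q (g s)) volume 0 t := by
    rcases hα1.lt_or_eq with hα1 | rfl
    · obtain ⟨τ, htτ, hτ, -⟩ := exists_gt_of_ae (isOpen_timeInterval T) hgcap ht
      have hgi := intervalIntegrable_of_rpow_smul hα.le ht.1.le htτ.le (hτ hα1)
      exact ⟨Q.integrable_comp hgi.1, Q.integrable_comp hgi.2⟩
    · have hcont : ContinuousOn (fun s => (κ • A) (Q (Function.update v 0 u₀ s))) (Icc 0 t) :=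
        ((κ • A).comp Q).continuous.comp_continuousOn (hv.continuousOn_update ht)
      rw [intervalIntegrable_iff_integrableOn_Ioc_of_le ht.1.le]
      refine (hcont.integrableOn_Icc.mono_set Ioc_subset_Icc_self).congr ?_
      filter_upwards [hcap] with s hs
      rw [← hs, caputo, if_pos rfl]
  have hinc : ∀ s ∈ Ioo 0 t, Q (v t) - Q (v s) = ∫ x in s..t, Q (g x) := fun s hs => by
    have hsub := Icc_subset_timeInterval hs.1 ht
    rw [Q.intervalIntegral_comp_comm ((intervalIntegrable_iff_integrableOn_Icc_of_le hs.2.le).2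
      (hg.2.1.integrableOn_compact_subset hsub isCompact_Icc)), ← map_sub,
      hg.sub_eq_integral (isOpen_timeInterval T) hv.continuousOn hs.2.le hsub]
  rw [sub_eq_integral_of_tendsto (y := fun s => Q (v s)) ht.1 hQg
      ((Q.continuous.tendsto u₀).comp hv.initial) hinc,
    eq_inv_smul_iff₀ (Real.Gamma_pos_of_pos hα).ne', ← integral_rpow_smul_caputo hα hα1 ht.1.le hQg,
    intervalIntegral.integral_of_le ht.1.le, intervalIntegral.integral_of_le ht.1.le]
  refine integral_congr_ae ?_
  filter_upwards [hcap] with s hs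
  rw [hs]

end IsSolution

theorem eq_zero_of_volterra {E : Type*} [NormedAddCommGroup E] [NormedSpace ℝ E]
    [NormedSpace ℂ E] {α b c : ℝ} (hα : 0 < α) (A : E →L[ℂ] E) {e : ℝ → E}
    (he : ContinuousOn e (Icc 0 b))
    (h : ∀ t ∈ Ioc 0 b, e t = c • ∫ s in (0 : ℝ)..t, (t - s) ^ (α - 1) • A (e s)) :
    ∀ t ∈ Ioc 0 b, e t = 0 := by
  obtain ⟨M, hM⟩ := isCompact_Icc.exists_bound_of_continuousOn he
  have hnorm : ∀ t ∈ Ioc 0 b,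
      ‖e t‖ ≤ |c| * ‖A‖ * ∫ s in (0 : ℝ)..t, (t - s) ^ (α - 1) * ‖e s‖ := fun t ht => by
    have hint : IntervalIntegrable (fun s => (t - s) ^ (α - 1) * ‖e s‖) volume 0 t := by
      refine (intervalIntegrable_sub_rpow hα).mul_continuousOn ?_
      rw [uIcc_of_le ht.1.le]
      exact (he.mono (Icc_subset_Icc_right ht.2)).norm
    rw [h t ht, norm_smul, Real.norm_eq_abs, mul_assoc, ← intervalIntegral.integral_const_mul]
    refine mul_le_mul_of_nonneg_left (intervalIntegral.norm_integral_le_of_norm_le ht.1.le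
      (Eventually.of_forall fun s hs => ?_) (hint.const_mul _)) (abs_nonneg c)
    have hkernel := Real.rpow_nonneg (sub_nonneg.2 hs.2) (α - 1)
    rw [norm_smul, Real.norm_of_nonneg hkernel, mul_left_comm]
    exact mul_le_mul_of_nonneg_left (A.le_opNorm (e s)) hkernel
  exact fun t ht => norm_eq_zero.1 (eq_zero_of_le_integral hα (by positivity)
    (fun t _ => norm_nonneg (e t)) (fun t ht => hM t (Ioc_subset_Icc_self ht)) hnorm t ht)

namespace IsSolution

variable {d : ℕ} {α β : ℝ} {κ : ℂ} {u₀ : L2 d} {T : EReal} {u v : ℝ → L2 d}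
  {Q A : L2 d →L[ℂ] L2 d}

theorem map_eq_map (hα : 0 < α) (hα1 : α ≤ 1) (hκ : Complex.I ^ (β : ℂ) * κ = 1)
    (hu : IsSolution α β u₀ T u) (hv : IsSolution α β u₀ T v)
    (hQ : ∀ v ∈ domH0 d, Q (H0 v) = A (Q v)) {b : ℝ} (hb : b ∈ timeInterval T) :
    Q (v b) = Q (u b) := by
  have hcont : ∀ {w}, IsSolution α β u₀ T w →
      ContinuousOn (fun s => Q (Function.update w 0 u₀ s)) (Icc 0 b) := fun hw =>
    Q.continuous.comp_continuousOn (hw.continuousOn_update hb)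
  have hint : ∀ {w}, IsSolution α β u₀ T w → ∀ t ∈ Ioc 0 b, IntervalIntegrable
      (fun s => (t - s) ^ (α - 1) • (κ • A) (Q (Function.update w 0 u₀ s))) volume 0 t :=
    fun hw t ht => by
      refine (intervalIntegrable_sub_rpow hα).smul_continuousOn ?_
      rw [uIcc_of_le ht.1.le]
      exact (κ • A).continuous.comp_continuousOn ((hcont hw).mono (Icc_subset_Icc_right ht.2))
  have hdiff := eq_zero_of_volterra (c := (Real.Gamma α)⁻¹) hα (κ • A)
    ((hcont hv).fun_sub (hcont hu)) (fun t ht => by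
      have htT := Ioc_subset_timeInterval hb ht
      simp only [map_sub, smul_sub]
      rw [intervalIntegral.integral_sub (hint hv t ht) (hint hu t ht), smul_sub,
        ← hv.volterra hα hα1 hκ hQ htT, ← hu.volterra hα hα1 hκ hQ htT,
        Function.update_of_ne ht.1.ne', Function.update_of_ne ht.1.ne', sub_sub_sub_cancel_right])
    b ⟨hb.1, le_rfl⟩
  simpa only [Function.update_of_ne hb.1.ne', sub_eq_zero] using hdiff

theorem unique (hα : 0 < α) (hα1 : α ≤ 1) (hκ : Complex.I ^ (β : ℂ) * κ = 1)
    (hu : IsSolution α β u₀ T u) (hv : IsSolution α β u₀ T v) : EqOn v u (timeInterval T) := by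
  intro b hb
  have hball : ∀ R : ℝ, ∀ᵐ ξ, ‖ξ‖ ≤ R → fourierL2 d (v b - u b) ξ = 0 := fun R => by
    obtain ⟨Q, A, hQ, hQ0⟩ := exists_truncation d R
    exact hQ0 _ (by rw [map_sub, hu.map_eq_map hα hα1 hκ hv hQ hb, sub_self])
  have hfourier : fourierL2 d (v b - u b) = 0 := by
    apply Lp.ext
    filter_upwards [ae_all_iff.2 fun n : ℕ => hball n,
      Lp.coeFn_zero ℂ 2 (volume : Measure (Sp d))] with ξ hξ hzero
    obtain ⟨n, hn⟩ := exists_nat_ge ‖ξ‖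
    rw [hξ n hn, hzero, Pi.zero_apply]
  rw [map_eq_zero_iff _ (fourierL2 d).injective] at hfourier
  exact sub_eq_zero.1 hfourier

end IsSolution

/-! ### The symbol bounds for the three classes of initial data -/

theorem I_cpow_mul_neg_I_cpow (β : ℂ) : Complex.I ^ β * (-Complex.I) ^ β = 1 := by
  rw [Complex.cpow_def_of_ne_zero Complex.I_ne_zero,
    Complex.cpow_def_of_ne_zero (neg_ne_zero.2 Complex.I_ne_zero), ← Complex.exp_add,
    Complex.log_I, Complex.log_neg_I, ← Complex.exp_zero]
  congr 1
  ring

theorem norm_neg_I_cpow (β : ℝ) : ‖(-Complex.I) ^ (β : ℂ)‖ = 1 := by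
  rw [Complex.norm_cpow_of_ne_zero (neg_ne_zero.2 Complex.I_ne_zero)]
  simp

theorem norm_derivSymbol {d : ℕ} (α β : ℝ) {t : ℝ} (ht : 0 ≤ t) (ξ : Sp d) :
    ‖derivSymbol α ((-Complex.I) ^ (β : ℂ)) t ξ‖ = ‖ξ‖ ^ 2 * t ^ (α - 1) *
      ‖mittagLeffler α α ((-Complex.I) ^ (β : ℂ) * ((‖ξ‖ ^ 2 * t ^ α : ℝ) : ℂ))‖ := by
  rw [derivSymbol, norm_mul, norm_mul, norm_neg_I_cpow, one_mul, Complex.norm_real,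
    Real.norm_of_nonneg (by positivity)]

theorem sq_mul_rpow_le {x t γ : ℝ} (a : ℝ) (hx : 0 ≤ x) (ht : 0 ≤ t) (hγ : 1 ≤ γ) :
    x ^ 2 * t ^ a ≤ (t ^ a + 1) * (1 + x ^ (2 * γ)) := by
  rw [mul_comm (t ^ a + 1)]
  gcongr
  · exact sq_le_one_add_rpow hx hγ
  · linarith

theorem cos_nonneg_of_le {α β : ℝ} (hβ : β ∈ Ioc 0 α) : 0 ≤ Real.cos (π * β / (2 * α)) := by
  have hα : 0 < α := hβ.1.trans_le hβ.2
  have hangle : 0 ≤ π * β / (2 * α) :=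
    div_nonneg (mul_nonneg Real.pi_pos.le hβ.1.le) (by positivity)
  refine Real.cos_nonneg_of_neg_pi_div_two_le_of_le (by linarith [Real.pi_pos]) ?_
  rw [div_le_div_iff₀ (by positivity) two_pos]
  nlinarith [mul_le_mul_of_nonneg_left hβ.2 Real.pi_pos.le]

theorem sq_mul_rpow_rpow {α x t : ℝ} (hα : α ≠ 0) (hx : 0 ≤ x) (ht : 0 ≤ t) :
    (x ^ 2 * t ^ α) ^ (1 / α) = x ^ (2 * (1 / α)) * t := by
  rw [Real.mul_rpow (by positivity) (by positivity), ← Real.rpow_mul ht, mul_one_div_cancel hα,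
    Real.rpow_one, ← Real.rpow_natCast, ← Real.rpow_mul hx, Nat.cast_ofNat]

theorem sq_mul_rpow_mul_rpow {α x t : ℝ} (hα : α ≠ 0) (hx : 0 < x) (ht : 0 < t) :
    x ^ 2 * t ^ (α - 1) * (x ^ 2 * t ^ α) ^ ((1 - α) / α) = x ^ (2 * (1 / α)) := by
  have hexp : 1 / α = 1 + (1 - α) / α := by
    field_simp
    ring
  have hmul : (x ^ 2 * t ^ α) * (x ^ 2 * t ^ α) ^ ((1 - α) / α) = x ^ (2 * (1 / α)) * t := by
    rw [← sq_mul_rpow_rpow hα hx.le ht.le, hexp, Real.rpow_add (by positivity), Real.rpow_one]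
  rw [Real.rpow_sub_one ht.ne', ← mul_div_assoc, div_mul_eq_mul_div, hmul,
    mul_div_cancel_right₀ _ ht.ne']

theorem exists_norm_solSymbol_le {α β : ℝ} (hα : α ∈ Ioc 0 1) (hβ : β ∈ Ioc 0 α) :
    ∃ C, 0 ≤ C ∧ ∀ {d : ℕ} (ξ : Sp d) (t : ℝ), 0 ≤ t →
      ‖solSymbol α ((-Complex.I) ^ (β : ℂ)) t ξ‖
        ≤ C * Real.exp (Real.cos (π * β / (2 * α)) * ‖ξ‖ ^ (2 * (1 / α)) * t) := by
  obtain ⟨C, hC, hE⟩ := exists_norm_mittagLeffler_ray_le_add hα hβ (b := 1) ⟨zero_le_one, le_rfl⟩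
  have hinv : 0 ≤ 1 / α := one_div_nonneg.2 hα.1.le
  refine ⟨C + 1 / α + 1, by positivity, fun {d} ξ t ht => ?_⟩
  have hcos := cos_nonneg_of_le hβ
  have hexp : 1 ≤ Real.exp (Real.cos (π * β / (2 * α)) * ‖ξ‖ ^ (2 * (1 / α)) * t) :=
    Real.one_le_exp (by positivity)
  rcases (show 0 ≤ ‖ξ‖ ^ 2 * t ^ α by positivity).eq_or_lt with hr | hr
  · rw [solSymbol, ← hr, Complex.ofReal_zero, mul_zero, mittagLeffler_zero, Real.Gamma_one,
      inv_one, Complex.ofReal_one, norm_one]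
    nlinarith
  · refine (hE _ hr).trans ?_
    rw [sub_self, zero_div, Real.rpow_zero, mul_one, sq_mul_rpow_rpow hα.1.ne' (norm_nonneg ξ) ht,
      ← mul_assoc]
    nlinarith

theorem exists_norm_derivSymbol_le {α β : ℝ} (hα : α ∈ Ioc 0 1) (hβ : β ∈ Ioc 0 α) :
    ∃ C, 0 ≤ C ∧ ∀ {d : ℕ} (ξ : Sp d) (t : ℝ), 0 < t →
      ‖derivSymbol α ((-Complex.I) ^ (β : ℂ)) t ξ‖ ≤ C * (t ^ (α - 1) + 1) *
        Real.exp (Real.cos (π * β / (2 * α)) * ‖ξ‖ ^ (2 * (1 / α)) * t) *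
          (1 + ‖ξ‖ ^ (2 * (1 / α))) := by
  obtain ⟨C, hC, hE⟩ := exists_norm_mittagLeffler_ray_le_add hα hβ ⟨hα.1.le, hα.2⟩
  have hinv : 0 ≤ 1 / α := one_div_nonneg.2 hα.1.le
  refine ⟨C + 1 / α, by positivity, fun {d} ξ t ht => ?_⟩
  have hcos := cos_nonneg_of_le hβ
  rw [norm_derivSymbol α β ht.le]
  rcases (norm_nonneg ξ).eq_or_lt with hξ | hξ
  · rw [← hξ, zero_pow two_ne_zero, zero_mul, zero_mul]
    positivity
  have hr : 0 < ‖ξ‖ ^ 2 * t ^ α := by positivity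
  have hML := hE _ hr
  rw [sq_mul_rpow_rpow hα.1.ne' hξ.le ht.le, ← mul_assoc (Real.cos _)] at hML
  set e := Real.exp (Real.cos (π * β / (2 * α)) * ‖ξ‖ ^ (2 * (1 / α)) * t)
  have he : 1 ≤ e := Real.one_le_exp (by positivity)
  calc ‖ξ‖ ^ 2 * t ^ (α - 1) * ‖mittagLeffler α α _‖
      ≤ ‖ξ‖ ^ 2 * t ^ (α - 1) * (C + 1 / α * (‖ξ‖ ^ 2 * t ^ α) ^ ((1 - α) / α) * e) := by gcongr
    _ = C * (‖ξ‖ ^ 2 * t ^ (α - 1)) * 1 + 1 / α *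
          (‖ξ‖ ^ 2 * t ^ (α - 1) * (‖ξ‖ ^ 2 * t ^ α) ^ ((1 - α) / α)) * e := by ring
    _ = C * (‖ξ‖ ^ 2 * t ^ (α - 1)) * 1 + 1 / α * (1 * ‖ξ‖ ^ (2 * (1 / α))) * e := by
        rw [sq_mul_rpow_mul_rpow hα.1.ne' hξ ht, one_mul]
    _ ≤ C * ((t ^ (α - 1) + 1) * (1 + ‖ξ‖ ^ (2 * (1 / α)))) * e +
          1 / α * ((t ^ (α - 1) + 1) * (1 + ‖ξ‖ ^ (2 * (1 / α)))) * e := by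
        gcongr C * ?_ * ?_ + 1 / α * (?_ * ?_) * e
        · exact sq_mul_rpow_le _ hξ.le ht.le (one_le_one_div hα.1 hα.2)
        · exact le_add_of_nonneg_left (by positivity)
        · exact le_add_of_nonneg_left zero_le_one
    _ = (C + 1 / α) * (t ^ (α - 1) + 1) * e * (1 + ‖ξ‖ ^ (2 * (1 / α))) := by ring

theorem exists_symbolBound_of_lt {α β : ℝ} (hα : α ∈ Ioc 0 1) (hβ1 : β ≤ 1) (hαβ : α < β) :
    ∃ C, 0 < C ∧ ∀ {d : ℕ} (h : L2 d),
      MemLp (fun ξ : Sp d => ((‖ξ‖ ^ (2 * 1 : ℝ) : ℝ) : ℂ) * h ξ) 2 volume →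
        SymbolBound α 1 C 0 ((-Complex.I) ^ (β : ℂ)) h := by
  obtain ⟨C₁, hC₁⟩ := exists_norm_mittagLeffler_ray_le hα.1 hβ1 hαβ 1
  obtain ⟨C₂, hC₂⟩ := exists_norm_mittagLeffler_ray_le hα.1 hβ1 hαβ α
  have hC : 0 < |C₁| + |C₂| + 1 := by positivity
  refine ⟨|C₁| + |C₂| + 1, hC, fun {d} h hh => ⟨hα.1, hα.2, le_rfl, hC.le, le_rfl, hh,
    Eventually.of_forall fun ξ _ t ht => ?_, Eventually.of_forall fun ξ _ t ht => ?_⟩⟩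
  · rw [zero_mul, Real.exp_zero, mul_one, solSymbol]
    linarith [hC₁ (‖ξ‖ ^ 2 * t ^ α) (by positivity), le_abs_self C₁, abs_nonneg C₂]
  · have hML := hC₂ (‖ξ‖ ^ 2 * t ^ α) (by positivity)
    rw [zero_mul, Real.exp_zero, mul_one, norm_derivSymbol α β ht.le, mul_comm,
      mul_assoc]
    refine mul_le_mul ?_ (sq_mul_rpow_le _ (norm_nonneg ξ) ht.le le_rfl) (by positivity) hC.le
    linarith [le_abs_self C₂, abs_nonneg C₁]

theorem exists_symbolBound_of_le {α β : ℝ} (hα : α ∈ Ioc 0 1) (hβ : β ∈ Ioc 0 α) :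
    ∃ C, 0 < C ∧ ∀ {d : ℕ} (h : L2 d) (X : ℝ), 0 ≤ X →
      MemLp (fun ξ : Sp d => ((‖ξ‖ ^ (2 * (1 / α)) : ℝ) : ℂ) * h ξ) 2 volume →
      (∀ᵐ ξ, h ξ ≠ 0 → Real.cos (π * β / (2 * α)) * ‖ξ‖ ^ (2 * (1 / α)) ≤ X) →
        SymbolBound α (1 / α) C X ((-Complex.I) ^ (β : ℂ)) h := by
  obtain ⟨C₁, hC₁, hsol⟩ := exists_norm_solSymbol_le hα hβ
  obtain ⟨C₂, hC₂, hderiv⟩ := exists_norm_derivSymbol_le hα hβ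
  have hC : 0 < C₁ + C₂ + 1 := by positivity
  refine ⟨C₁ + C₂ + 1, hC, fun {d} h X hX hh hrate =>
    ⟨hα.1, hα.2, one_le_one_div hα.1 hα.2, hC.le, hX, hh, ?_, ?_⟩⟩
  · filter_upwards [hrate] with ξ hξ h0 t ht
    refine (hsol ξ t ht).trans ?_
    gcongr
    · linarith
    · exact hξ h0
  · filter_upwards [hrate] with ξ hξ h0 t ht
    refine (hderiv ξ t ht).trans ?_
    gcongr
    · linarith
    · exact hξ h0

theorem suppL2_subset {d : ℕ} {f : Sp d → ℂ} {h : L2 d} (hf : (h : Sp d → ℂ) =ᵐ[volume] f) :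
    suppL2 h ⊆ tsupport f := fun ξ hξ => by
  by_contra hξf
  obtain ⟨r, hr, hsub⟩ := Metric.isOpen_iff.1 (isClosed_tsupport f).isOpen_compl ξ hξf
  refine hξ r hr ?_
  filter_upwards [ae_restrict_of_ae hf, ae_restrict_mem measurableSet_ball] with x hx hball
  rw [hx, Pi.zero_apply]
  exact image_eq_zero_of_notMem_tsupport (hsub hball)

theorem ae_mem_suppL2 {d : ℕ} (h : L2 d) : ∀ᵐ ξ, h ξ ≠ 0 → ξ ∈ suppL2 h := by
  rw [ae_iff]
  refine measure_null_of_locally_null _ fun ξ hξ => ?_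
  simp only [suppL2, mem_ofPred_eq, Classical.not_imp, not_forall, not_not] at hξ
  obtain ⟨-, r, hr, hball⟩ := hξ
  refine ⟨{x | ¬(h x ≠ 0 → x ∈ suppL2 h)} ∩ Metric.ball ξ r,
    inter_mem self_mem_nhdsWithin (mem_nhdsWithin_of_mem_nhds (Metric.ball_mem_nhds ξ hr)), ?_⟩
  refine measure_mono_null (fun x hx => ?_)
    (ae_iff.1 ((ae_restrict_iff' measurableSet_ball).1 hball))
  simp only [mem_inter_iff, mem_ofPred_eq, Classical.not_imp] at hx ⊢
  exact ⟨hx.2, hx.1.1⟩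

theorem freqRadius_nonneg {d : ℕ} (u₀ : L2 d) : 0 ≤ freqRadius u₀ := by
  refine Real.sSup_nonneg ?_
  rintro _ ⟨ξ, -, rfl⟩
  exact norm_nonneg ξ

theorem norm_le_freqRadius {d : ℕ} {u₀ : L2 d} (hu₀ : u₀ ∈ fourierC0 d) :
    ∀ᵐ ξ, fourierL2 d u₀ ξ ≠ 0 → ‖ξ‖ ≤ freqRadius u₀ := by
  obtain ⟨f, -, hfc, hf⟩ := hu₀
  have hbdd : BddAbove ((fun ξ : Sp d => ‖ξ‖) '' suppL2 (fourierL2 d u₀)) :=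
    (hfc.isCompact.bddAbove_image continuous_norm.continuousOn).mono
      (image_mono (suppL2_subset hf))
  filter_upwards [ae_mem_suppL2 (fourierL2 d u₀)] with ξ hsupp hne
  exact le_csSup hbdd (mem_image_of_mem _ (hsupp hne))

theorem fourierC0_subset_domH0pow (d : ℕ) {γ : ℝ} (hγ : 0 ≤ γ) :
    fourierC0 d ⊆ domH0pow d γ := by
  rintro v ⟨f, hfc, hfs, hf⟩
  have hpow : Continuous fun ξ : Sp d => ((‖ξ‖ ^ (2 * γ) : ℝ) : ℂ) :=
    Complex.continuous_ofReal.comp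
      ((Real.continuous_rpow_const (by positivity)).comp continuous_norm)
  refine (memLp_congr_ae ?_).1 ((hpow.mul hfc).memLp_of_hasCompactSupport hfs.mul_left)
  filter_upwards [hf] with ξ hξ
  rw [Pi.mul_apply, hξ]

theorem norm_rpow_two_mul_one {E : Type*} [Norm E] (x : E) : ‖x‖ ^ (2 * 1 : ℝ) = ‖x‖ ^ 2 := by
  rw [mul_one, Real.rpow_two]

theorem memLp_of_mem_domH0 {d : ℕ} {v : L2 d} (hv : v ∈ domH0 d) :
    MemLp (fun ξ : Sp d => ((‖ξ‖ ^ (2 * 1 : ℝ) : ℝ) : ℂ) * fourierL2 d v ξ) 2 volume := by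
  simp_rw [norm_rpow_two_mul_one]
  exact mem_domH0_iff.1 hv

theorem normH0_eq {d : ℕ} {v : L2 d} (hv : v ∈ domH0 d) :
    normH0 v = Real.sqrt (‖fourierL2 d v‖ ^ 2 +
      ‖mulL2 (fun ξ : Sp d => ((‖ξ‖ ^ (2 * 1 : ℝ) : ℝ) : ℂ)) (fourierL2 d v)‖ ^ 2) := by
  have hH0 : fourierL2 d (H0 v)
      = mulL2 (fun ξ : Sp d => ((‖ξ‖ ^ (2 * 1 : ℝ) : ℝ) : ℂ)) (fourierL2 d v) := by
    apply Lp.ext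
    filter_upwards [fourierL2_H0 hv, mulL2_ae (memLp_of_mem_domH0 hv)] with ξ hξ hmul
    rw [hξ, hmul, norm_rpow_two_mul_one]
  rw [normH0, ← hH0, LinearIsometryEquiv.norm_map, LinearIsometryEquiv.norm_map]

theorem normH0pow_eq {d : ℕ} (γ : ℝ) (v : L2 d) :
    normH0pow γ v = Real.sqrt (‖fourierL2 d v‖ ^ 2 +
      ‖mulL2 (fun ξ : Sp d => ((‖ξ‖ ^ (2 * γ) : ℝ) : ℂ)) (fourierL2 d v)‖ ^ 2) := by
  rw [normH0pow, H0pow, LinearIsometryEquiv.norm_map, LinearIsometryEquiv.norm_map]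

theorem exists_symbolBound {α β : ℝ} (hα : α ∈ Ioc 0 1) (hβ : β ∈ Ioc 0 1) :
    ∃ C, 0 < C ∧ ∀ {d : ℕ}, ∀ u₀ ∈ initialSpace d α β, ∃ γ X : ℝ,
      SymbolBound α γ C X ((-Complex.I) ^ (β : ℂ)) (fourierL2 d u₀) ∧
      initialNorm α β u₀ = Real.sqrt (‖fourierL2 d u₀‖ ^ 2 +
        ‖mulL2 (fun ξ : Sp d => ((‖ξ‖ ^ (2 * γ) : ℝ) : ℂ)) (fourierL2 d u₀)‖ ^ 2) ∧
      (α ≤ β → X = 0) ∧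
      (β < α → X = Real.cos (π * β / (2 * α)) * freqRadius u₀ ^ (2 / α)) := by
  rcases lt_or_ge α β with hαβ | hβα
  · obtain ⟨C, hC, hbound⟩ := exists_symbolBound_of_lt hα hβ.2 hαβ
    refine ⟨C, hC, fun {d} u₀ hu₀ => ?_⟩
    rw [initialSpace, if_pos hαβ] at hu₀
    refine ⟨1, 0, hbound _ (memLp_of_mem_domH0 hu₀), ?_, fun _ => rfl,
      fun hlt => absurd hlt hαβ.not_gt⟩
    rw [initialNorm, if_pos hαβ, normH0_eq hu₀]
  · obtain ⟨C, hC, hbound⟩ := exists_symbolBound_of_le hα ⟨hβ.1, hβα⟩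
    refine ⟨C, hC, fun {d} u₀ hu₀ => ?_⟩
    rw [initialSpace, if_neg hβα.not_gt] at hu₀
    rw [initialNorm, if_neg hβα.not_gt, normH0pow_eq]
    rcases hβα.eq_or_lt with rfl | hlt
    · rw [if_pos rfl] at hu₀
      have hcos : Real.cos (π * β / (2 * β)) = 0 := by
        rw [mul_div_mul_right _ _ hα.1.ne', Real.cos_pi_div_two]
      refine ⟨1 / β, 0, hbound _ 0 le_rfl hu₀ (Eventually.of_forall fun ξ _ => ?_), rfl,
        fun _ => rfl, fun hlt => absurd hlt (lt_irrefl _)⟩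
      rw [hcos, zero_mul]
    · rw [if_neg hlt.ne'] at hu₀
      have hcos := cos_nonneg_of_le ⟨hβ.1, hβα⟩
      refine ⟨1 / α, _, hbound _ _ (mul_nonneg hcos (Real.rpow_nonneg (freqRadius_nonneg u₀) _))
        (fourierC0_subset_domH0pow d (one_div_nonneg.2 hα.1.le) hu₀) ?_, rfl,
        fun hle => absurd hlt hle.not_gt, fun _ => rfl⟩
      filter_upwards [norm_le_freqRadius hu₀] with ξ hξ hne
      rw [mul_one_div]
      exact mul_le_mul_of_nonneg_left (Real.rpow_le_rpow (norm_nonneg ξ) (hξ hne)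
        (div_nonneg zero_le_two hα.1.le)) hcos

end TFSE

end

theorem proposition2p1 (d : ℕ) (hd : 1 ≤ d) (α β : ℝ) (hα : 0 < α) (hα1 : α ≤ 1)
    (hβ : 0 < β) (hβ1 : β ≤ 1) :
    ∃ C : ℝ, 0 < C ∧ ∀ u₀ ∈ TFSE.initialSpace d α β, ∃ u : ℝ → TFSE.L2 d,
      -- existence and uniqueness, on `(0,∞)` (`T = ⊤`) and on every `(0,T)`
      (∀ T : EReal, 0 < T → TFSE.IsSolution α β u₀ T u ∧
        ∀ v : ℝ → TFSE.L2 d, TFSE.IsSolution α β u₀ T v →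
          EqOn v u (TFSE.timeInterval T)) ∧
      -- the formula for the solution
      (∀ t : ℝ, 0 ≤ t →
        MemLp (fun ξ : TFSE.Sp d =>
          TFSE.mittagLeffler α 1 ((-Complex.I) ^ (β : ℂ) * ((‖ξ‖ ^ 2 * t ^ α : ℝ) : ℂ)) *
            TFSE.fourierL2 d u₀ ξ) 2 volume ∧
        u t = (TFSE.fourierL2 d).symm (TFSE.mulL2 (fun ξ : TFSE.Sp d =>
          TFSE.mittagLeffler α 1 ((-Complex.I) ^ (β : ℂ) * ((‖ξ‖ ^ 2 * t ^ α : ℝ) : ℂ)))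
            (TFSE.fourierL2 d u₀))) ∧
      -- regularity and norm estimates
      ∀ T : ℝ, 0 < T →
        TFSE.MemCDom T u ∧ TFSE.MemW11 T u ∧
        (α ≤ β → TFSE.eNormCDom T u + TFSE.eNormW11 T u ≤
          ENNReal.ofReal (C * (1 + T) * TFSE.initialNorm α β u₀)) ∧
        (β < α → TFSE.eNormCDom T u + TFSE.eNormW11 T u ≤
          ENNReal.ofReal (C * (1 + T) *
            Real.exp (Real.cos (Real.pi * β / (2 * α)) *
              TFSE.freqRadius u₀ ^ (2 / α) * T) * TFSE.initialNorm α β u₀)) := by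
  obtain ⟨C, hC, hdata⟩ := TFSE.exists_symbolBound ⟨hα, hα1⟩ ⟨hβ, hβ1⟩
  refine ⟨C * (6 + 2 / α), by positivity, fun u₀ hu₀ => ?_⟩
  obtain ⟨γ, X, B, hnorm, hrate_le, hrate_lt⟩ := hdata u₀ hu₀
  have hκ := TFSE.I_cpow_mul_neg_I_cpow β
  refine ⟨TFSE.sol α ((-Complex.I) ^ (β : ℂ)) (TFSE.fourierL2 d u₀), fun T _ => ?_,
    fun t ht => ⟨B.memLp_sol ht, rfl⟩, fun T hT => ?_⟩
  · have hsol := B.isSolution_sol hκ T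
    rw [LinearIsometryEquiv.symm_apply_apply] at hsol
    exact ⟨hsol, fun v hv => hsol.unique hα hα1 hκ hv⟩
  have hle := B.eNorm_sol_le hT
  rw [← hnorm] at hle
  refine ⟨B.memCDom_sol T, B.memW11_sol hT, fun hαβ => ?_, fun hβα => ?_⟩
  · rwa [hrate_le hαβ, zero_mul, Real.exp_zero, mul_one] at hle
  · rwa [hrate_lt hβα] at hle
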